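/- **Conventions.** Let $(X,\mathrm{dist})$ be a metric space and let $k,z\ge 1$ be integers. For $q\in X$ and a $k$-tuple of centers $S\in X^k$ (repetitions allowed) put $\mathrm{cost}(q,S)=\min_{s\in S}\mathrm{dist}(q,s)^z$; for a finite $P\subseteq X$ put $\mathrm{cost}(P,S)=\sum_{p\in P}\mathrm{cost}(p,S)$. A solution $\mathcal A\in X^k$ is an $\alpha$-approximation for $(k,z)$-clustering on $P$ if $\mathrm{cost}(P,\mathcal A)\le\alpha\,\mathrm{cost}(P,S)$ for all $S\in X^k$. A finite set $\mathbb C\subseteq X$ is an *$\mathcal A$-approximate centroid set* with precision $\varepsilon$ for $(k,z)$-clustering on $P$ if for every $S\in X^k$ there is $\tilde S\in\mathbb C^k$ such that every $p\in P$ with $\mathrm{cost}(p,S)\le(8z/\varepsilon)^z\,\mathrm{cost}(p,\mathcal A)$ or $\mathrm{cost}(p,\tilde S)\le(8z/\varepsilon)^z\,\mathrm{cost}(p,\mathcal A)$ satisfies $$|\mathrm{cost}(p,S)-\mathrm{cost}(p,\tilde S)|\le\frac{\varepsilon}{z\log(z/\varepsilon)}\bigl(\mathrm{cost}(p,S)+\mathrm{cost}(p,\mathcal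 A)\bigr).$$ A finite set $\Omega\subseteq X$ with weights $w:\Omega\to(0,\infty)$ is a (positively weighted) *$\eta$-coreset* of $P$ if for all $S\in X^k$ $$\Bigl|\mathrm{cost}(P,S)-\sum_{q\in\Omega}w(q)\,\mathrm{cost}(q,S)\Bigr|\le\eta\,\mathrm{cost}(P,S).$$ Algorithms are programs for a randomized random-access machine over integers and reals, in which arithmetic on integers and reals, $\exp$, $\log$, $\lfloor\cdot\rfloor$, comparisons, memory accesses (with indirect addressing), and drawing an independent uniform random element of $[0,1]$ each take one step. **Theorem.** For every constant $\alpha\ge1$ there are a program and a constant $C>0$, both depending only on $\alpha$, such that the following holds. Let $(X,\mathrm{dist})$ be a metric space, $P\subseteq X$ a set of $n\ge1$ distinct clients, $k,z\ge1$ integers, $0<\varepsilon<1/3$ and $0<\pi<1$. Let $\mathcal A\in X^k$ be an $\alpha$-approximation for $(k,z)$-clustering on $P$, and suppose that there is a finite $\mathcal A$-approximate centroid set $\mathbb C$ with precision $\varepsilon$ for $(k,z)$-clustering on $P$. Given $n,k,z,|\mathbb C|,\varepsilon,\pi$ and, for each client, (the index of) a nearest center in $\mathcal A$ and its distance to it,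 the program always halts within $C\cdot n$ steps, and with probability at least $1-\pi$ it outputs a positively weighted $C\varepsilon$-coreset $\Omega\subseteq P\cup\mathcal A$ of $P$ for $(k,z)$-clustering, of size $$|\Omega|\le C\cdot\frac{2^{C z\log z}\,\log^4(1/\varepsilon)}{\min(\varepsilon^2,\varepsilon^z)}\Bigl(k\log|\mathbb C|+\log\log(1/\varepsilon)+\log(1/\pi)\Bigr).$$ -/

import Mathlib

open MeasureTheory

/-! ## The clustering problem -/

namespace Clustering

/-- `cost(q, S)`: the `z`-th power of the distance from `q` to the nearest of the `k` centers
of `S` (a `k`-tuple, so that repetitions are allowed; only used for `1 ≤ k`). -/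
noncomputable def ptCost {X : Type*} [MetricSpace X] {k : ℕ} (z : ℕ) (q : X)
    (S : Fin k → X) : ℝ :=
  ⨅ i, dist q (S i) ^ z

/-- Cost of the weighted finite set `(Q, w)` for the centers `S`. -/
noncomputable def wCost {X : Type*} [MetricSpace X] {k : ℕ} (z : ℕ) (Q : Finset X)
    (w : X → ℝ) (S : Fin k → X) : ℝ :=
  ∑ q ∈ Q, w q * ptCost z q S

/-- Cost of the unweighted finite set `P` for the centers `S`. -/
noncomputable def cost {X : Type*} [MetricSpace X] {k : ℕ} (z : ℕ) (P : Finset X)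
    (S : Fin k → X) : ℝ :=
  ∑ p ∈ P, ptCost z p S

/-- `A` is an `α`-approximate solution of `(k, z)`-clustering on `P`. -/
def IsApproxSolution {X : Type*} [MetricSpace X] {k : ℕ} (z : ℕ) (α : ℝ) (P : Finset X)
    (A : Fin k → X) : Prop :=
  ∀ S : Fin k → X, cost z P A ≤ α * cost z P S

/-- `K` is an `A`-approximate centroid set for `(k, z)`-clustering on `P`, with
precision `ε`. -/
def IsApproxCentroidSet {X : Type*} [MetricSpace X] {k : ℕ} (z : ℕ) (ε : ℝ) (P : Finset X)
    (A : Fin k → X) (K : Finset X) : Prop :=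
  ∀ S : Fin k → X, ∃ S' : Fin k → X, (∀ i, S' i ∈ K) ∧
    ∀ p ∈ P,
      (ptCost z p S ≤ (8 * z / ε) ^ z * ptCost z p A ∨
        ptCost z p S' ≤ (8 * z / ε) ^ z * ptCost z p A) →
      |ptCost z p S - ptCost z p S'| ≤
        ε / (z * Real.log (z / ε)) * (ptCost z p S + ptCost z p A)

/-- The weighted finite set `(Ω, w)`, with positive weights, is an `η`-coreset of `P` for
`(k, z)`-clustering. -/
def IsCoreset {X : Type*} [MetricSpace X] (k z : ℕ) (η : ℝ) (P Ω : Finset X)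
    (w : X → ℝ) : Prop :=
  (∀ q ∈ Ω, 0 < w q) ∧
    ∀ S : Fin k → X, |cost z P S - wCost z Ω w S| ≤ η * cost z P S

/-- `c` assigns to each client (the clients being numbered by `e`) a nearest center of `A`. -/
def IsNearest {X : Type*} [MetricSpace X] {k n : ℕ} {P : Finset X} (e : Fin n ≃ P)
    (A : Fin k → X) (c : Fin n → Fin k) : Prop :=
  ∀ i j, dist (e i : X) (A (c i)) ≤ dist (e i : X) (A j)

end Clustering

/-! ## A randomized real random-access machine with a step count

Programs are finite texts in a structured imperative language.  The memory consists of banks of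
integer cells and banks of real cells, with indirect addressing inside a bank.  Every arithmetic
operation, comparison, memory access and random draw costs one step. -/

namespace RealRAM

/-- A memory state: integer cells, real cells (bank, address), and the number of random
reals that have been drawn so far. -/
structure State where
  int : ℕ → ℤ → ℤ
  real : ℕ → ℤ → ℝ
  drawn : ℕ

mutual
/-- Integer expressions. -/
inductive IntExpr : Type
  | const : ℤ → IntExpr
  /-- the integer cell of a given bank at a computed address -/
  | get : ℕ → IntExpr → IntExpr
  | add : IntExpr → IntExpr → IntExpr
  | sub : IntExpr → IntExpr → IntExpr
  | mul : IntExpr → IntExpr → IntExpr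
  | floor : RealExpr → IntExpr
/-- Real expressions. -/
inductive RealExpr : Type
  | cast : IntExpr → RealExpr
  /-- the real cell of a given bank at a computed address -/
  | get : ℕ → IntExpr → RealExpr
  | add : RealExpr → RealExpr → RealExpr
  | sub : RealExpr → RealExpr → RealExpr
  | mul : RealExpr → RealExpr → RealExpr
  | div : RealExpr → RealExpr → RealExpr
  | exp : RealExpr → RealExpr
  | log : RealExpr → RealExpr
end

/-- Boolean expressions. -/
inductive BoolExpr : Type
  | leInt : IntExpr → IntExpr → BoolExpr
  | leReal : RealExpr → RealExpr → BoolExpr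
  | not : BoolExpr → BoolExpr
  | and : BoolExpr → BoolExpr → BoolExpr

mutual
/-- The value of an integer expression in a state. -/
noncomputable def IntExpr.eval (s : State) : IntExpr → ℤ
  | .const m => m
  | .get b a => s.int b (a.eval s)
  | .add a b => a.eval s + b.eval s
  | .sub a b => a.eval s - b.eval s
  | .mul a b => a.eval s * b.eval s
  | .floor a => ⌊a.eval s⌋
/-- The value of a real expression in a state. -/
noncomputable def RealExpr.eval (s : State) : RealExpr → ℝ
  | .cast a => (a.eval s : ℝ)
  | .get b a => s.real b (a.eval s)
  | .add a b => a.eval s + b.eval s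
  | .sub a b => a.eval s - b.eval s
  | .mul a b => a.eval s * b.eval s
  | .div a b => a.eval s / b.eval s
  | .exp a => Real.exp (a.eval s)
  | .log a => Real.log (a.eval s)
end

/-- The truth of a boolean expression in a state. -/
def BoolExpr.eval (s : State) : BoolExpr → Prop
  | .leInt a b => a.eval s ≤ b.eval s
  | .leReal a b => a.eval s ≤ b.eval s
  | .not a => ¬ a.eval s
  | .and a b => a.eval s ∧ b.eval s

mutual
/-- The number of steps for evaluating an integer expression: one per node. -/
def IntExpr.steps : IntExpr → ℕ
  | .const _ => 1
  | .get _ a => a.steps + 1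
  | .add a b => a.steps + b.steps + 1
  | .sub a b => a.steps + b.steps + 1
  | .mul a b => a.steps + b.steps + 1
  | .floor a => a.steps + 1
/-- The number of steps for evaluating a real expression: one per node. -/
def RealExpr.steps : RealExpr → ℕ
  | .cast a => a.steps + 1
  | .get _ a => a.steps + 1
  | .add a b => a.steps + b.steps + 1
  | .sub a b => a.steps + b.steps + 1
  | .mul a b => a.steps + b.steps + 1
  | .div a b => a.steps + b.steps + 1
  | .exp a => a.steps + 1
  | .log a => a.steps + 1
end

/-- The number of steps for evaluating a boolean expression: one per node. -/
def BoolExpr.steps : BoolExpr → ℕ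
  | .leInt a b => a.steps + b.steps + 1
  | .leReal a b => a.steps + b.steps + 1
  | .not a => a.steps + 1
  | .and a b => a.steps + b.steps + 1

/-- Programs. -/
inductive Prog
  | skip : Prog
  /-- write an integer into a bank at a computed address -/
  | putInt : ℕ → IntExpr → IntExpr → Prog
  /-- write a real into a bank at a computed address -/
  | putReal : ℕ → IntExpr → RealExpr → Prog
  /-- write a fresh uniform random element of `[0, 1]` into a real bank -/
  | draw : ℕ → IntExpr → Prog
  | seq : Prog → Prog → Prog
  | cond : BoolExpr → Prog → Prog → Prog
  | loop : BoolExpr → Prog → Prog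

/-- The state after writing the integer `v` into cell `a` of integer bank `b`. -/
def State.setInt (s : State) (b : ℕ) (a v : ℤ) : State :=
  { s with int := Function.update s.int b (Function.update (s.int b) a v) }

/-- The state after writing the real `v` into cell `a` of real bank `b`. -/
def State.setReal (s : State) (b : ℕ) (a : ℤ) (v : ℝ) : State :=
  { s with real := Function.update s.real b (Function.update (s.real b) a v) }

/-- `Runs ω p s s' t`: with the sequence `ω` of random reals, the program `p` started in the
state `s` halts in the state `s'` after exactly `t` steps. -/
inductive Runs (ω : ℕ → unitInterval) : Prog → State → State → ℕ → Prop
  | skip (s : State) : Runs ω .skip s s 1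
  | putInt (s : State) (b : ℕ) (a v : IntExpr) :
      Runs ω (.putInt b a v) s (s.setInt b (a.eval s) (v.eval s)) (a.steps + v.steps + 1)
  | putReal (s : State) (b : ℕ) (a : IntExpr) (v : RealExpr) :
      Runs ω (.putReal b a v) s (s.setReal b (a.eval s) (v.eval s)) (a.steps + v.steps + 1)
  | draw (s : State) (b : ℕ) (a : IntExpr) :
      Runs ω (.draw b a) s
        { s.setReal b (a.eval s) (ω s.drawn) with drawn := s.drawn + 1 } (a.steps + 1)
  | seq {p q : Prog} {s s' s'' : State} {t t' : ℕ} :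
      Runs ω p s s' t → Runs ω q s' s'' t' → Runs ω (.seq p q) s s'' (t + t')
  | condTrue {b : BoolExpr} {p q : Prog} {s s' : State} {t : ℕ} :
      b.eval s → Runs ω p s s' t → Runs ω (.cond b p q) s s' (b.steps + t + 1)
  | condFalse {b : BoolExpr} {p q : Prog} {s s' : State} {t : ℕ} :
      ¬ b.eval s → Runs ω q s s' t → Runs ω (.cond b p q) s s' (b.steps + t + 1)
  | loopTrue {b : BoolExpr} {p : Prog} {s s' s'' : State} {t t' : ℕ} :
      b.eval s → Runs ω p s s' t → Runs ω (.loop b p) s' s'' t' →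
      Runs ω (.loop b p) s s'' (b.steps + t + t' + 1)
  | loopFalse {b : BoolExpr} {p : Prog} {s : State} :
      ¬ b.eval s → Runs ω (.loop b p) s s (b.steps + 1)

/-- The law of the sequence of random reals: independent and uniform on `[0, 1]`. -/
noncomputable def coins : Measure (ℕ → unitInterval) :=
  Measure.infinitePi fun _ => (volume : Measure unitInterval)

end RealRAM

/-! ## Input and output of a coreset algorithm -/

namespace Clustering

open RealRAM

/-- The initial state.  Integer bank `0` holds `n, k, z, m` (with `m` the size of the centroid
set), integer bank `1` the number of a nearest center for each of the `n` clients, real bank `0`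
holds `ε, π`, and real bank `1` the distances of the clients to their nearest center.  All other
cells hold zero. -/
noncomputable def inputState {X : Type*} [MetricSpace X] {k n : ℕ} {P : Finset X} (z m : ℕ)
    (ε π : ℝ) (e : Fin n ≃ P) (A : Fin k → X) (c : Fin n → Fin k) : State where
  int b a :=
    if b = 0 then
      (if a = 0 then n else if a = 1 then k else if a = 2 then z else if a = 3 then m else 0)
    else if b = 1 then
      (if h : 0 ≤ a ∧ a.toNat < n then ((c ⟨a.toNat, h.2⟩ : ℕ) : ℤ) else 0)
    else 0
  real b a :=
    if b = 0 then (if a = 0 then ε else if a = 1 then π else 0)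
    else if b = 1 then
      (if h : 0 ≤ a ∧ a.toNat < n then
        dist (e ⟨a.toNat, h.2⟩ : X) (A (c ⟨a.toNat, h.2⟩)) else 0)
    else 0
  drawn := 0

/-- The label `ℓ` names the point `x`: the labels `0, …, n - 1` name the clients, and the labels
`n, …, n + k - 1` name the centers of `A`. -/
def Names {X : Type*} {k n : ℕ} {P : Finset X} (e : Fin n ≃ P) (A : Fin k → X) (ℓ : ℤ)
    (x : X) : Prop :=
  (∃ i : Fin n, ℓ = (i : ℕ) ∧ x = e i) ∨ (∃ j : Fin k, ℓ = n + (j : ℕ) ∧ x = A j)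

open Classical in
/-- The state `s` holds the weighted set `(Ω, w)` as output: integer cell `0` of bank `2` is the
length `L` of a list whose `j`-th entry consists of a label (integer bank `3`) and a weight
(real bank `2`); `Ω` is the set of the listed points, and the weights of repeated points add up. -/
def IsOutput {X : Type*} {k n : ℕ} {P : Finset X} (e : Fin n ≃ P) (A : Fin k → X)
    (s : State) (Ω : Finset X) (w : X → ℝ) : Prop :=
  ∃ (L : ℕ) (x : Fin L → X), s.int 2 0 = L ∧
    (∀ j : Fin L, Names e A (s.int 3 ((j : ℕ) : ℤ)) (x j)) ∧
    Ω = Finset.univ.image x ∧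
    ∀ y, w y = ∑ j : Fin L with x j = y, s.real 2 ((j : ℕ) : ℤ)

/-- The size bound, with `O`-constant `C`. -/
noncomputable def sizeBound (C : ℝ) (k z m : ℕ) (ε π : ℝ) : ℝ :=
  C * ((2 : ℝ) ^ (C * z * Real.log z) * Real.log (1 / ε) ^ 4 / min (ε ^ 2) (ε ^ z)) *
    (k * Real.log m + Real.log (Real.log (1 / ε)) + Real.log (1 / π))

end Clustering

-- The coreset is obtained by stratified importance sampling. Let d be the distance of a client to
-- its center in `A`, x = d^z, and compare x with the average cost avg of its cluster. With Θ =
-- (6z/ε)^(2z), a client is inner if x ≤ avg/Θ, outer if x > Θ·avg, and main otherwise; main clients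
-- of a cluster are split into classes in which x varies by a factor less than 3. Next-fit packs the
-- clients of every cluster and class into bins. The weights are 1 for inner clients, a constant of
-- the class comparable to x for main clients, and x for outer clients. The inner clients of a
-- cluster share one bin; any other bin with at least two clients has load at most T = cost(P,
-- A)/samples. One client is drawn from each bin, with probability proportional to its weight, and
-- receives the weight load/wt, so every sum is estimated without bias. Next-fit opens few bins
-- (`NextFit.card_openers_le`), and three linear passes do all the work.
--
-- Fix a solution S, with distances a. Part of the estimate is correct for every outcome of the
-- random numbers. Inner clients are almost at their center, so their costs differ by amounts
-- charged to avg (`Packing.inner_abs_le`). In a main bin far from S all costs nearly agree. For an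
-- outer client far from S, most of its cluster is closer to the center and therefore about as far
-- from S, so the cost of the client is at most ε times its share of the cost of the cluster
-- (`Packing.le_of_outer_of_notMem_good`). The other clients are called good. On them, the squared
-- width of the contribution of a bin is at most spread·T times the cost of the bin for S and `A`
-- (`Packing.sq_sub_le`), and Hoeffding's inequality over the independent bins bounds the failure
-- probability (`coins_estimate_le`).
--
-- The union bound runs only over the tuples S' of the centroid set. For arbitrary S with
-- approximant S', the good set is defined by S'. On it the estimate transfers from S' to S
-- (`Packing.near_of_mem_good`); off it, far from S' implies far from S (`Approximates.le_of_lt`),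
-- and the deterministic bounds apply to S itself. `Packing.est_abs_sub_le` combines both into an
-- error O(ε)(cost(P, S) + cost(P, A)), and cost(P, A) ≤ α cost(P, S).

namespace NextFit

-- Next-fit packing and the number of its bins.

open Finset

/-- The state of the next-fit packing: the open bin of every key (`0` if there is none) and the
current load of every bin. -/
structure Bins where
  lead : ℤ → ℕ
  load : ℕ → ℝ

open Classical in
/-- The bin that receives the item `i`: the open bin of its key if the item fits, and otherwise
the new bin `i + 1`. -/
noncomputable def binOf (key : ℕ → ℤ) (s : ℕ → ℝ) (cap : ℤ → ℝ) (σ : Bins) (i : ℕ) : ℕ :=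
  if 1 ≤ σ.lead (key i) ∧ σ.load (σ.lead (key i)) + s i ≤ cap (key i) then σ.lead (key i)
  else i + 1

/-- The packing of the first `i` items. -/
noncomputable def bins (key : ℕ → ℤ) (s : ℕ → ℝ) (cap : ℤ → ℝ) : ℕ → Bins
  | 0 => ⟨fun _ => 0, fun _ => 0⟩
  | i + 1 =>
    let σ := bins key s cap i
    let L := binOf key s cap σ i
    ⟨Function.update σ.lead (key i) L, Function.update σ.load L (σ.load L + s i)⟩

/-- The bin of the item `i`. -/
noncomputable def bin (key : ℕ → ℤ) (s : ℕ → ℝ) (cap : ℤ → ℝ) (i : ℕ) : ℕ :=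
  binOf key s cap (bins key s cap i) i

variable {key : ℕ → ℤ} {s : ℕ → ℝ} {cap : ℤ → ℝ}

theorem lead_succ (i : ℕ) : (bins key s cap (i + 1)).lead =
    Function.update (bins key s cap i).lead (key i) (bin key s cap i) := rfl

theorem load_succ (i : ℕ) : (bins key s cap (i + 1)).load =
    Function.update (bins key s cap i).load (bin key s cap i)
      ((bins key s cap i).load (bin key s cap i) + s i) := rfl

theorem bin_cases (i : ℕ) :
    (bin key s cap i = (bins key s cap i).lead (key i) ∧ 1 ≤ (bins key s cap i).lead (key i) ∧
      (bins key s cap i).load ((bins key s cap i).lead (key i)) + s i ≤ cap (key i)) ∨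
    (bin key s cap i = i + 1 ∧ ((bins key s cap i).lead (key i) = 0 ∨
      cap (key i) < (bins key s cap i).load ((bins key s cap i).lead (key i)) + s i)) := by
  unfold bin binOf
  split_ifs with h
  · exact Or.inl ⟨rfl, h⟩
  · refine Or.inr ⟨rfl, ?_⟩
    by_contra hc
    push Not at hc
    exact h ⟨Nat.one_le_iff_ne_zero.mpr hc.1, hc.2⟩

theorem lead_spec (i : ℕ) : ∀ κ, (bins key s cap i).lead κ ≠ 0 →
    ∃ j < i, (bins key s cap i).lead κ = j + 1 ∧ key j = κ ∧ bin key s cap j = j + 1 := by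
  induction i with
  | zero => intro κ h; exact absurd rfl h
  | succ i ih =>
    intro κ h
    rw [lead_succ] at h ⊢
    by_cases hk : κ = key i
    · subst hk
      rw [Function.update_self] at h ⊢
      rcases bin_cases (key := key) (s := s) (cap := cap) i with ⟨h1, h2, -⟩ | ⟨h1, -⟩
      · obtain ⟨j, hj, h3⟩ := ih (key i) (by omega)
        exact ⟨j, by omega, by rw [h1]; exact h3⟩
      · exact ⟨i, by omega, h1, rfl, h1⟩
    · rw [Function.update_of_ne hk] at h ⊢
      obtain ⟨j, hj, h3⟩ := ih κ h
      exact ⟨j, by omega, h3⟩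

/-- Bins are numbered by the items that open them, so a bin number determines its opener and thereby
its key. The number `0` stays free for "no bin". -/
theorem bin_spec (i : ℕ) :
    ∃ j ≤ i, bin key s cap i = j + 1 ∧ key j = key i ∧ bin key s cap j = j + 1 := by
  rcases bin_cases (key := key) (s := s) (cap := cap) i with ⟨h1, h2, -⟩ | ⟨h1, -⟩
  · obtain ⟨j, hj, h3, h4, h5⟩ := lead_spec (key := key) (s := s) (cap := cap) i (key i) (by omega)
    exact ⟨j, hj.le, h1.trans h3, h4, h5⟩
  · exact ⟨i, le_rfl, h1, rfl, h1⟩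

theorem bin_pos (i : ℕ) : 1 ≤ bin key s cap i := by
  obtain ⟨j, -, h, -⟩ := bin_spec (key := key) (s := s) (cap := cap) i
  omega

theorem bin_le (i : ℕ) : bin key s cap i ≤ i + 1 := by
  obtain ⟨j, h0, h, -⟩ := bin_spec (key := key) (s := s) (cap := cap) i
  omega

theorem key_eq_of_bin_eq {i j : ℕ} (h : bin key s cap i = bin key s cap j) : key i = key j := by
  obtain ⟨i', -, h1, h2, -⟩ := bin_spec (key := key) (s := s) (cap := cap) i
  obtain ⟨j', -, h3, h4, -⟩ := bin_spec (key := key) (s := s) (cap := cap) j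
  obtain rfl : i' = j' := by omega
  rw [← h2, h4]

theorem load_eq (i : ℕ) (L : ℕ) : (bins key s cap i).load L =
    ∑ j ∈ range i with bin key s cap j = L, s j := by
  induction i with
  | zero => simp [bins]
  | succ i ih =>
    rw [load_succ, range_add_one, filter_insert]
    by_cases h : bin key s cap i = L
    · subst h
      rw [Function.update_self, if_pos rfl, sum_insert (by simp), ih, add_comm]
    · rw [Function.update_of_ne (Ne.symm h), if_neg h, ih]

/-- The capacity is tested only when an item joins an existing bin; an oversized item may overfill a
bin of its own. Hence the second item `j'`. -/
theorem load_le_cap (i : ℕ) : ∀ j < i, ∀ j' < i, j ≠ j' → bin key s cap j = bin key s cap j' →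
    (bins key s cap i).load (bin key s cap j) ≤ cap (key j) := by
  induction i with
  | zero => intro j hj; omega
  | succ i ih =>
    have main : ∀ j < i, bin key s cap j = bin key s cap i →
        (bins key s cap (i + 1)).load (bin key s cap i) ≤ cap (key i) := by
      intro j hj hb
      rw [load_succ, Function.update_self]
      rcases bin_cases (key := key) (s := s) (cap := cap) i with ⟨h1, h2, h3⟩ | ⟨h1, -⟩
      · rwa [h1]
      · have := bin_le (key := key) (s := s) (cap := cap) j
        omega
    intro j hj j' hj' hne hb
    rcases Nat.lt_succ_iff_lt_or_eq.mp hj with hj | rfl <;>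
      rcases Nat.lt_succ_iff_lt_or_eq.mp hj' with hj' | rfl
    · by_cases hi : bin key s cap j = bin key s cap i
      · rw [hi, key_eq_of_bin_eq hi]
        exact main j hj hi
      · rw [load_succ, Function.update_of_ne hi]
        exact ih j hj j' hj' hne hb
    · rw [hb, key_eq_of_bin_eq hb]
      exact main j hj hb
    · exact main j' hj' hb.symm
    · exact absurd rfl hne

/-- The items that open a bin. -/
noncomputable def openers (key : ℕ → ℤ) (s : ℕ → ℝ) (cap : ℤ → ℝ) (i : ℕ) : Finset ℕ :=
  (range i).filter fun j => bin key s cap j = j + 1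

/-- Amortization, with the load of the open bin as potential. If item `i` opens a new bin although
one is open, then cap < old load + s i, so the left side grows by cap + s i - old load < 2 s i. The
extra cap on the right pays for the first bin of the key; the first conjunct recognizes that case.
-/
theorem card_openers_key_mul_cap_le (hs : ∀ i, 0 ≤ s i) (hcap : ∀ κ, 0 ≤ cap κ) (i : ℕ) (κ : ℤ) :
    ((bins key s cap i).lead κ = 0 → ∀ j < i, key j ≠ κ) ∧
    (#{j ∈ openers key s cap i | key j = κ} : ℝ) * cap κ +
      (bins key s cap i).load ((bins key s cap i).lead κ) ≤
      cap κ + 2 * ∑ j ∈ range i with key j = κ, s j := by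
  induction i with
  | zero => simp [openers, bins, hcap]
  | succ i ih =>
    obtain ⟨ih0, ih⟩ := ih
    have hop : openers key s cap (i + 1) =
        if bin key s cap i = i + 1 then insert i (openers key s cap i)
        else openers key s cap i := by
      rw [openers, range_add_one, filter_insert, openers]
    have hni : i ∉ openers key s cap i := by simp [openers]
    by_cases hk : key i = κ
    · subst hk
      have hsum : ∑ j ∈ range (i + 1) with key j = key i, s j =
          s i + ∑ j ∈ range i with key j = key i, s j := by
        rw [range_add_one, filter_insert, if_pos rfl, sum_insert (by simp)]
      rw [lead_succ, Function.update_self, load_succ, Function.update_self, hsum]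
      refine ⟨fun h => absurd h (by have := bin_pos (key := key) (s := s) (cap := cap) i; omega), ?_⟩
      rcases bin_cases (key := key) (s := s) (cap := cap) i with ⟨h1, h2, h3⟩ | ⟨h1, h2⟩
      · have hne : bin key s cap i ≠ i + 1 := by
          obtain ⟨j, hj, h4, -⟩ := lead_spec (key := key) (s := s) (cap := cap) i (key i) (by omega)
          omega
        rw [hop, if_neg hne, h1]
        linarith [hs i]
      · rw [hop, if_pos h1, filter_insert, if_pos rfl, card_insert_of_notMem (by simp [hni]), h1]
        have hload : (bins key s cap i).load (i + 1) = 0 := by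
          rw [load_eq]
          refine sum_eq_zero fun j hj => ?_
          rw [mem_filter, mem_range] at hj
          have := bin_le (key := key) (s := s) (cap := cap) j
          omega
        rw [hload]
        push_cast
        rcases h2 with h2 | h2
        · have h5 := ih0 h2
          have h6 : {j ∈ openers key s cap i | key j = key i} = ∅ := by
            refine filter_eq_empty_iff.mpr fun j hj => h5 j ?_
            simpa using (mem_filter.mp hj).1
          rw [h6]
          have : 0 ≤ ∑ j ∈ range i with key j = key i, s j := sum_nonneg fun j _ => hs j
          simp only [card_empty, Nat.cast_zero]
          linarith [hs i]
        · linarith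
    · have hsum : ∑ j ∈ range (i + 1) with key j = κ, s j = ∑ j ∈ range i with key j = κ, s j := by
        rw [range_add_one, filter_insert, if_neg hk]
      have hcard : {j ∈ openers key s cap (i + 1) | key j = κ} =
          {j ∈ openers key s cap i | key j = κ} := by
        rw [hop]
        split_ifs
        · rw [filter_insert, if_neg hk]
        · rfl
      rw [lead_succ, Function.update_of_ne (Ne.symm hk), hsum, hcard]
      constructor
      · intro h j hj
        rcases Nat.lt_succ_iff_lt_or_eq.mp hj with hj | rfl
        · exact ih0 h j hj
        · exact hk
      · refine le_trans (add_le_add le_rfl ?_) ih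
        rw [load_succ]
        by_cases hL : (bins key s cap i).lead κ = bin key s cap i
        -- The open bin of `κ` was opened by an item with key `κ`, so it cannot be the bin that
        -- receives an item with another key.
        · exfalso
          have hpos := bin_pos (key := key) (s := s) (cap := cap) i
          obtain ⟨j, -, h3, h4, -⟩ :=
            lead_spec (key := key) (s := s) (cap := cap) i κ (by omega)
          obtain ⟨j', -, h5, h6, -⟩ := bin_spec (key := key) (s := s) (cap := cap) i
          obtain rfl : j = j' := by omega
          exact hk (h6.symm.trans h4)
        · rw [Function.update_of_ne hL]

/-- The number of bins. -/
theorem card_openers_le (hs : ∀ i, 0 ≤ s i) (n : ℕ) (hcap : ∀ κ, 0 ≤ cap κ)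
    (hcap' : ∀ i < n, 0 < cap (key i)) (keys : Finset ℤ) (hkeys : ∀ i < n, key i ∈ keys) :
    (#(openers key s cap n) : ℝ) ≤ #keys + ∑ i ∈ range n, 2 * s i / cap (key i) := by
  have hmaps : ∀ j ∈ openers key s cap n, key j ∈ keys := fun j hj =>
    hkeys j (by simpa using (mem_filter.mp hj).1)
  have hmaps' : ∀ j ∈ range n, key j ∈ keys := fun j hj => hkeys j (by simpa using hj)
  rw [card_eq_sum_card_fiberwise hmaps, ← sum_fiberwise_of_maps_to hmaps', card_eq_sum_ones]
  push_cast
  rw [← sum_add_distrib]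
  refine sum_le_sum fun κ _ => ?_
  have h1 : ∑ i ∈ range n with key i = κ, 2 * s i / cap (key i) =
      2 * (∑ i ∈ range n with key i = κ, s i) / cap κ := by
    rw [mul_sum, sum_div]
    exact sum_congr rfl fun i hi => by rw [(mem_filter.mp hi).2]
  rw [h1]
  have hload : 0 ≤ (bins key s cap n).load ((bins key s cap n).lead κ) := by
    rw [load_eq]; exact sum_nonneg fun j _ => hs j
  have h2 := (card_openers_key_mul_cap_le hs hcap n κ (key := key)).2
  by_cases hκ : ∃ i < n, key i = κ
  · obtain ⟨i, hi, rfl⟩ := hκ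
    have h3 := hcap' i hi
    rw [← mul_le_mul_iff_of_pos_right h3, add_mul, div_mul_cancel₀ _ h3.ne']
    linarith
  · push Not at hκ
    have h6 : {j ∈ openers key s cap n | key j = κ} = ∅ := by
      refine filter_eq_empty_iff.mpr fun j hj => hκ j ?_
      simpa using (mem_filter.mp hj).1
    have h7 : {j ∈ range n | key j = κ} = ∅ :=
      filter_eq_empty_iff.mpr fun j hj => hκ j (by simpa using hj)
    rw [h6, h7]
    simp

end NextFit

-- Execution of loop-free programs and of counting loops.

namespace RealRAM

/-- The program has no loop. -/
def Prog.IsFlat : Prog → Prop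
  | .skip => True
  | .putInt _ _ _ => True
  | .putReal _ _ _ => True
  | .draw _ _ => True
  | .seq p q => p.IsFlat ∧ q.IsFlat
  | .cond _ p q => p.IsFlat ∧ q.IsFlat
  | .loop _ _ => False

open Classical in
/-- The final state of a loop-free program. -/
noncomputable def Prog.exec (ω : ℕ → unitInterval) : Prog → State → State
  | .skip, s => s
  | .putInt b a v, s => s.setInt b (a.eval s) (v.eval s)
  | .putReal b a v, s => s.setReal b (a.eval s) (v.eval s)
  | .draw b a, s => { s.setReal b (a.eval s) (ω s.drawn) with drawn := s.drawn + 1 }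
  | .seq p q, s => q.exec ω (p.exec ω s)
  | .cond b p q, s => if b.eval s then p.exec ω s else q.exec ω s
  | .loop _ _, s => s

/-- A bound on the number of steps of a loop-free program. -/
def Prog.maxSteps : Prog → ℕ
  | .skip => 1
  | .putInt _ a v => a.steps + v.steps + 1
  | .putReal _ a v => a.steps + v.steps + 1
  | .draw _ a => a.steps + 1
  | .seq p q => p.maxSteps + q.maxSteps
  | .cond b p q => b.steps + (p.maxSteps + q.maxSteps) + 1
  | .loop _ _ => 0

theorem Prog.IsFlat.runs {p : Prog} (hp : p.IsFlat) (ω : ℕ → unitInterval) (s : State) :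
    ∃ t ≤ p.maxSteps, Runs ω p s (p.exec ω s) t := by
  induction p generalizing s with
  | skip => exact ⟨_, le_rfl, .skip s⟩
  | putInt b a v => exact ⟨_, le_rfl, .putInt s b a v⟩
  | putReal b a v => exact ⟨_, le_rfl, .putReal s b a v⟩
  | draw b a => exact ⟨_, le_rfl, .draw s b a⟩
  | seq p q hp' hq' =>
    obtain ⟨t, ht, h⟩ := hp' hp.1 s
    obtain ⟨t', ht', h'⟩ := hq' hp.2 (p.exec ω s)
    exact ⟨_, add_le_add ht ht', .seq h h'⟩
  | cond b p q hp' hq' =>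
    by_cases hb : b.eval s
    · obtain ⟨t, ht, h⟩ := hp' hp.1 s
      refine ⟨_, ?_, by rw [Prog.exec, if_pos hb]; exact .condTrue hb h⟩
      simp only [Prog.maxSteps]
      omega
    · obtain ⟨t, ht, h⟩ := hq' hp.2 s
      refine ⟨_, ?_, by rw [Prog.exec, if_neg hb]; exact .condFalse hb h⟩
      simp only [Prog.maxSteps]
      omega
  | loop b p => exact hp.elim

/-- The integer at address `0` of a bank. -/
def ivar (b : ℕ) : IntExpr := .get b (.const 0)

/-- The real at address `0` of a bank. -/
def rvar (b : ℕ) : RealExpr := .get b (.const 0)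

/-- Run `body` once for every value `0, …, n - 1` of the counter in integer bank `4`, where `n` is
the integer at address `0` of bank `0`. -/
def forLoop (body : Prog) : Prog :=
  .seq (.putInt 4 (.const 0) (.const 0))
    (.loop (.leInt (.add (ivar 4) (.const 1)) (ivar 0))
      (.seq body (.putInt 4 (.const 0) (.add (ivar 4) (.const 1)))))

@[simp] theorem setInt_real (s : State) (b a v) : (s.setInt b a v).real = s.real := rfl
@[simp] theorem setReal_int (s : State) (b a v) : (s.setReal b a v).int = s.int := rfl
@[simp] theorem setInt_drawn (s : State) (b a v) : (s.setInt b a v).drawn = s.drawn := rfl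
@[simp] theorem setReal_drawn (s : State) (b a v) : (s.setReal b a v).drawn = s.drawn := rfl
@[simp] theorem setInt_int (s : State) (b a v b') : (s.setInt b a v).int b' =
    if b' = b then Function.update (s.int b) a v else s.int b' := by
  simp only [State.setInt, Function.update_apply]
@[simp] theorem setReal_real (s : State) (b a v b') : (s.setReal b a v).real b' =
    if b' = b then Function.update (s.real b) a v else s.real b' := by
  simp only [State.setReal, Function.update_apply]

/-- The rule for counting loops: an invariant `Inv i`, which does not depend on the counter,
is preserved by the body. -/
theorem forLoop_runs {body : Prog} (hb : body.IsFlat) (ω : ℕ → unitInterval) (n : ℕ)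
    (Inv : ℕ → State → Prop) (hcount : ∀ i s v, Inv i s → Inv i (s.setInt 4 0 v))
    (hn : ∀ i s, Inv i s → s.int 0 0 = n)
    (hstep : ∀ i < n, ∀ s, s.int 4 0 = (i : ℤ) → Inv i s →
      (body.exec ω s).int 4 0 = (i : ℤ) ∧ Inv (i + 1) (body.exec ω s))
    (s : State) (hs : Inv 0 s) :
    ∃ s' t, Runs ω (forLoop body) s s' t ∧ Inv n s' ∧ t ≤ (body.maxSteps + 20) * (n + 1) := by
  -- Induction on the number `r` of remaining rounds. The test and the increment of the counter cost
  -- at most 20 steps per round, and the final failing test at most 10.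
  have key : ∀ (r i : ℕ) (s : State), i + r = n → s.int 4 0 = (i : ℤ) → Inv i s → ∃ s' t,
      Runs ω (.loop (.leInt (.add (ivar 4) (.const 1)) (ivar 0))
        (.seq body (.putInt 4 (.const 0) (.add (ivar 4) (.const 1))))) s s' t ∧ Inv n s' ∧
        t ≤ (body.maxSteps + 20) * r + 10 := by
    intro r
    induction r with
    | zero =>
      intro i s hi h4 hI
      refine ⟨s, _, .loopFalse ?_, by rwa [show n = i by omega], ?_⟩
      · simp only [BoolExpr.eval, IntExpr.eval, ivar, h4, hn i s hI]
        omega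
      · simp [BoolExpr.steps, IntExpr.steps, ivar]
    | succ r ih =>
      intro i s hi h4 hI
      obtain ⟨h5, h6⟩ := hstep i (by omega) s h4 hI
      obtain ⟨t, ht, hrun⟩ := hb.runs ω s
      obtain ⟨s', t', hrun', hI', ht'⟩ := ih (i + 1) ((body.exec ω s).setInt 4 0 (i + 1))
        (by omega) (by simp) (hcount _ _ _ h6)
      obtain ⟨t₀, ht₀, hput⟩ : ∃ t₀ ≤ 10,
          Runs ω (.putInt 4 (.const 0) (.add (ivar 4) (.const 1))) (body.exec ω s)
            ((body.exec ω s).setInt 4 0 (i + 1)) t₀ := by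
        have := Runs.putInt (ω := ω) (body.exec ω s) 4 (.const 0) (.add (ivar 4) (.const 1))
        simp only [IntExpr.eval, ivar, h5] at this
        exact ⟨_, by simp [IntExpr.steps], this⟩
      refine ⟨s', _, .loopTrue ?_ (.seq hrun hput) hrun', hI', ?_⟩
      · simp only [BoolExpr.eval, IntExpr.eval, ivar, h4, hn i s hI]
        omega
      · simp only [BoolExpr.steps, IntExpr.steps, ivar]
        rw [mul_add]
        omega
  obtain ⟨s', t, h1, h2, h3⟩ := key n 0 (s.setInt 4 0 0) (by omega) (by simp) (hcount _ _ _ hs)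
  refine ⟨s', _, .seq (.putInt s 4 (.const 0) (.const 0)) h1, h2, ?_⟩
  simp only [IntExpr.steps]
  rw [mul_add]
  omega

end RealRAM

-- The sampling algorithm and the correctness of its program.

namespace Clustering

open RealRAM NextFit Finset

/-- The data on which the sampling algorithm works. -/
structure Input where
  n : ℕ
  k : ℕ
  z : ℕ
  m : ℕ
  ε : ℝ
  π : ℝ
  c : ℕ → ℤ
  d : ℕ → ℝ

namespace Input

variable (I : Input)

open Classical in
/-- The cost of a client in the given solution. -/
noncomputable def x (i : ℕ) : ℝ := if I.d i ≤ 0 then 0 else Real.exp (I.z * Real.log (I.d i))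

/-- The number of clients of a cluster. -/
def size (a : ℤ) : ℕ := #{j ∈ range I.n | I.c j = a}

/-- The cost of a cluster in the given solution. -/
noncomputable def mass (a : ℤ) : ℝ := ∑ j ∈ range I.n with I.c j = a, I.x j

/-- The cost of the given solution. -/
noncomputable def total : ℝ := ∑ j ∈ range I.n, I.x j

/-- The logarithm of the ratio between the cost of an outer client and the average cost. -/
noncomputable def bound : ℝ := 2 * I.z * Real.log (6 * I.z / I.ε)

/-- The number of the class of the outer clients. -/
noncomputable def top : ℤ := ⌊I.bound⌋ + 1

/-- The number of samples that are drawn from the clients that are not inner ones. -/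
noncomputable def samples : ℝ :=
  -- The first factor is the exponent that the union bound needs. The second dominates
  -- `Packing.spread` divided by ε², where 1792 = 64 · 28.
  (1 + (I.k * Real.log I.m + Real.log (Real.log (1 / I.ε)) + Real.log (1 / I.π))) *
    (108 * (I.z * I.z) * Real.exp (I.z * Real.log (1792 * I.z)) *
      (1 / (I.ε * I.ε) + Real.exp (I.z * Real.log (1 / I.ε))))

/-- The cost that is represented by one sample. -/
noncomputable def unit : ℝ := I.total / I.samples

/-- The average cost in the cluster of a client. -/
noncomputable def avg (i : ℕ) : ℝ := I.mass (I.c i) / I.size (I.c i)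

/-- The logarithm of the ratio of the cost of a client to the average cost in its cluster. -/
noncomputable def level (i : ℕ) : ℝ := Real.log (I.x i) - Real.log (I.avg i)

/-- The inner clients. -/
def Inner (i : ℕ) : Prop := I.x i ≤ 0 ∨ I.level i ≤ -I.bound

open Classical in
/-- The class of a client. -/
noncomputable def cls (i : ℕ) : ℤ :=
  if I.Inner i then -1 - I.top else if I.level i ≤ I.bound then ⌊I.level i⌋ else I.top

/-- The key of a client, which encodes the cluster and the class. -/
noncomputable def key (i : ℕ) : ℤ := I.c i + I.k * I.cls i

open Classical in
/-- The sampling weight of a client. -/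
noncomputable def wt (i : ℕ) : ℝ :=
  if I.Inner i then 1 else
    if I.level i ≤ I.bound then Real.exp ⌊I.level i⌋ * I.avg i else I.x i

/-- The capacity of the bins of a key. -/
noncomputable def cap (κ : ℤ) : ℝ := if κ / I.k = -1 - I.top then I.n else I.unit

/-- The bin of a client. -/
noncomputable def bin (i : ℕ) : ℕ := NextFit.bin I.key I.wt I.cap i

/-- The load of the bin `L` before the client `i` has been processed. -/
noncomputable def load (i L : ℕ) : ℝ := (bins I.key I.wt I.cap i).load L

/-- The client `i` is selected, given the random numbers. -/
def Selected (ω : ℕ → unitInterval) (i : ℕ) : Prop :=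
  I.load i (I.bin i) ≤ ω (I.bin i - 1) * I.load I.n (I.bin i) ∧
    ω (I.bin i - 1) * I.load I.n (I.bin i) < I.load i (I.bin i) + I.wt i

/-- The state `s` holds the input. -/
structure Holds (s : State) : Prop where
  int00 : s.int 0 0 = I.n
  int01 : s.int 0 1 = I.k
  int02 : s.int 0 2 = I.z
  int03 : s.int 0 3 = I.m
  int1 : ∀ i < I.n, s.int 1 (i : ℕ) = I.c i
  real00 : s.real 0 0 = I.ε
  real01 : s.real 0 1 = I.π
  real1 : ∀ i < I.n, s.real 1 (i : ℕ) = I.d i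

theorem Holds.congr {I : Input} {s s' : State} (h : I.Holds s) (h0 : s'.int 0 = s.int 0)
    (h1 : s'.int 1 = s.int 1) (h2 : s'.real 0 = s.real 0) (h3 : s'.real 1 = s.real 1) :
    I.Holds s' := by
  constructor <;> (try rw [h0]) <;> (try rw [h1]) <;> (try rw [h2]) <;> (try rw [h3])
  exacts [h.int00, h.int01, h.int02, h.int03, h.int1, h.real00, h.real01, h.real1]

/-- First pass: the costs of the clients, the sizes and costs of the clusters, the total cost, and
the random numbers. -/
def costBody : Prog :=
  -- Powers are computed as exp (z log d). Distance zero needs its own branch, since `Real.log 0 =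
  -- 0` would give cost 1.
  .seq (.cond (.leReal (.get 1 (ivar 4)) (.cast (.const 0)))
      (.putReal 3 (ivar 4) (.cast (.const 0)))
      (.putReal 3 (ivar 4)
        (.exp (.mul (.cast (.get 0 (.const 2))) (.log (.get 1 (ivar 4)))))))
  <| .seq (.putInt 5 (.get 1 (ivar 4)) (.add (.get 5 (.get 1 (ivar 4))) (.const 1)))
  <| .seq (.putReal 4 (.get 1 (ivar 4)) (.add (.get 4 (.get 1 (ivar 4))) (.get 3 (ivar 4))))
  <| .seq (.putReal 5 (.const 0) (.add (rvar 5) (.get 3 (ivar 4))))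
  -- One number per client suffices: there are at most n bins, and the bin `L` uses the number at
  -- address `L - 1`.
  <| .draw 6 (ivar 4)

/-- The state during the first pass. -/
structure CostInv (ω : ℕ → unitInterval) (i : ℕ) (s : State) : Prop where
  holds : I.Holds s
  drawn : s.drawn = i
  int5 : ∀ a, s.int 5 a = #{j ∈ range i | I.c j = a}
  real3 : ∀ j < i, s.real 3 (j : ℕ) = I.x j
  real4 : ∀ a, s.real 4 a = ∑ j ∈ range i with I.c j = a, I.x j
  real5 : s.real 5 0 = ∑ j ∈ range i, I.x j
  real6 : ∀ j < i, s.real 6 (j : ℕ) = ω j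
  int2 : s.int 2 0 = 0
  int8 : ∀ a, s.int 8 a = 0
  real12 : ∀ a, s.real 12 a = 0

theorem costInv_step (ω : ℕ → unitInterval) (i : ℕ) (hi : i < I.n) (s : State)
    (h4 : s.int 4 0 = i) (h : I.CostInv ω i s) :
    (costBody.exec ω s).int 4 0 = i ∧ I.CostInv ω (i + 1) (costBody.exec ω s) := by
  have hx : costBody.exec ω s = (((((s.setReal 3 i (I.x i)).setInt 5 (I.c i)
      (s.int 5 (I.c i) + 1)).setReal 4 (I.c i) (s.real 4 (I.c i) + I.x i)).setReal 5 0
      (s.real 5 0 + I.x i)) |> fun s => { s.setReal 6 i (ω i) with drawn := i + 1 }) := by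
    have h1 := h.holds.real1 i hi
    have h2 := h.holds.int1 i hi
    have h3 := h.holds.int02
    have h5 := h.drawn
    by_cases hd : I.d i ≤ 0 <;>
      simp [costBody, Prog.exec, BoolExpr.eval, IntExpr.eval, RealExpr.eval, ivar, rvar, h1, h2,
        h3, h4, h5, x, hd]
  rw [hx]
  refine ⟨by simpa using h4, ⟨h.holds.congr (by simp) (by simp) (by simp) (by simp), rfl,
    ?_, ?_, ?_, ?_, ?_, by simpa using h.int2, by simpa using h.int8, by simpa using h.real12⟩⟩
  · intro a
    rw [range_add_one, filter_insert]
    by_cases ha : I.c i = a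
    · subst ha
      simp [h.int5]
    · simp [h.int5, ha, Function.update_of_ne (Ne.symm ha)]
  · intro j hj
    rcases Nat.lt_succ_iff_lt_or_eq.mp hj with hj | rfl
    · simp [Function.update_of_ne (show (j : ℤ) ≠ i by omega), h.real3 j hj]
    · simp
  · intro a
    rw [range_add_one, filter_insert]
    by_cases ha : I.c i = a
    · subst ha
      simp [h.real4, add_comm]
    · simp [h.real4, ha, Function.update_of_ne (Ne.symm ha)]
  · simp [sum_range_succ, h.real5]
  · intro j hj
    rcases Nat.lt_succ_iff_lt_or_eq.mp hj with hj | rfl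
    · simp [Function.update_of_ne (show (j : ℤ) ≠ i by omega), h.real6 j hj]
    · simp

/-- The computation of the parameters. -/
def paramProg : Prog :=
  .seq (.putReal 7 (.const 0) (.mul (.mul (.cast (.const 2)) (.cast (.get 0 (.const 2))))
      (.log (.div (.mul (.cast (.const 6)) (.cast (.get 0 (.const 2)))) (.get 0 (.const 0))))))
  <| .seq (.putInt 6 (.const 0) (.add (.floor (rvar 7)) (.const 1)))
  <| .putReal 8 (.const 0) (.div (rvar 5) (.mul
      (.add (.cast (.const 1)) (.add (.add
        (.mul (.cast (.get 0 (.const 1))) (.log (.cast (.get 0 (.const 3)))))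
        (.log (.log (.div (.cast (.const 1)) (.get 0 (.const 0))))))
        (.log (.div (.cast (.const 1)) (.get 0 (.const 1))))))
      (.mul (.mul (.mul (.cast (.const 108))
          (.mul (.cast (.get 0 (.const 2))) (.cast (.get 0 (.const 2)))))
        (.exp (.mul (.cast (.get 0 (.const 2)))
          (.log (.mul (.cast (.const 1792)) (.cast (.get 0 (.const 2))))))))
        (.add (.div (.cast (.const 1)) (.mul (.get 0 (.const 0)) (.get 0 (.const 0))))
          (.exp (.mul (.cast (.get 0 (.const 2)))
            (.log (.div (.cast (.const 1)) (.get 0 (.const 0))))))))))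

/-- Second pass, first part: key, weight and capacity of a client. -/
def keyBody : Prog :=
  .seq (.putReal 9 (.const 0) (.div (.get 4 (.get 1 (ivar 4))) (.cast (.get 5 (.get 1 (ivar 4))))))
  <| .seq (.putReal 14 (.const 0) (.sub (.log (.get 3 (ivar 4))) (.log (rvar 9))))
  <| .seq (.cond (.and (.not (.leReal (.get 3 (ivar 4)) (.cast (.const 0))))
        (.not (.leReal (rvar 14) (.sub (.cast (.const 0)) (rvar 7)))))
      (.cond (.leReal (rvar 14) (rvar 7))
        (.seq (.putInt 7 (.const 0) (.floor (rvar 14)))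
          <| .seq (.putReal 10 (ivar 4) (.mul (.exp (.cast (.floor (rvar 14)))) (rvar 9)))
          <| .putReal 11 (.const 0) (rvar 8))
        (.seq (.putInt 7 (.const 0) (ivar 6))
          <| .seq (.putReal 10 (ivar 4) (.get 3 (ivar 4)))
          <| .putReal 11 (.const 0) (rvar 8)))
      (.seq (.putInt 7 (.const 0) (.sub (.const (-1)) (ivar 6)))
        <| .seq (.putReal 10 (ivar 4) (.cast (.const 1)))
        <| .putReal 11 (.const 0) (.cast (ivar 0))))
  <| .putInt 7 (.const 0) (.add (.get 1 (ivar 4)) (.mul (.get 0 (.const 1)) (ivar 7)))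

/-- Second pass, second part: the packing of a client into a bin. -/
def packBody : Prog :=
  .seq (.cond (.and (.leInt (.const 1) (.get 8 (ivar 7)))
        (.leReal (.add (.get 12 (.get 8 (ivar 7))) (.get 10 (ivar 4))) (rvar 11)))
      .skip (.putInt 8 (ivar 7) (.add (ivar 4) (.const 1))))
  <| .seq (.putInt 9 (ivar 4) (.get 8 (ivar 7)))
  -- The load before the client is the left end of the interval that the client occupies within its
  -- bin; the third pass needs it.
  <| .seq (.putReal 13 (ivar 4) (.get 12 (.get 9 (ivar 4))))
  <| .putReal 12 (.get 9 (ivar 4)) (.add (.get 12 (.get 9 (ivar 4))) (.get 10 (ivar 4)))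

/-- The state during the second pass. -/
structure PackInv (ω : ℕ → unitInterval) (i : ℕ) (s : State) : Prop where
  holds : I.Holds s
  int5 : ∀ a, s.int 5 a = I.size a
  real3 : ∀ j < I.n, s.real 3 (j : ℕ) = I.x j
  real4 : ∀ a, s.real 4 a = I.mass a
  real6 : ∀ j < I.n, s.real 6 (j : ℕ) = ω j
  real7 : s.real 7 0 = I.bound
  int6 : s.int 6 0 = I.top
  real8 : s.real 8 0 = I.unit
  int2 : s.int 2 0 = 0
  int8 : ∀ κ, s.int 8 κ = (bins I.key I.wt I.cap i).lead κ
  int9 : ∀ j < i, s.int 9 (j : ℕ) = I.bin j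
  real10 : ∀ j < i, s.real 10 (j : ℕ) = I.wt j
  real12 : ∀ L : ℕ, s.real 12 (L : ℕ) = I.load i L
  real13 : ∀ j < i, s.real 13 (j : ℕ) = I.load j (I.bin j)

theorem param_spec (ω : ℕ → unitInterval) (s : State) (h : I.CostInv ω I.n s) :
    I.PackInv ω 0 (paramProg.exec ω s) := by
  have hx : paramProg.exec ω s =
      ((s.setReal 7 0 I.bound).setInt 6 0 I.top).setReal 8 0 I.unit := by
    have h1 := h.holds
    simp [paramProg, Prog.exec, IntExpr.eval, RealExpr.eval, rvar, h1.int01,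
      h1.int02, h1.int03, h1.real00, h1.real01, h.real5, bound, top, unit, samples, total]
  rw [hx]
  refine ⟨h.holds.congr (by simp) (by simp) (by simp) (by simp), by simpa [size] using h.int5,
    by simpa using h.real3, by simpa [mass] using h.real4, by simpa using h.real6, by simp,
    by simp,
    by simp, by simpa using h.int2, by simpa [bins] using h.int8, by simp, by simp,
    by simpa [load, bins] using fun L : ℕ => h.real12 L, by simp⟩

/-- The cluster is the remainder in [0, k), so Euclidean division recovers the class, also when it
is negative. -/
theorem key_ediv (hc : ∀ i < I.n, 0 ≤ I.c i ∧ I.c i < I.k) {i : ℕ} (hi : i < I.n) :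
    I.key i / I.k = I.cls i := by
  obtain ⟨h1, h2⟩ := hc i hi
  rw [key, Int.add_mul_ediv_left _ _ (by omega), Int.ediv_eq_zero_of_lt h1 h2, zero_add]

/-- Keeps the number of the inner class apart from the main ones: level > -bound > -top, so the
floor is at least -top. -/
theorem bound_floor_lt (i : ℕ) (h : ¬ I.Inner i) : -1 - I.top < ⌊I.level i⌋ := by
  rw [Inner, not_or, not_le, not_le] at h
  rw [← Int.add_one_le_iff, Int.le_floor, top]
  have := Int.floor_le I.bound
  push_cast
  linarith [h.2, Int.lt_floor_add_one I.bound]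

theorem cls_eq_inner_iff (hb : 0 ≤ I.bound) (i : ℕ) : I.cls i = -1 - I.top ↔ I.Inner i := by
  constructor
  · intro h
    by_contra hi
    have h1 := I.bound_floor_lt i hi
    have h2 : 0 ≤ ⌊I.bound⌋ := Int.floor_nonneg.mpr hb
    rw [cls, if_neg hi] at h
    split_ifs at h
    · omega
    · unfold top at h
      omega
  · intro h
    rw [cls, if_pos h]

open Classical in
theorem cap_key (hc : ∀ i < I.n, 0 ≤ I.c i ∧ I.c i < I.k) (hb : 0 ≤ I.bound) {i : ℕ}
    (hi : i < I.n) : I.cap (I.key i) = if I.Inner i then (I.n : ℝ) else I.unit := by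
  rw [cap, I.key_ediv hc hi]
  simp only [I.cls_eq_inner_iff hb]

theorem keyBody_spec (hc : ∀ i < I.n, 0 ≤ I.c i ∧ I.c i < I.k) (hb : 0 ≤ I.bound)
    (ω : ℕ → unitInterval) (i : ℕ) (hi : i < I.n) (s : State)
    (h4 : s.int 4 0 = i) (h : I.PackInv ω i s) :
    ∃ v : ℤ, keyBody.exec ω s = (((((s.setReal 9 0 (I.avg i)).setReal 14 0 (I.level i)).setInt 7 0
      v).setReal 10 i (I.wt i)).setReal 11 0 (I.cap (I.key i))).setInt 7 0 (I.key i) := by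
  have h1 := h.holds.int1 i hi
  have h2 := h.real3 i hi
  have h3 := h.holds.int00
  have h5 := h.holds.int01
  refine ⟨I.cls i, ?_⟩
  rw [I.cap_key hc hb hi]
  have e1 : s.real 4 (I.c i) / (s.int 5 (I.c i) : ℝ) = I.avg i := by
    rw [h.real4, h.int5, avg, Int.cast_natCast]
  have hlev : Real.log (I.x i) - Real.log (I.avg i) = I.level i := rfl
  by_cases hin : I.Inner i
  · have hin' : ¬ (0 < I.x i ∧ -I.bound < I.level i) := fun h0 =>
      hin.elim (fun h => absurd h0.1 (not_lt.mpr h)) fun h => absurd h0.2 (not_lt.mpr h)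
    simp [keyBody, Prog.exec, BoolExpr.eval, IntExpr.eval, RealExpr.eval, ivar, rvar, h1, h2,
      h3, h4, h5, e1, h.real7, h.int6, key, cls, wt, hin, hlev, hin']
  · have hin' := hin
    rw [Inner, not_or, not_le, not_le] at hin'
    by_cases hl : I.level i ≤ I.bound <;>
      simp [keyBody, Prog.exec, BoolExpr.eval, IntExpr.eval, RealExpr.eval, ivar, rvar, h1, h2,
        h4, h5, e1, h.real7, h.int6, h.real8, key, cls, wt, hin, hlev, hl, hin']

theorem packBody_spec (ω : ℕ → unitInterval) (i : ℕ) (s : State)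
    (h4 : s.int 4 0 = i) (h7 : s.int 7 0 = I.key i)
    (h8 : ∀ κ, s.int 8 κ = (bins I.key I.wt I.cap i).lead κ)
    (h10 : s.real 10 i = I.wt i) (h11 : s.real 11 0 = I.cap (I.key i))
    (h12 : ∀ L : ℕ, s.real 12 (L : ℕ) = I.load i L) :
    packBody.exec ω s = (((s.setInt 8 (I.key i) (I.bin i)).setInt 9 i (I.bin i)).setReal 13 i
      (I.load i (I.bin i))).setReal 12 (I.bin i) (I.load i (I.bin i) + I.wt i) := by
  by_cases hb : 1 ≤ (bins I.key I.wt I.cap i).lead (I.key i) ∧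
      (bins I.key I.wt I.cap i).load ((bins I.key I.wt I.cap i).lead (I.key i)) + I.wt i ≤
        I.cap (I.key i)
  · have hbin : I.bin i = (bins I.key I.wt I.cap i).lead (I.key i) := by
      rw [bin, NextFit.bin, binOf, if_pos hb]
    -- If the client joins the open bin, rewriting the table of open bins changes nothing; thus both
    -- branches have the same normal form.
    have hself : s.setInt 8 (I.key i) (I.bin i) = s := by
      rw [State.setInt, hbin, ← h8, Function.update_eq_self, Function.update_eq_self]
    have h9 : s.int 8 (I.key i) = I.bin i := by rw [h8, hbin]
    have hb' : 1 ≤ I.bin i ∧ I.load i (I.bin i) + I.wt i ≤ I.cap (I.key i) := by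
      rw [hbin]; exact hb
    rw [hself]
    simp [packBody, Prog.exec, BoolExpr.eval, IntExpr.eval, RealExpr.eval, ivar, rvar, h4, h7,
      h9, h10, h11, h12, hb']
  · have hbin : I.bin i = i + 1 := by rw [bin, NextFit.bin, binOf, if_neg hb]
    have hb' : ¬ (1 ≤ (bins I.key I.wt I.cap i).lead (I.key i) ∧
        I.load i ((bins I.key I.wt I.cap i).lead (I.key i)) + I.wt i ≤ I.cap (I.key i)) := hb
    have e : s.real 12 ((i : ℤ) + 1) = I.load i (i + 1) := by rw [← h12]; push_cast; rfl
    rw [hbin]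
    simp [packBody, Prog.exec, BoolExpr.eval, IntExpr.eval, RealExpr.eval, ivar, rvar, h4, h7,
      h8, h10, h11, h12, hb', e]

theorem packInv_step (hc : ∀ i < I.n, 0 ≤ I.c i ∧ I.c i < I.k) (hb : 0 ≤ I.bound)
    (ω : ℕ → unitInterval) (i : ℕ) (hi : i < I.n) (s : State)
    (h4 : s.int 4 0 = i) (h : I.PackInv ω i s) :
    ((Prog.seq keyBody packBody).exec ω s).int 4 0 = i ∧
      I.PackInv ω (i + 1) ((Prog.seq keyBody packBody).exec ω s) := by
  obtain ⟨v, hv⟩ := I.keyBody_spec hc hb ω i hi s h4 h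
  rw [Prog.exec, hv, I.packBody_spec ω i _ (by simpa using h4) (by simp) (by simpa using h.int8)
    (by simp) (by simp) (by simpa using h.real12)]
  refine ⟨by simpa using h4, ⟨h.holds.congr (by simp) (by simp) (by simp) (by simp),
    by simpa using h.int5, by simpa using h.real3, by simpa using h.real4, by simpa using h.real6,
    by simpa using h.real7, by simpa using h.int6, by simpa using h.real8, by simpa using h.int2,
    ?_, ?_, ?_, ?_, ?_⟩⟩
  · intro κ
    rw [lead_succ]
    by_cases hκ : κ = I.key i
    · subst hκ
      simp [bin]
    · simp [Function.update_of_ne hκ, h.int8]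
  · intro j hj
    rcases Nat.lt_succ_iff_lt_or_eq.mp hj with hj | rfl
    · simp [Function.update_of_ne (show (j : ℤ) ≠ i by omega), h.int9 j hj]
    · simp
  · intro j hj
    rcases Nat.lt_succ_iff_lt_or_eq.mp hj with hj | rfl
    · simp [Function.update_of_ne (show (j : ℤ) ≠ i by omega), h.real10 j hj]
    · simp
  · intro L
    have hload : I.load (i + 1) L = Function.update (bins I.key I.wt I.cap i).load (I.bin i)
      (I.load i (I.bin i) + I.wt i) L := by rw [load, load_succ]; rfl
    rw [hload]
    by_cases hL : L = I.bin i
    · subst hL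
      simp [bin, load]
    · rw [Function.update_of_ne hL]
      simp [Function.update_of_ne (show (L : ℤ) ≠ I.bin i by omega), h.real12, load]
  · intro j hj
    rcases Nat.lt_succ_iff_lt_or_eq.mp hj with hj | rfl
    · simp [Function.update_of_ne (show (j : ℤ) ≠ i by omega), h.real13 j hj]
    · simp


theorem bin_spec' (i : ℕ) : 1 ≤ I.bin i ∧ I.bin i ≤ i + 1 := ⟨bin_pos i, bin_le i⟩

/-- Third pass: the selection of the samples. -/
def outBody : Prog :=
  .seq (.putReal 9 (.const 0) (.mul (.get 6 (.sub (.get 9 (ivar 4)) (.const 1)))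
      (.get 12 (.get 9 (ivar 4)))))
  <| .cond (.and (.leReal (.get 13 (ivar 4)) (rvar 9))
      (.not (.leReal (.add (.get 13 (ivar 4)) (.get 10 (ivar 4))) (rvar 9))))
    (.seq (.putInt 3 (ivar 2) (ivar 4))
      <| .seq (.putReal 2 (ivar 2) (.div (.get 12 (.get 9 (ivar 4))) (.get 10 (ivar 4))))
      <| .putInt 2 (.const 0) (.add (ivar 2) (.const 1)))
    .skip

open Classical in
/-- The list of the selected clients among the first `i` clients. -/
noncomputable def selection (ω : ℕ → unitInterval) (i : ℕ) : List ℕ :=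
  (List.range i).filter fun j => I.Selected ω j

/-- The weight of a client in the output if it is selected. -/
noncomputable def outWt (i : ℕ) : ℝ := I.load I.n (I.bin i) / I.wt i

/-- The state during the third pass. -/
structure OutInv (ω : ℕ → unitInterval) (i : ℕ) (s : State) : Prop where
  int00 : s.int 0 0 = I.n
  real6 : ∀ j < I.n, s.real 6 (j : ℕ) = ω j
  int9 : ∀ j < I.n, s.int 9 (j : ℕ) = I.bin j
  real10 : ∀ j < I.n, s.real 10 (j : ℕ) = I.wt j
  real12 : ∀ L : ℕ, s.real 12 (L : ℕ) = I.load I.n L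
  real13 : ∀ j < I.n, s.real 13 (j : ℕ) = I.load j (I.bin j)
  int2 : s.int 2 0 = (I.selection ω i).length
  out : ∀ j v : ℕ, (I.selection ω i)[j]? = some v →
    s.int 3 (j : ℕ) = v ∧ s.real 2 (j : ℕ) = I.outWt v

theorem outInv_step (ω : ℕ → unitInterval) (i : ℕ) (hi : i < I.n) (s : State)
    (h4 : s.int 4 0 = i) (h : I.OutInv ω i s) :
    (outBody.exec ω s).int 4 0 = i ∧ I.OutInv ω (i + 1) (outBody.exec ω s) := by
  classical
  have h6 : s.real 6 ((I.bin i : ℤ) - 1) = ω (I.bin i - 1) := by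
    have := I.bin_spec' i
    rw [← h.real6 _ (by omega)]
    congr 1
    omega
  by_cases hsel : I.Selected ω i
  · have hsel' := hsel
    rw [Selected] at hsel'
    have hx : outBody.exec ω s = (((s.setReal 9 0 (ω (I.bin i - 1) * I.load I.n (I.bin i))).setInt 3
        (s.int 2 0) i).setReal 2 (s.int 2 0) (I.outWt i)).setInt 2 0 (s.int 2 0 + 1) := by
      simp [outBody, Prog.exec, BoolExpr.eval, IntExpr.eval, RealExpr.eval, ivar, rvar, h4, h6,
        h.int9 i hi, h.real10 i hi, h.real12, h.real13 i hi, hsel', outWt]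
    have hl : I.selection ω (i + 1) = I.selection ω i ++ [i] := by
      simp [selection, List.range_succ, hsel]
    rw [hx]
    refine ⟨by simpa using h4, ⟨by simpa using h.int00, by simpa using h.real6,
      by simpa using h.int9, by simpa using h.real10, by simpa using h.real12,
      by simpa using h.real13, by simp [hl, h.int2], ?_⟩⟩
    intro j v hv
    rw [hl, List.getElem?_append] at hv
    split_ifs at hv with hj
    · have hne : (j : ℤ) ≠ s.int 2 0 := by rw [h.int2]; omega
      simp [Function.update_of_ne hne, h.out j v hv]
    · have hj' : j = (I.selection ω i).length := by
        by_contra hne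
        rw [List.getElem?_eq_none (by simp; omega)] at hv
        cases hv
      subst hj'
      obtain rfl : i = v := by simpa using hv
      simp [h.int2]
  · have hsel' := hsel
    rw [Selected] at hsel'
    have hx : outBody.exec ω s = s.setReal 9 0 (ω (I.bin i - 1) * I.load I.n (I.bin i)) := by
      simp [outBody, Prog.exec, BoolExpr.eval, IntExpr.eval, RealExpr.eval, ivar, rvar, h4, h6,
        h.int9 i hi, h.real10 i hi, h.real12, h.real13 i hi]
      intro h1 h2
      exact absurd ⟨h1, h2⟩ hsel'
    have hl : I.selection ω (i + 1) = I.selection ω i := by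
      simp [selection, List.range_succ, hsel]
    rw [hx]
    exact ⟨by simpa using h4, ⟨by simpa using h.int00, by simpa using h.real6,
      by simpa using h.int9, by simpa using h.real10, by simpa using h.real12,
      by simpa using h.real13, by simpa [hl] using h.int2, by simpa [hl] using h.out⟩⟩

end Input

/-- The sampling algorithm. -/
def samplingProg : Prog :=
  .seq (forLoop Input.costBody) <| .seq Input.paramProg <|
    .seq (forLoop (.seq Input.keyBody Input.packBody)) (forLoop Input.outBody)

/-- A constant that bounds the number of steps per client. -/
def stepBound : ℕ :=
  2 * ((Input.costBody.maxSteps + 20) + Input.paramProg.maxSteps +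
    ((Prog.seq Input.keyBody Input.packBody).maxSteps + 20) + (Input.outBody.maxSteps + 20))

/-- The algorithm halts after a linear number of steps and outputs the selected clients. -/
theorem samplingProg_runs (I : Input) (hn : 0 < I.n) (hc : ∀ i < I.n, 0 ≤ I.c i ∧ I.c i < I.k)
    (hb : 0 ≤ I.bound) (ω : ℕ → unitInterval) (s : State) (hs : I.Holds s) (hd : s.drawn = 0)
    (hint : ∀ b a, 2 ≤ b → s.int b a = 0) (hreal : ∀ b a, 2 ≤ b → s.real b a = 0) :
    ∃ s' t, Runs ω samplingProg s s' t ∧ I.OutInv ω I.n s' ∧ t ≤ stepBound * I.n := by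
  obtain ⟨s₁, t₁, hrun₁, hI₁, ht₁⟩ := forLoop_runs (body := Input.costBody)
    (by simp [Input.costBody, Prog.IsFlat]) ω I.n (I.CostInv ω)
    (fun i s v h => ⟨h.holds.congr (by simp) (by simp) (by simp) (by simp), by simpa using h.drawn,
      by simpa using h.int5, by simpa using h.real3, by simpa using h.real4, by simpa using h.real5,
      by simpa using h.real6, by simpa using h.int2, by simpa using h.int8,
      by simpa using h.real12⟩)
    (fun i s h => h.holds.int00) (I.costInv_step ω) s
    ⟨hs, hd, by simp [hint], by simp, by simp [hreal], by simp [hreal], by simp,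
      by simp [hint], by simp [hint], by simp [hreal]⟩
  obtain ⟨t₂, ht₂, hrun₂⟩ := Prog.IsFlat.runs (p := Input.paramProg)
    (by simp [Input.paramProg, Prog.IsFlat]) ω s₁
  obtain ⟨s₃, t₃, hrun₃, hI₃, ht₃⟩ := forLoop_runs (body := .seq Input.keyBody Input.packBody)
    (by simp [Input.keyBody, Input.packBody, Prog.IsFlat]) ω I.n (I.PackInv ω)
    (fun i s v h => ⟨h.holds.congr (by simp) (by simp) (by simp) (by simp),
      by simpa using h.int5, by simpa using h.real3, by simpa using h.real4, by simpa using h.real6,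
      by simpa using h.real7, by simpa using h.int6, by simpa using h.real8, by simpa using h.int2,
      by simpa using h.int8, by simpa using h.int9, by simpa using h.real10,
      by simpa using h.real12, by simpa using h.real13⟩)
    (fun i s h => h.holds.int00) (I.packInv_step hc hb ω) _ (I.param_spec ω s₁ hI₁)
  obtain ⟨s₄, t₄, hrun₄, hI₄, ht₄⟩ := forLoop_runs (body := Input.outBody)
    (by simp [Input.outBody, Prog.IsFlat]) ω I.n (I.OutInv ω)
    (fun i s v h => ⟨by simpa using h.int00, by simpa using h.real6,
      by simpa using h.int9, by simpa using h.real10, by simpa using h.real12,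
      by simpa using h.real13, by simpa using h.int2, by simpa using h.out⟩)
    (fun i s h => h.int00) (I.outInv_step ω) s₃
    ⟨hI₃.holds.int00, hI₃.real6, hI₃.int9, hI₃.real10, hI₃.real12, hI₃.real13,
      by simp [hI₃.int2, Input.selection], by simp [Input.selection]⟩
  refine ⟨s₄, _, .seq hrun₁ (.seq hrun₂ (.seq hrun₃ hrun₄)), hI₄, ?_⟩
  rw [stepBound]
  -- Every pass takes a multiple of n + 1 steps, and n + 1 ≤ 2n since n ≥ 1; this is the factor 2 in
  -- `stepBound`.
  nlinarith [Nat.zero_le (Input.costBody.maxSteps), Nat.zero_le Input.paramProg.maxSteps,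
    Nat.zero_le Input.outBody.maxSteps,
    Nat.zero_le (Prog.seq Input.keyBody Input.packBody).maxSteps]

end Clustering

-- Costs of clients in one bin: power inequalities and deterministic estimates.

namespace Clustering

open Finset

section Real

/-- (1 + ε/z)^z ≤ e^ε ≤ 1/(1 - ε) ≤ 1 + 2ε. -/
theorem add_pow_le_of_le {ε b r : ℝ} {z : ℕ} (hz : 0 < z) (hε : 0 < ε) (hε' : ε ≤ 1 / 2)
    (hb : 0 ≤ b) (hr : 0 ≤ b + r) (h : r ≤ ε / z * b) : (b + r) ^ z ≤ (1 + 2 * ε) * b ^ z := by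
  have hz' : (0 : ℝ) < z := by exact_mod_cast hz
  have h1 : b + r ≤ (ε / z + 1) * b := by linarith
  have h2 : (ε / z + 1) ^ z ≤ 1 + 2 * ε := by
    calc (ε / z + 1) ^ z ≤ Real.exp (ε / z) ^ z :=
          pow_le_pow_left₀ (by positivity) (Real.add_one_le_exp _) _
      _ = Real.exp ε := by rw [← Real.exp_nat_mul, mul_div_cancel₀ _ hz'.ne']
      _ ≤ 1 / (1 - ε) := Real.exp_bound_div_one_sub_of_interval hε.le (by linarith)
      _ ≤ 1 + 2 * ε := by rw [div_le_iff₀ (by linarith)]; nlinarith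
  calc (b + r) ^ z ≤ ((ε / z + 1) * b) ^ z := pow_le_pow_left₀ hr h1 _
    _ = (ε / z + 1) ^ z * b ^ z := mul_pow _ _ _
    _ ≤ _ := mul_le_mul_of_nonneg_right h2 (by positivity)

/-- A relaxed triangle inequality for z-th powers. Either r is at most an ε/(2z) fraction of b, and
the first term suffices, or b + r ≤ (3z/ε) r, and the second does. -/
theorem add_pow_le {ε b r : ℝ} {z : ℕ} (hz : 0 < z) (hε : 0 < ε) (hε' : ε ≤ 1) (hb : 0 ≤ b)
    (hr : 0 ≤ r) : (b + r) ^ z ≤ (1 + ε) * b ^ z + (3 * z / ε) ^ z * r ^ z := by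
  have hz' : (1 : ℝ) ≤ z := by exact_mod_cast hz
  by_cases h : r ≤ ε / 2 / z * b
  · have := add_pow_le_of_le hz (half_pos hε) (by linarith) hb (by linarith) h
    have h2 : 0 ≤ (3 * z / ε) ^ z * r ^ z := by positivity
    linarith
  · push Not at h
    have h1 : b ≤ 2 * z / ε * r := by
      have : b = 2 * z / ε * (ε / 2 / z * b) := by field_simp
      rw [this]
      exact mul_le_mul_of_nonneg_left h.le (by positivity)
    have h3 : 1 ≤ z / ε := by rw [le_div_iff₀ hε]; linarith
    have h2 : b + r ≤ 3 * z / ε * r := by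
      have : 3 * z / ε * r = 2 * z / ε * r + z / ε * r := by ring
      nlinarith
    have h4 : (b + r) ^ z ≤ (3 * z / ε * r) ^ z := pow_le_pow_left₀ (by linarith) h2 _
    rw [mul_pow] at h4
    have : 0 ≤ (1 + ε) * b ^ z := by positivity
    linarith

/-- z - 2 factors b are traded for ν d. For z = 1 the truncated exponent is 0, and d ≤ b does the
work instead. -/
theorem sq_mul_pow_le {d b ν : ℝ} {z : ℕ} (hz : 0 < z) (hd : 0 ≤ d) (hdb : d ≤ b)
    (hb : b ≤ ν * d) : d ^ 2 * (b ^ (z - 1)) ^ 2 ≤ d ^ z * b ^ z * ν ^ (z - 2) := by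
  obtain _ | _ | k := z
  · omega
  · simp only [zero_add, tsub_self, pow_zero, one_pow, mul_one, pow_one, Nat.reduceSub]
    nlinarith
  · have h1 : b ^ k ≤ ν ^ k * d ^ k := by
      rw [← mul_pow]; exact pow_le_pow_left₀ (hd.trans hdb) hb _
    have h2 : 0 ≤ d ^ 2 * (b ^ k * b ^ 2) := by have := hd.trans hdb; positivity
    simp only [show k + 1 + 1 - 1 = k + 1 by omega, show k + 1 + 1 - 2 = k by omega]
    calc d ^ 2 * (b ^ (k + 1)) ^ 2 = d ^ 2 * (b ^ k * b ^ 2) * b ^ k := by ring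
      _ ≤ d ^ 2 * (b ^ k * b ^ 2) * (ν ^ k * d ^ k) := mul_le_mul_of_nonneg_left h1 h2
      _ = _ := by ring

theorem add_four_mul_pow_le {a d : ℝ} (ha : 0 ≤ a) (hd : 0 ≤ d) (z : ℕ) :
    (a + 4 * d) ^ z ≤ 8 ^ z * (a ^ z + d ^ z) := by
  have h8 : (8 : ℝ) ^ z = 2 ^ z * 4 ^ z := by rw [← mul_pow]; norm_num
  have h4 : (1 : ℝ) ≤ 4 ^ z := one_le_pow₀ (by norm_num)
  rcases le_total a (4 * d) with h | h
  · calc (a + 4 * d) ^ z ≤ (2 * (4 * d)) ^ z := pow_le_pow_left₀ (by positivity) (by linarith) _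
      _ = 8 ^ z * d ^ z := by rw [← mul_pow]; ring
      _ ≤ _ := mul_le_mul_of_nonneg_left (by linarith [pow_nonneg ha z]) (by positivity)
  · calc (a + 4 * d) ^ z ≤ (2 * a) ^ z := pow_le_pow_left₀ (by positivity) (by linarith) _
      _ = 2 ^ z * 1 * a ^ z := by rw [mul_pow]; ring
      _ ≤ 2 ^ z * 4 ^ z * a ^ z := by gcongr
      _ ≤ _ := by
        rw [h8]
        exact mul_le_mul_of_nonneg_left (by linarith [pow_nonneg hd z]) (by positivity)

end Real

variable {ι : Type*} [Fintype ι]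

/-- The sum of `f` over the cluster of `i`. -/
def clSum (cl : ι → ℤ) (f : ι → ℝ) (i : ι) : ℝ := ∑ j with cl j = cl i, f j

theorem clSum_congr {cl : ι → ℤ} {f : ι → ℝ} {i j : ι} (h : cl i = cl j) :
    clSum cl f i = clSum cl f j := by rw [clSum, clSum, h]

theorem clSum_nonneg {cl : ι → ℤ} {f : ι → ℝ} (hf : ∀ i, 0 ≤ f i) (i : ι) :
    0 ≤ clSum cl f i := sum_nonneg fun j _ => hf j

theorem le_clSum {cl : ι → ℤ} {f : ι → ℝ} (hf : ∀ i, 0 ≤ f i) (i : ι) :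
    f i ≤ clSum cl f i :=
  single_le_sum (f := f) (fun j _ => hf j) (by simp)

/-- The charging argument: the `g`-sum of each cluster is distributed among its members in
proportion to `f`. Equality can fail only where the `f`-sum is 0 and division by it yields 0. -/
theorem sum_mul_clSum_div_le {cl : ι → ℤ} {f g : ι → ℝ} (hg : ∀ i, 0 ≤ g i) :
    ∑ i, f i * (clSum cl g i / clSum cl f i) ≤ ∑ i, g i := by
  have h1 : ∀ i, f i * (clSum cl g i / clSum cl f i) =
      ∑ j, if cl j = cl i then f i * g j / clSum cl f j else 0 := by
    intro i
    rw [← sum_filter, clSum, sum_div, mul_sum]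
    refine sum_congr rfl fun j hj => ?_
    rw [clSum_congr (mem_filter.mp hj).2]
    ring
  simp_rw [h1]
  rw [sum_comm]
  refine sum_le_sum fun j _ => ?_
  have h2 : (∑ i, if cl j = cl i then f i * g j / clSum cl f j else 0) =
      clSum cl f j / clSum cl f j * g j := by
    rw [← sum_filter, ← sum_div, ← sum_mul]
    simp only [eq_comm (a := cl j)]
    rw [← clSum]
    ring
  rw [h2]
  exact mul_le_of_le_one_left (hg j) (div_self_le_one _)

/-- The average of `d ^ z` over the cluster of `i`. -/
noncomputable def clAvg (z : ℕ) (d : ι → ℝ) (cl : ι → ℤ) (i : ι) : ℝ :=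
  clSum cl (fun j => d j ^ z) i / clSum cl (fun _ => 1) i

/-- The distances of the clients to the centers of a solution: they are nonnegative, and the
triangle inequality holds along the way through the common nearest center of a cluster. -/
structure Admissible (d : ι → ℝ) (cl : ι → ℤ) (a : ι → ℝ) : Prop where
  nonneg : ∀ i, 0 ≤ a i
  le_add : ∀ i j, cl i = cl j → a i ≤ a j + (d i + d j)

/-- A packing of the clients into bins: the clients of a bin have the same cluster and the same
kind (inner `0`, main `1`, outer `2`). -/
structure Packing (z : ℕ) (ε τ : ℝ) (d : ι → ℝ) (cl : ι → ℤ) where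
  bin : ι → ℕ
  wt : ι → ℝ
  kind : ι → ℕ
  wt_pos : ∀ i, 0 < wt i
  cl_eq : ∀ {i j}, bin i = bin j → cl i = cl j
  kind_eq : ∀ {i j}, bin i = bin j → kind i = kind j
  kind_le : ∀ i, kind i ≤ 2
  inner_wt : ∀ i, kind i = 0 → wt i = 1
  inner_le : ∀ i, kind i = 0 → d i ^ z ≤ (ε / (6 * z)) ^ (2 * z) * clAvg z d cl i
  main_wt : ∀ {i j}, kind i = 1 → bin i = bin j → wt i = wt j
  main_le : ∀ i, kind i = 1 → wt i ≤ d i ^ z ∧ d i ^ z ≤ 3 * wt i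
  outer_wt : ∀ i, kind i = 2 → wt i = d i ^ z
  outer_lt : ∀ i, kind i = 2 → (6 * z / ε) ^ (2 * z) * clAvg z d cl i < d i ^ z
  -- Only bins with two clients are bounded; a client alone in its bin is always drawn and counted
  -- exactly, whatever its load.
  load_le : ∀ i j, kind i ≠ 0 → i ≠ j → bin i = bin j → ∑ l with bin l = bin i, wt l ≤ τ

namespace Packing

variable {z : ℕ} {ε τ : ℝ} {d : ι → ℝ} {cl : ι → ℤ} (B : Packing z ε τ d cl)

/-- The load of the bin of `i`. -/
def load (i : ι) : ℝ := ∑ l with B.bin l = B.bin i, B.wt l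

theorem load_pos (i : ι) : 0 < B.load i :=
  sum_pos (fun j _ => B.wt_pos j) ⟨i, by simp⟩

theorem load_congr {i j : ι} (h : B.bin i = B.bin j) : B.load i = B.load j := by
  rw [load, load, h]

variable (hz : 0 < z) (hε : 0 < ε) (hε' : ε < 1 / 3) (hd : ∀ i, 0 ≤ d i)

include hz hε hε' in
theorem three_le_div : 3 ≤ (z : ℝ) / ε := by
  have hz' : (1 : ℝ) ≤ z := by exact_mod_cast hz
  rw [le_div_iff₀ hε]; linarith

-- The exponent 2z in the definition of inner clients is spent here: one factor (ε/(6z))^z cancels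
-- the loss (3z/ε)^z · 2^z of `add_pow_le` and of doubling, and the other one is at most ε.
include hz hε hε' in
theorem inner_abs_le (hd : ∀ i, 0 ≤ d i) {a : ι → ℝ} (ha : Admissible d cl a) {i j : ι}
    (hi : B.kind i = 0) (hij : B.bin i = B.bin j) :
    |a j ^ z - a i ^ z| ≤ 2 * ε * a i ^ z + 2 * ε * clAvg z d cl i := by
  have hz' : (1 : ℝ) ≤ z := by exact_mod_cast hz
  have hcl := B.cl_eq hij
  have hj : B.kind j = 0 := by rw [← B.kind_eq hij, hi]
  have havg : 0 ≤ clAvg z d cl i :=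
    div_nonneg (clSum_nonneg (fun i => pow_nonneg (hd i) _) _) (clSum_nonneg (by simp) _)
  have havg' : clAvg z d cl j = clAvg z d cl i := by
    rw [clAvg, clAvg, clSum_congr hcl, clSum_congr (f := fun _ => 1) hcl]
  have h1 := B.inner_le i hi
  have h2 := B.inner_le j hj
  rw [havg'] at h2
  set A := clAvg z d cl i
  have h3 : (d i + d j) ^ z ≤ 2 ^ z * ((ε / (6 * z)) ^ (2 * z) * A) := by
    rcases le_total (d i) (d j) with h | h
    · calc (d i + d j) ^ z ≤ (2 * d j) ^ z :=
            pow_le_pow_left₀ (add_nonneg (hd i) (hd j)) (by linarith) _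
        _ ≤ _ := by rw [mul_pow]; exact mul_le_mul_of_nonneg_left h2 (by positivity)
    · calc (d i + d j) ^ z ≤ (2 * d i) ^ z :=
            pow_le_pow_left₀ (add_nonneg (hd i) (hd j)) (by linarith) _
        _ ≤ _ := by rw [mul_pow]; exact mul_le_mul_of_nonneg_left h1 (by positivity)
  have h4 : (3 * z / ε) ^ z * (d i + d j) ^ z ≤ ε * A := by
    have e1 : (3 * z / ε) ^ z * (2 ^ z * ((ε / (6 * z)) ^ (2 * z) * A)) =
        (ε / (6 * z)) ^ z * A := by
      have : (3 * z / ε) ^ z * 2 ^ z * (ε / (6 * z)) ^ z = 1 := by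
        rw [← mul_pow, ← mul_pow]
        have : 3 * z / ε * 2 * (ε / (6 * z)) = 1 := by field_simp; norm_num
        rw [this, one_pow]
      rw [two_mul, pow_add]
      linear_combination (ε / (6 * z)) ^ z * A * this
    have e2 : (ε / (6 * z)) ^ z ≤ ε := by
      have e3 : ε / (6 * z) ≤ ε := div_le_self hε.le (by linarith)
      calc (ε / (6 * z)) ^ z ≤ ε ^ z := pow_le_pow_left₀ (by positivity) e3 _
        _ ≤ ε ^ 1 := pow_le_pow_of_le_one hε.le (by linarith) hz
        _ = ε := pow_one _
    calc _ ≤ (3 * z / ε) ^ z * (2 ^ z * ((ε / (6 * z)) ^ (2 * z) * A)) :=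
          mul_le_mul_of_nonneg_left h3 (by positivity)
      _ = _ := e1
      _ ≤ _ := mul_le_mul_of_nonneg_right e2 havg
  have key : ∀ p q, a p ≤ a q + (d i + d j) → a p ^ z ≤ (1 + ε) * a q ^ z + ε * A := by
    intro p q h
    calc a p ^ z ≤ (a q + (d i + d j)) ^ z := pow_le_pow_left₀ (ha.nonneg p) h _
      _ ≤ (1 + ε) * a q ^ z + (3 * z / ε) ^ z * (d i + d j) ^ z :=
        add_pow_le hz hε (by linarith) (ha.nonneg q) (add_nonneg (hd i) (hd j))
      _ ≤ _ := by linarith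
  have k1 := key i j (ha.le_add i j hcl)
  have k2 := key j i (by linarith [ha.le_add j i hcl.symm])
  have p1 : 0 ≤ a i ^ z := pow_nonneg (ha.nonneg i) z
  have p2 : 0 ≤ a j ^ z := pow_nonneg (ha.nonneg j) z
  rw [abs_le]
  constructor
  · nlinarith [mul_nonneg hε.le p1, mul_nonneg hε.le havg, mul_le_mul_of_nonneg_left k2 hε.le]
  · nlinarith [mul_nonneg hε.le p1, mul_nonneg hε.le havg]

-- The weights in a main bin coincide and determine the costs up to the factor 3 ≤ 3^z.
include hz hd in
theorem main_dist_le {i j : ι} (hi : B.kind i = 1) (hij : B.bin i = B.bin j) :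
    d j ≤ 3 * d i := by
  have hj : B.kind j = 1 := by rw [← B.kind_eq hij, hi]
  by_contra h
  push Not at h
  have h1 := (B.main_le j hj).2
  have h2 := (B.main_le i hi).1
  have h3 : (3 * d i) ^ z < d j ^ z := pow_lt_pow_left₀ h (by linarith [hd i]) hz.ne'
  have h4 : (3 : ℝ) ≤ 3 ^ z := le_self_pow₀ (by norm_num) hz.ne'
  rw [mul_pow] at h3
  have h5 := mul_le_mul_of_nonneg_right h4 (pow_nonneg (hd i) z)
  rw [B.main_wt hi hij] at h2
  linarith

include hz hε hε' hd in
/-- The costs of two close clients that are far from the centers are almost the same. -/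
theorem main_pow_le {a : ι → ℝ} (ha : Admissible d cl a) {i j : ι}
    (hi : B.kind i = 1) (hij : B.bin i = B.bin j) (hfar : 4 * z / ε * d i ≤ a i) :
    a j ^ z ≤ (1 + 2 * ε) * a i ^ z := by
  have h1 := B.main_dist_le hz hd hi hij
  have h2 := ha.le_add j i (B.cl_eq hij).symm
  have hz' : (0 : ℝ) < z := by exact_mod_cast hz
  have h3 : d j + d i ≤ ε / z * a i := by
    have : ε / z * (4 * z / ε * d i) ≤ ε / z * a i :=
      mul_le_mul_of_nonneg_left hfar (by positivity)
    have e : ε / z * (4 * z / ε * d i) = 4 * d i := by field_simp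
    linarith
  have h4 : 0 ≤ a i + (d j + d i) := by linarith [ha.nonneg i, hd i, hd j]
  exact (pow_le_pow_left₀ (ha.nonneg j) h2 _).trans
    (add_pow_le_of_le hz hε (by linarith) (ha.nonneg i) h4 h3)

include hz hε hε' hd in
/-- The same as `main_pow_le`, with the far client on the other side. -/
theorem main_pow_le' {a : ι → ℝ} (ha : Admissible d cl a) {i j : ι}
    (hi : B.kind i = 1) (hij : B.bin i = B.bin j) (hfar : 8 * z / ε * d i ≤ a i) :
    a i ^ z ≤ (1 + 2 * ε) * a j ^ z := by
  have h1 := B.main_dist_le hz hd hi hij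
  have h2 := ha.le_add i j (B.cl_eq hij)
  have hz' : (1 : ℝ) ≤ z := by exact_mod_cast hz
  set t := ε / z with ht
  have ht0 : 0 < t := by positivity
  have ht1 : t ≤ 1 := by rw [ht, div_le_one (by linarith)]; linarith
  have h3 : 2 * (d i + d j) ≤ t * a i := by
    have : t * (8 * z / ε * d i) ≤ t * a i := mul_le_mul_of_nonneg_left hfar ht0.le
    have e : t * (8 * z / ε * d i) = 8 * d i := by rw [ht]; field_simp
    linarith
  have h5 : d i + d j ≤ t * a j := by nlinarith [hd i, hd j]
  have h4 : 0 ≤ a j + (d i + d j) := by linarith [ha.nonneg j, hd i, hd j]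
  exact (pow_le_pow_left₀ (ha.nonneg i) h2 _).trans
    (add_pow_le_of_le hz hε (by linarith) (ha.nonneg j) h4 h5)

end Packing

/-- `a'` approximates `a` at the clients for which one of them is not huge. -/
def Approximates (z : ℕ) (ε : ℝ) (d a a' : ι → ℝ) : Prop :=
  ∀ i, (a i ^ z ≤ (8 * z / ε) ^ z * d i ^ z ∨ a' i ^ z ≤ (8 * z / ε) ^ z * d i ^ z) →
    |a i ^ z - a' i ^ z| ≤ ε * (a i ^ z + d i ^ z)

/-- `u` and `v` agree up to the factor `1 + t` and the additive error `t * y`. -/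
def Near (t u v y : ℝ) : Prop := u ≤ (1 + t) * v + t * y ∧ v ≤ (1 + t) * u + t * y

theorem Near.mono {s t u v y : ℝ} (h : Near s u v y) (hst : s ≤ t) (hu : 0 ≤ u) (hv : 0 ≤ v)
    (hy : 0 ≤ y) : Near t u v y := by
  constructor
  · nlinarith [h.1]
  · nlinarith [h.2]

theorem near_of_abs_le {ε u v y : ℝ} (hε : 0 < ε) (hε' : ε < 1 / 3) (hu : 0 ≤ u)
    (hy : 0 ≤ y) (h : |u - v| ≤ ε * (u + y)) : Near (2 * ε) u v y := by
  rw [abs_le] at h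
  obtain ⟨h1, h2⟩ := h
  have h3 : (1 - ε) * u ≤ v + ε * y := by linarith
  have h4 : (1 + 2 * ε) * (1 - ε) ≥ 1 := by nlinarith
  have h5 : (1 + 2 * ε) * ((1 - ε) * u) ≤ (1 + 2 * ε) * (v + ε * y) :=
    mul_le_mul_of_nonneg_left h3 (by linarith)
  constructor
  · nlinarith [mul_nonneg hε.le hy, mul_le_mul_of_nonneg_right h4 hu]
  · nlinarith [mul_nonneg hε.le hy, mul_nonneg hε.le hu]

-- Being far transfers from `a'` to `a` with the loss of a factor 2 in the distance. Either `a i` is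
-- huge anyway, or the approximation applies at `i` and its error is too small to matter.
omit [Fintype ι] in
theorem Approximates.le_of_lt {z : ℕ} {ε y : ℝ} {d a a' : ι → ℝ} (hz : 0 < z) (hε : 0 < ε)
    (hε' : ε < 1 / 3) (hd : ∀ i, 0 ≤ d i) (ha : ∀ i, 0 ≤ a i) (h : Approximates z ε d a a')
    (hy : 1 ≤ y) (hy' : 2 * y ≤ 8 * z / ε) {i : ι}
    (hi : (2 * y) ^ z * d i ^ z < a' i ^ z) : y * d i ≤ a i := by
  have hx : 0 ≤ d i ^ z := pow_nonneg (hd i) z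
  have hyz : 1 ≤ y ^ z := one_le_pow₀ hy
  have hmono : (2 * y) ^ z ≤ (8 * z / ε) ^ z := pow_le_pow_left₀ (by linarith) hy' _
  rw [← pow_le_pow_iff_left₀ (mul_nonneg (by linarith) (hd i)) (ha i) hz.ne', mul_pow]
  by_cases hc : a i ^ z ≤ (8 * z / ε) ^ z * d i ^ z
  · have h1 := (abs_le.mp (h i (Or.inl hc))).1
    have hv : 0 ≤ a i ^ z := pow_nonneg (ha i) z
    have h2 : 2 * y ^ z ≤ (2 * y) ^ z := by
      rw [mul_pow]
      exact mul_le_mul_of_nonneg_right (le_self_pow₀ (by norm_num) hz.ne') (by positivity)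
    nlinarith [mul_le_mul_of_nonneg_right h2 hx, mul_le_mul_of_nonneg_right hyz hx]
  · push Not at hc
    have h1 : y ^ z ≤ (2 * y) ^ z := pow_le_pow_left₀ (by linarith) (by linarith) _
    exact (mul_le_mul_of_nonneg_right (h1.trans hmono) hx).trans hc.le

namespace Packing

variable {z : ℕ} {ε τ : ℝ} {d : ι → ℝ} {cl : ι → ℤ} (B : Packing z ε τ d cl)

/-- The clients whose cost is estimated with the help of the sampling: the main clients
in a bin with a client for which the solution is not huge, and the outer clients for which the
solution is not far away. -/
def good (a : ι → ℝ) : Set ι :=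
  -- The condition for main clients concerns the whole bin, so a main bin is good entirely or not at
  -- all. Outer clients are judged one by one, and an outer bin may be mixed.
  {i | (B.kind i = 1 ∧ ∃ j, B.bin i = B.bin j ∧ a j ^ z ≤ (8 * z / ε) ^ z * d j ^ z) ∨
    (B.kind i = 2 ∧ a i ^ z ≤ 8 ^ z * d i ^ z)}

theorem good_iff_of_main {a : ι → ℝ} {i j : ι} (hi : B.kind i = 1) (hij : B.bin i = B.bin j) :
    i ∈ B.good a ↔ j ∈ B.good a := by
  have hj : B.kind j = 1 := by rw [← B.kind_eq hij, hi]
  simp [good, hi, hj, hij]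

variable (hz : 0 < z) (hε : 0 < ε) (hε' : ε < 1 / 3) (hd : ∀ i, 0 ≤ d i)

-- If one of the two costs at `i` is not huge, the approximation applies at `i`; this covers outer
-- clients because 8 ≤ 8z/ε. Otherwise one goes through a client p of the bin whose cost for `a'` is
-- not huge: a i ≈ a p ≈ a' p ≈ a' i. Each comparison loses 1 + 2ε, and (1 + 2ε)³ ≤ 1 + 11ε for ε <
-- 1/3.
include hz hε hε' hd in
theorem near_of_mem_good {a a' : ι → ℝ} (ha : Admissible d cl a) (ha' : Admissible d cl a')
    (h : Approximates z ε d a a') {i : ι} (hi : i ∈ B.good a') :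
    Near (11 * ε) (a i ^ z) (a' i ^ z) (d i ^ z) := by
  have h3 := three_le_div hz hε hε'
  have hz' : (1 : ℝ) ≤ z := by exact_mod_cast hz
  have nn : ∀ j, 0 ≤ a j ^ z := fun j => pow_nonneg (ha.nonneg j) z
  have nn' : ∀ j, 0 ≤ a' j ^ z := fun j => pow_nonneg (ha'.nonneg j) z
  have nx : ∀ j, 0 ≤ d j ^ z := fun j => pow_nonneg (hd j) z
  have base : ∀ j, (a j ^ z ≤ (8 * z / ε) ^ z * d j ^ z ∨ a' j ^ z ≤ (8 * z / ε) ^ z * d j ^ z) →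
      Near (2 * ε) (a j ^ z) (a' j ^ z) (d j ^ z) := fun j hj =>
    near_of_abs_le hε hε' (nn j) (nx j) (h j hj)
  by_cases hc : a i ^ z ≤ (8 * z / ε) ^ z * d i ^ z ∨ a' i ^ z ≤ (8 * z / ε) ^ z * d i ^ z
  · exact (base i hc).mono (by linarith) (nn i) (nn' i) (nx i)
  rw [not_or, not_le, not_le] at hc
  rcases hi with ⟨hk, p, hip, hp⟩ | ⟨hk, hi⟩
  · have hbase := base p (Or.inr hp)
    have hpow : ∀ y, 0 ≤ y → (8 * z / ε) ^ z * d i ^ z < y ^ z → 8 * z / ε * d i ≤ y := by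
      intro y hy h
      rw [← mul_pow] at h
      exact (lt_of_pow_lt_pow_left₀ z hy h).le
    have f1 := hpow _ (ha.nonneg i) hc.1
    have f2 := hpow _ (ha'.nonneg i) hc.2
    have e4 : 4 * z / ε * d i ≤ 8 * z / ε * d i := by
      apply mul_le_mul_of_nonneg_right _ (hd i)
      have : 8 * z / ε = 4 * z / ε + 4 * (z / ε) := by ring
      linarith
    have m1 := B.main_pow_le' hz hε hε' hd ha hk hip f1
    have m2 := B.main_pow_le hz hε hε' hd ha hk hip (e4.trans f1)
    have m3 := B.main_pow_le' hz hε hε' hd ha' hk hip f2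
    have m4 := B.main_pow_le hz hε hε' hd ha' hk hip (e4.trans f2)
    have hx : d p ^ z ≤ 3 * d i ^ z := by
      have hkp : B.kind p = 1 := by rw [← B.kind_eq hip, hk]
      have h1 := (B.main_le p hkp).2
      have h2 := (B.main_le i hk).1
      rw [B.main_wt hk hip] at h2
      linarith
    have final : ∀ u u' v v' : ℝ, 0 ≤ v → u ≤ (1 + 2 * ε) * u' →
        u' ≤ (1 + 2 * ε) * v' + 2 * ε * d p ^ z → v' ≤ (1 + 2 * ε) * v →
        u ≤ (1 + 11 * ε) * v + 11 * ε * d i ^ z := by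
      intro u u' v v' hv g1 g2 g3
      have t1 : u' ≤ (1 + 2 * ε) * ((1 + 2 * ε) * v) + 2 * ε * (3 * d i ^ z) := by nlinarith
      have t2 : u ≤ (1 + 2 * ε) * ((1 + 2 * ε) * ((1 + 2 * ε) * v) + 2 * ε * (3 * d i ^ z)) :=
        g1.trans (mul_le_mul_of_nonneg_left t1 (by linarith))
      have t3 : (1 + 2 * ε) * (1 + 2 * ε) * (1 + 2 * ε) ≤ 1 + 11 * ε := by
        have q1 : ε * ε ≤ ε * (1 / 3) := mul_le_mul_of_nonneg_left hε'.le hε.le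
        have q2 : ε * ε * ε ≤ ε * (1 / 3) * (1 / 3) :=
          mul_le_mul q1 hε'.le hε.le (by linarith)
        linarith
      have t4 : (1 + 2 * ε) * (6 * ε) ≤ 11 * ε := by nlinarith
      have t5 := mul_le_mul_of_nonneg_right t3 hv
      have t6 := mul_le_mul_of_nonneg_right t4 (nx i)
      linarith
    exact ⟨final _ _ _ _ (nn' i) m1 hbase.1 m4, final _ _ _ _ (nn i) m3 hbase.2 m2⟩
  · exfalso
    have h8 : (8 : ℝ) ^ z ≤ (8 * z / ε) ^ z := by
      apply pow_le_pow_left₀ (by norm_num)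
      have : 8 * z / ε = 8 * (z / ε) := by ring
      linarith
    have := mul_le_mul_of_nonneg_right h8 (nx i)
    linarith [hc.2]

-- All clients of the bin are far for `a'`, hence for `a`; then moving within the bin hardly changes
-- `a`. The values of `a'` are not compared with those of `a`.
include hz hε hε' hd in
theorem abs_le_of_main_of_notMem_good {a a' : ι → ℝ} (ha : Admissible d cl a)
    (h : Approximates z ε d a a') {i j : ι} (hk : B.kind i = 1) (hi : i ∉ B.good a')
    (hij : B.bin i = B.bin j) : |a j ^ z - a i ^ z| ≤ 4 * ε * a i ^ z := by
  have h3 := three_le_div hz hε hε'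
  have e8 : 2 * (4 * z / ε) = 8 * z / ε := by ring
  have far : ∀ l, B.bin i = B.bin l → 4 * z / ε * d l ≤ a l := by
    intro l hl
    refine h.le_of_lt hz hε hε' hd ha.nonneg (y := 4 * z / ε) ?_ e8.le ?_
    · have : 4 * z / ε = 4 * (z / ε) := by ring
      linarith
    · rw [e8]
      by_contra hc
      exact hi (Or.inl ⟨hk, l, hl, not_lt.mp hc⟩)
  have m1 := B.main_pow_le hz hε hε' hd ha hk hij (far i rfl)
  have m2 := B.main_pow_le hz hε hε' hd ha (by rw [← B.kind_eq hij, hk]) hij.symm (far j hij)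
  have p1 : 0 ≤ a i ^ z := pow_nonneg (ha.nonneg i) z
  rw [abs_le]
  constructor
  · nlinarith [mul_nonneg hε.le p1, mul_le_mul_of_nonneg_left m1 hε.le]
  · nlinarith [mul_nonneg hε.le p1]

-- With N, X, V the size of the cluster, its cost for `A` and its cost for `a`, Markov's inequality
-- says that few members q have d q > d i. The others satisfy a i ≤ 2 a q, because 4 d i ≤ a i.
-- Hence N·(a i)^z ≤ 2^(z+1) V, and N > Θ X/(d i)^z, with Θ large compared to 2^(z+1)/ε, gives the
-- claim.
include hz hε hε' hd in
theorem le_of_outer_of_notMem_good {a a' : ι → ℝ} (ha : Admissible d cl a)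
    (h : Approximates z ε d a a') {i : ι} (hk : B.kind i = 2) (hi : i ∉ B.good a') :
    a i ^ z ≤ ε * (d i ^ z *
      (clSum cl (fun j => a j ^ z) i / clSum cl (fun j => d j ^ z) i)) := by
  have h3 := three_le_div hz hε hε'
  have hz' : (1 : ℝ) ≤ z := by exact_mod_cast hz
  have nn : ∀ j, 0 ≤ a j ^ z := fun j => pow_nonneg (ha.nonneg j) z
  have nx : ∀ j, 0 ≤ d j ^ z := fun j => pow_nonneg (hd j) z
  have far : 4 * d i ≤ a i := by
    refine h.le_of_lt hz hε hε' hd ha.nonneg (y := 4) (by norm_num) ?_ ?_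
    · have : 8 * z / ε = 8 * (z / ε) := by ring
      linarith
    · by_contra hc
      refine hi (Or.inr ⟨hk, ?_⟩)
      norm_num at hc
      exact hc
  have hlt := B.outer_lt i hk
  rw [clAvg] at hlt
  set X := clSum cl (fun j => d j ^ z) i with hX
  set V := clSum cl (fun j => a j ^ z) i with hV
  set N := clSum cl (fun _ => (1 : ℝ)) i with hN
  set Θ : ℝ := (6 * z / ε) ^ (2 * z) with hΘ
  have hNpos : 0 < N := lt_of_lt_of_le one_pos (le_clSum (f := fun _ => (1 : ℝ)) (by simp) i)
  have hXnn : 0 ≤ X := clSum_nonneg nx i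
  have hVnn : 0 ≤ V := clSum_nonneg nn i
  have hg : 18 ≤ 6 * z / ε := by
    have : 6 * z / ε = 6 * (z / ε) := by ring
    linarith
  have hΘ1 : 2 ^ (z + 1) ≤ ε * Θ := by
    have e1 : (18 : ℝ) ^ z ≤ (6 * z / ε) ^ z := pow_le_pow_left₀ (by norm_num) hg _
    have e2 : 6 * z / ε ≤ (6 * z / ε) ^ z := le_self_pow₀ (by linarith) hz.ne'
    have e3 : (2 : ℝ) ^ z ≤ 18 ^ z := pow_le_pow_left₀ (by norm_num) (by norm_num) _
    calc (2 : ℝ) ^ (z + 1) = 2 ^ z * 2 := pow_succ _ _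
      _ ≤ (6 * z / ε) ^ z * (6 * z) :=
          mul_le_mul (e3.trans e1) (by linarith) (by norm_num) (by positivity)
      _ = ε * ((6 * z / ε) ^ z * (6 * z / ε)) := by field_simp
      _ ≤ ε * ((6 * z / ε) ^ z * (6 * z / ε) ^ z) := by gcongr
      _ = ε * Θ := by rw [hΘ, two_mul, pow_add]
  have hΘ2 : 2 ≤ Θ := by
    have : (2 : ℝ) ≤ 2 ^ (z + 1) := le_self_pow₀ (by norm_num) (by omega)
    nlinarith
  have hΘpos : 0 < Θ := by linarith
  have hxpos : 0 < d i ^ z := lt_of_le_of_lt (by positivity) hlt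
  have hXpos : 0 < X := lt_of_lt_of_le hxpos (le_clSum (f := fun j => d j ^ z) nx i)
  have hlt' : Θ * X < d i ^ z * N := by
    rw [← mul_div_assoc, div_lt_iff₀ hNpos] at hlt
    exact hlt
  -- Markov's inequality in summed form: the first term serves the members with d q ≤ d i, the
  -- second those with d q > d i.
  have hsum : N * a i ^ z ≤ 2 ^ z * V + a i ^ z / d i ^ z * X := by
    have : ∀ q ∈ ({q | cl q = cl i} : Finset ι),
        1 * a i ^ z ≤ 2 ^ z * a q ^ z + a i ^ z / d i ^ z * d q ^ z := by
      intro q hq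
      have hq' : cl q = cl i := by simpa using hq
      rw [one_mul]
      by_cases hdq : d q ≤ d i
      · have h1 := ha.le_add i q hq'.symm
        have h2 : a i ≤ 2 * a q := by linarith
        have h4 := pow_le_pow_left₀ (ha.nonneg i) h2 z
        rw [mul_pow] at h4
        have : 0 ≤ a i ^ z / d i ^ z * d q ^ z :=
          mul_nonneg (div_nonneg (nn i) (nx i)) (nx q)
        linarith
      · push Not at hdq
        have h1 : d i ^ z ≤ d q ^ z := pow_le_pow_left₀ (hd i) hdq.le _
        have h2 : a i ^ z / d i ^ z * d i ^ z ≤ a i ^ z / d i ^ z * d q ^ z :=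
          mul_le_mul_of_nonneg_left h1 (div_nonneg (nn i) (nx i))
        rw [div_mul_cancel₀ _ hxpos.ne'] at h2
        have : 0 ≤ 2 ^ z * a q ^ z := mul_nonneg (by positivity) (nn q)
        linarith
    have := sum_le_sum this
    rwa [← sum_mul, sum_add_distrib, ← mul_sum, ← mul_sum] at this
  have hsmall : a i ^ z / d i ^ z * X ≤ N * a i ^ z / 2 := by
    have : 2 * X ≤ d i ^ z * N := by nlinarith
    rw [div_mul_eq_mul_div, div_le_iff₀ hxpos]
    nlinarith [nn i]
  have h5 : N * a i ^ z ≤ 2 ^ (z + 1) * V := by rw [pow_succ]; linarith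
  have h6 : N * a i ^ z ≤ ε * Θ * V := h5.trans (mul_le_mul_of_nonneg_right hΘ1 hVnn)
  rw [← mul_div_assoc, ← mul_div_assoc, le_div_iff₀ hXpos]
  have h7 : N * (a i ^ z * X) ≤ N * (ε * (d i ^ z * V)) := by
    calc N * (a i ^ z * X) = N * a i ^ z * X := by ring
      _ ≤ ε * Θ * V * X := mul_le_mul_of_nonneg_right h6 hXnn
      _ = ε * V * (Θ * X) := by ring
      _ ≤ ε * V * (d i ^ z * N) := mul_le_mul_of_nonneg_left hlt'.le (by positivity)
      _ = _ := by ring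
  exact le_of_mul_le_mul_left h7 hNpos

end Packing
end Clustering

-- Estimates from representatives: propagation of errors and widths of the bins.

namespace Clustering

open Finset

/-- Propagation of a relative error `ε` through an approximation with relative error `11 ε`. -/
theorem abs_sub_le_of_near {ε E V E' V' X : ℝ} (hε : 0 < ε) (hε' : ε < 1 / 3)
    (hE' : 0 ≤ E') (hV : 0 ≤ V) (hV' : 0 ≤ V') (hX : 0 ≤ X)
    (h1 : E ≤ (1 + 11 * ε) * E' + 33 * ε * X) (h2 : E' ≤ (1 + 11 * ε) * E + 33 * ε * X)
    (h3 : V ≤ (1 + 11 * ε) * V' + 11 * ε * X) (h4 : V' ≤ (1 + 11 * ε) * V + 11 * ε * X)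
    (h5 : |E' - V'| ≤ ε * (V' + X)) : |E - V| ≤ 3000 * ε * (V + X) := by
  rw [abs_le] at h5
  obtain ⟨h5, h6⟩ := h5
  -- Write E - V = (E - E') + (E' - V') + (V' - V) and compare every term with ε Q; the constants
  -- are generous.
  set Q := V + X with hQ
  have hQ0 : 0 ≤ Q := by positivity
  have hεQ : 0 ≤ ε * Q := by positivity
  have b0 : ε * X ≤ ε * Q := mul_le_mul_of_nonneg_left (by linarith) hε.le
  have b0' : ε * V ≤ ε * Q := mul_le_mul_of_nonneg_left (by linarith) hε.le
  have b1 : V' ≤ 6 * Q := by nlinarith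
  have b2 : ε * V' ≤ 6 * (ε * Q) := by nlinarith
  have c1 : V' - V ≤ 22 * (ε * Q) := by nlinarith
  have c2 : E' - V' ≤ 7 * (ε * Q) := by nlinarith
  have c3 : V' - E' ≤ 7 * (ε * Q) := by nlinarith
  have b3 : E' ≤ 9 * Q := by nlinarith
  have b4 : ε * E' ≤ 9 * (ε * Q) := by nlinarith
  have c4 : E - E' ≤ 132 * (ε * Q) := by nlinarith
  have b5 : E ≤ 60 * Q := by nlinarith
  have b6 : ε * E ≤ 60 * (ε * Q) := by nlinarith
  have c5 : E' - E ≤ 693 * (ε * Q) := by nlinarith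
  have c6 : V - V' ≤ 77 * (ε * Q) := by nlinarith
  rw [abs_le]
  constructor <;> nlinarith

namespace Packing

variable {ι : Type*} [Fintype ι]
variable {z : ℕ} {ε τ : ℝ} {d : ι → ℝ} {cl : ι → ℤ} (B : Packing z ε τ d cl)

/-- The estimate of the sum of `f` from the representatives `r i` of the bins. -/
noncomputable def est (r : ι → ι) (f : ι → ℝ) : ℝ := ∑ i, B.wt i / B.wt (r i) * f (r i)

theorem est_nonneg (r : ι → ι) {f : ι → ℝ} (hf : ∀ i, 0 ≤ f i) : 0 ≤ B.est r f :=
  sum_nonneg fun i _ => mul_nonneg (div_nonneg (B.wt_pos _).le (B.wt_pos _).le) (hf _)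

theorem est_mono (r : ι → ι) {f g : ι → ℝ} (h : ∀ i, f i ≤ g i) : B.est r f ≤ B.est r g :=
  sum_le_sum fun i _ => mul_le_mul_of_nonneg_left (h _) (div_nonneg (B.wt_pos _).le (B.wt_pos _).le)

theorem est_add_mul (r : ι → ι) (s t : ℝ) (f g : ι → ℝ) :
    B.est r (fun i => s * f i + t * g i) = s * B.est r f + t * B.est r g := by
  rw [est, est, est, mul_sum, mul_sum, ← sum_add_distrib]
  exact sum_congr rfl fun i _ => by ring

theorem est_add (r : ι → ι) (f g : ι → ℝ) :
    B.est r (fun i => f i + g i) = B.est r f + B.est r g := by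
  simpa using B.est_add_mul r 1 1 f g

variable (hz : 0 < z) (hε : 0 < ε) (hε' : ε < 1 / 3) (hd : ∀ i, 0 ≤ d i)

theorem kind_of_mem_good {a : ι → ℝ} {i : ι} (h : i ∈ B.good a) :
    B.kind i = 1 ∨ B.kind i = 2 := by
  rcases h with h | h
  exacts [Or.inl h.1, Or.inr h.1]

-- An outer bin reproduces its d^z exactly, and in a main bin d^z varies by a factor at most 3.
-- Inner bins, where d^z need not be comparable, contain no good clients.
include hd in
theorem est_good_le {r : ι → ι} (hr : ∀ i, B.bin (r i) = B.bin i) (a : ι → ℝ) :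
    B.est r ((B.good a).indicator fun i => d i ^ z) ≤ 3 * ∑ i, d i ^ z := by
  classical
  rw [est, mul_sum]
  refine sum_le_sum fun i _ => ?_
  have nx : ∀ j, 0 ≤ d j ^ z := fun j => pow_nonneg (hd j) z
  rw [Set.indicator_apply]
  split_ifs with h
  · have hw := B.wt_pos (r i)
    rcases B.kind_of_mem_good h with hk | hk
    · have hk' : B.kind i = 1 := by rw [← B.kind_eq (hr i), hk]
      rw [B.main_wt hk (hr i), div_self (B.wt_pos i).ne', one_mul]
      have := (B.main_le _ hk).2
      rw [B.main_wt hk (hr i)] at this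
      linarith [(B.main_le i hk').1]
    · have hk' : B.kind i = 2 := by rw [← B.kind_eq (hr i), hk]
      rw [← B.outer_wt _ hk, div_mul_cancel₀ _ hw.ne', B.outer_wt _ hk']
      linarith [nx i]
  · simpa using nx i

include hz hε hε' hd in
/-- If the estimate of the costs of the good clients is correct for `a'`, then the estimate of
the total cost is correct for `a`. -/
theorem est_abs_sub_le {r : ι → ι} (hr : ∀ i, B.bin (r i) = B.bin i) {a a' : ι → ℝ}
    (ha : Admissible d cl a) (ha' : Admissible d cl a') (h : Approximates z ε d a a')
    (hest : |B.est r ((B.good a').indicator fun i => a' i ^ z) -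
      ∑ i, (B.good a').indicator (fun i => a' i ^ z) i| ≤
      ε * (∑ i, (B.good a').indicator (fun i => a' i ^ z) i + ∑ i, d i ^ z)) :
    |B.est r (fun i => a i ^ z) - ∑ i, a i ^ z| ≤
      3010 * ε * (∑ i, a i ^ z + ∑ i, d i ^ z) := by
  classical
  have nn : ∀ j, 0 ≤ a j ^ z := fun j => pow_nonneg (ha.nonneg j) z
  have nn' : ∀ j, 0 ≤ a' j ^ z := fun j => pow_nonneg (ha'.nonneg j) z
  have nx : ∀ j, 0 ≤ d j ^ z := fun j => pow_nonneg (hd j) z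
  have ni : ∀ (G : Set ι) (f : ι → ℝ), (∀ i, 0 ≤ f i) → ∀ i, 0 ≤ G.indicator f i :=
    fun G f hf i => Set.indicator_nonneg (fun i _ => hf i) i
  set G := B.good a' with hG
  set X := ∑ i, d i ^ z with hX
  have hXnn : 0 ≤ X := sum_nonneg fun i _ => nx i
  have near : ∀ i, G.indicator (fun i => a i ^ z) i ≤
        (1 + 11 * ε) * G.indicator (fun i => a' i ^ z) i +
          11 * ε * G.indicator (fun i => d i ^ z) i ∧
      G.indicator (fun i => a' i ^ z) i ≤
        (1 + 11 * ε) * G.indicator (fun i => a i ^ z) i +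
          11 * ε * G.indicator (fun i => d i ^ z) i := by
    intro i
    by_cases hi : i ∈ G
    · simp only [Set.indicator_of_mem hi]
      exact B.near_of_mem_good hz hε hε' hd ha ha' h hi
    · simp [Set.indicator_of_notMem hi]
  have hXG : ∑ i, G.indicator (fun i => d i ^ z) i ≤ X :=
    sum_le_sum fun i _ => Set.indicator_le_self' (fun _ _ => nx _) i
  have hXE := B.est_good_le hd hr a'
  rw [← hG, ← hX] at hXE
  have hεnn : 0 ≤ 11 * ε := by linarith
  -- On the good set the hypothesis about `a'` is carried over to `a`. The 33 in
  -- `abs_sub_le_of_near` is 11 times the factor 3 of `est_good_le`.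
  have main := abs_sub_le_of_near (X := X) hε hε'
    (B.est_nonneg r (ni G _ nn')) (sum_nonneg fun i _ => ni G _ nn i)
    (sum_nonneg fun i _ => ni G _ nn' i) hXnn
    (E := B.est r (G.indicator fun i => a i ^ z))
    (by
      have := B.est_mono r fun i => (near i).1
      rw [B.est_add_mul] at this
      nlinarith [mul_le_mul_of_nonneg_left hXE hεnn])
    (by
      have := B.est_mono r fun i => (near i).2
      rw [B.est_add_mul] at this
      nlinarith [mul_le_mul_of_nonneg_left hXE hεnn])
    (by
      have := sum_le_sum fun i (_ : i ∈ univ) => (near i).1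
      rw [sum_add_distrib, ← mul_sum, ← mul_sum] at this
      nlinarith [mul_le_mul_of_nonneg_left hXG hεnn])
    (by
      have := sum_le_sum fun i (_ : i ∈ univ) => (near i).2
      rw [sum_add_distrib, ← mul_sum, ← mul_sum] at this
      nlinarith [mul_le_mul_of_nonneg_left hXG hεnn])
    hest
  set rest : ι → ℝ := Gᶜ.indicator fun i => a i ^ z with hrest
  have split : ∀ i, a i ^ z = G.indicator (fun i => a i ^ z) i + rest i := fun i => by
    have := congrFun (Set.indicator_self_add_compl G fun i => a i ^ z) i
    exact this.symm
  have hE : B.est r (fun i => a i ^ z) = B.est r (G.indicator fun i => a i ^ z) + B.est r rest := by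
    rw [← B.est_add]
    congr 1
    funext i
    exact split i
  have hV : ∑ i, a i ^ z = ∑ i, G.indicator (fun i => a i ^ z) i + ∑ i, rest i := by
    rw [← sum_add_distrib]
    exact sum_congr rfl fun i _ => split i
  have havg : ∀ i, 0 ≤ clAvg z d cl i := fun i =>
    div_nonneg (clSum_nonneg nx _) (clSum_nonneg (by simp) _)
  -- The share of the client in the cost of its cluster for `a`, in proportion to d^z; the shares
  -- add up to at most the total cost.
  set q : ι → ℝ := fun i => d i ^ z *
      (clSum cl (fun j => a j ^ z) i / clSum cl (fun j => d j ^ z) i) with hq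
  have hqnn : ∀ i, 0 ≤ q i := fun i =>
    mul_nonneg (nx i) (div_nonneg (clSum_nonneg nn _) (clSum_nonneg nx _))
  -- Off the good set the error is bounded client by client, for any choice of representatives.
  have pt : ∀ i, |B.wt i / B.wt (r i) * rest (r i) - rest i| ≤
      4 * ε * a i ^ z + 2 * ε * clAvg z d cl i + ε * q i := by
    intro i
    have p1 : 0 ≤ ε * a i ^ z := mul_nonneg hε.le (nn i)
    have p2 : 0 ≤ ε * clAvg z d cl i := mul_nonneg hε.le (havg i)
    have p3 : 0 ≤ ε * q i := mul_nonneg hε.le (hqnn i)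
    have hkr := B.kind_eq (hr i)
    have hcases : B.kind i = 0 ∨ B.kind i = 1 ∨ B.kind i = 2 := by
      have := B.kind_le i
      omega
    rcases hcases with hk | hk | hk
    · have hi : i ∉ G := fun hi => by rcases B.kind_of_mem_good hi with h | h <;> omega
      have hri : r i ∉ G := fun hi => by rcases B.kind_of_mem_good hi with h | h <;> omega
      rw [hrest, Set.indicator_of_mem (Set.mem_compl hi), Set.indicator_of_mem (Set.mem_compl hri),
        B.inner_wt i hk, B.inner_wt _ (hkr.trans hk), div_one, one_mul]
      have := B.inner_abs_le hz hε hε' hd ha hk (hr i).symm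
      linarith
    · have hiff := B.good_iff_of_main (a := a') hk (hr i).symm
      rw [B.main_wt hk (hr i).symm, div_self (B.wt_pos _).ne', one_mul]
      by_cases hi : i ∈ G
      · rw [hrest, Set.indicator_of_notMem (Set.notMem_compl_iff.mpr hi),
          Set.indicator_of_notMem (Set.notMem_compl_iff.mpr (hiff.mp hi)), sub_zero, abs_zero]
        linarith
      · have hri : r i ∉ G := fun h => hi (hiff.mpr h)
        rw [hrest, Set.indicator_of_mem (Set.mem_compl hi),
          Set.indicator_of_mem (Set.mem_compl hri)]
        have := B.abs_le_of_main_of_notMem_good hz hε hε' hd ha h hk hi (hr i).symm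
        linarith
    -- Since an outer bin may be mixed, nothing is gained from comparing the two terms: each of them
    -- is separately between 0 and ε q i.
    · have hkr' := hkr.trans hk
      have hxr : 0 < d (r i) ^ z := by rw [← B.outer_wt _ hkr']; exact B.wt_pos _
      have b1 : rest i ≤ ε * q i := by
        rw [hrest, Set.indicator_apply]
        split_ifs with hi
        · exact B.le_of_outer_of_notMem_good hz hε hε' hd ha h hk hi
        · exact p3
      have b2 : B.wt i / B.wt (r i) * rest (r i) ≤ ε * q i := by
        rw [hrest, Set.indicator_apply]
        split_ifs with hi
        · have h1 := B.le_of_outer_of_notMem_good hz hε hε' hd ha h hkr' hi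
          rw [clSum_congr (B.cl_eq (hr i)), clSum_congr (f := fun j => d j ^ z)
            (B.cl_eq (hr i))] at h1
          rw [B.outer_wt _ hk, B.outer_wt _ hkr']
          refine (mul_le_mul_of_nonneg_left h1 (div_nonneg (nx i) hxr.le)).trans (le_of_eq ?_)
          rw [hq]
          field_simp
        · simpa using p3
      have n1 : 0 ≤ rest i := ni _ _ nn i
      have n2 : 0 ≤ B.wt i / B.wt (r i) * rest (r i) :=
        mul_nonneg (div_nonneg (B.wt_pos _).le (B.wt_pos _).le) (ni _ _ nn _)
      rw [abs_le]
      constructor <;> linarith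
  have hrestsum : |B.est r rest - ∑ i, rest i| ≤ 5 * ε * ∑ i, a i ^ z + 2 * ε * X := by
    rw [est, ← sum_sub_distrib]
    refine (abs_sum_le_sum_abs _ _).trans ((sum_le_sum fun i _ => pt i).trans ?_)
    rw [sum_add_distrib, sum_add_distrib, ← mul_sum, ← mul_sum, ← mul_sum]
    have s1 : ∑ i, q i ≤ ∑ i, a i ^ z := sum_mul_clSum_div_le nn
    have s2 : ∑ i, clAvg z d cl i ≤ X := by
      have := sum_mul_clSum_div_le (cl := cl) (f := fun _ => 1) nx
      simpa [clAvg] using this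
    nlinarith [mul_le_mul_of_nonneg_left s1 hε.le, mul_le_mul_of_nonneg_left s2 hε.le]
  have hV0 : 0 ≤ ∑ i, a i ^ z := sum_nonneg fun i _ => nn i
  have hVG : ∑ i, G.indicator (fun i => a i ^ z) i ≤ ∑ i, a i ^ z :=
    sum_le_sum fun i _ => Set.indicator_le_self' (fun _ _ => nn _) i
  have e : B.est r (fun i => a i ^ z) - ∑ i, a i ^ z =
      (B.est r (G.indicator fun i => a i ^ z) - ∑ i, G.indicator (fun i => a i ^ z) i) +
        (B.est r rest - ∑ i, rest i) := by
    rw [hE]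
    linarith
  rw [e]
  refine (abs_add_le _ _).trans ?_
  have l1 := mul_le_mul_of_nonneg_left hVG hε.le
  have l2 := mul_nonneg hε.le hV0
  have l3 := mul_nonneg hε.le hXnn
  nlinarith

/-- The factor in the bound for the variance. -/
noncomputable def spread (z : ℕ) (ε : ℝ) : ℝ := 108 * z ^ 2 * 64 ^ z * (28 * z / ε) ^ (z - 2)

-- Powers differ by at most z·|a i - a j|·b^(z-1), with |a i - a j| ≤ 6 d q and b = a q + 4 d q.
-- Since some client of the good bin has a ≤ (8z/ε) d, and distances within the bin differ by a
-- factor at most 3, b ≤ (24z/ε) d q + 8 d q ≤ (28z/ε) d q. The client `q` of the bin is arbitrary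
-- so that the bound can be averaged over the bin.
include hz hε hε' hd in
theorem main_sq_sub_le {a : ι → ℝ} (ha : Admissible d cl a) {i j q : ι} (hk : B.kind i = 1)
    (hi : i ∈ B.good a) (hij : B.bin i = B.bin j) (hiq : B.bin i = B.bin q) :
    (a i ^ z - a j ^ z) ^ 2 ≤ 36 * z ^ 2 * 8 ^ z * (28 * z / ε) ^ (z - 2) *
      (d q ^ z * (a q ^ z + d q ^ z)) := by
  have h3 := three_le_div hz hε hε'
  have hkq : B.kind q = 1 := by rw [← B.kind_eq hiq, hk]
  obtain ⟨p, hip, hp⟩ : ∃ p, B.bin i = B.bin p ∧ a p ^ z ≤ (8 * z / ε) ^ z * d p ^ z := by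
    rcases hi with h | h
    · exact h.2
    · exact absurd h.1 (by omega)
  have hp' : a p ≤ 8 * z / ε * d p := by
    rw [← mul_pow] at hp
    exact (pow_le_pow_iff_left₀ (ha.nonneg p) (mul_nonneg (by positivity) (hd p)) hz.ne').mp hp
  have dist : ∀ l, B.bin i = B.bin l → d l ≤ 3 * d q := fun l hl =>
    B.main_dist_le hz hd hkq (hiq.symm.trans hl)
  have up : ∀ l, B.bin i = B.bin l → a l ≤ a q + 4 * d q := fun l hl => by
    have := ha.le_add l q (B.cl_eq (hl.symm.trans hiq))
    linarith [dist l hl]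
  have hbq : a q + 4 * d q ≤ 28 * z / ε * d q := by
    have h1 := ha.le_add q p (B.cl_eq (hiq.symm.trans hip))
    have h2 := dist p hip
    have e1 : 8 * z / ε * d p ≤ 8 * z / ε * (3 * d q) :=
      mul_le_mul_of_nonneg_left h2 (by positivity)
    have e2 : 8 * z / ε * (3 * d q) = 24 * (z / ε * d q) := by ring
    have e3 : 28 * z / ε * d q = 28 * (z / ε * d q) := by ring
    have e4 : 3 * d q ≤ z / ε * d q := mul_le_mul_of_nonneg_right h3 (hd q)
    linarith [hd q]
  set b := a q + 4 * d q with hb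
  have hbnn : 0 ≤ b := by have := ha.nonneg q; have := hd q; positivity
  have hdiff : |a i - a j| ≤ 6 * d q := by
    rw [abs_le]
    have h1 := ha.le_add i j (B.cl_eq hij)
    have h2 := ha.le_add j i (B.cl_eq hij).symm
    constructor <;> linarith [dist i rfl, dist j hij]
  have hpow : |a i ^ z - a j ^ z| ≤ 6 * d q * z * b ^ (z - 1) := by
    refine (abs_pow_sub_pow_le (a i) (a j) z).trans ?_
    rw [abs_of_nonneg (ha.nonneg i), abs_of_nonneg (ha.nonneg j)]
    have := hd q
    have h1 : max (a i) (a j) ^ (z - 1) ≤ b ^ (z - 1) :=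
      pow_le_pow_left₀ ((ha.nonneg i).trans (le_max_left _ _)) (max_le (up i rfl) (up j hij)) _
    have h2 : 0 ≤ max (a i) (a j) ^ (z - 1) :=
      pow_nonneg ((ha.nonneg i).trans (le_max_left _ _)) _
    gcongr
  have hsq : (a i ^ z - a j ^ z) ^ 2 ≤ (6 * d q * z * b ^ (z - 1)) ^ 2 := by
    rw [← sq_abs]
    exact pow_le_pow_left₀ (abs_nonneg _) hpow _
  have h5 := sq_mul_pow_le hz (hd q) (by linarith [ha.nonneg q, hd q]) hbq
  have h6 := add_four_mul_pow_le (ha.nonneg q) (hd q) z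
  rw [← hb] at h6
  have nx : 0 ≤ d q ^ z := pow_nonneg (hd q) z
  calc (a i ^ z - a j ^ z) ^ 2 ≤ 36 * z ^ 2 * (d q ^ 2 * (b ^ (z - 1)) ^ 2) := by
        refine hsq.trans (le_of_eq ?_)
        ring
    _ ≤ 36 * z ^ 2 * (d q ^ z * b ^ z * (28 * z / ε) ^ (z - 2)) := by gcongr
    _ ≤ 36 * z ^ 2 * (d q ^ z * (8 ^ z * (a q ^ z + d q ^ z)) * (28 * z / ε) ^ (z - 2)) := by
        gcongr
    _ = _ := by ring

include hz hε hε' hd in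
/-- The variation of the estimate within one bin. -/
theorem sq_sub_le {a : ι → ℝ} (ha : Admissible d cl a) {i j : ι} (hij : B.bin i = B.bin j)
    (hτ : 0 ≤ τ) :
    (B.load i / B.wt i * (B.good a).indicator (fun i => a i ^ z) i -
        B.load j / B.wt j * (B.good a).indicator (fun i => a i ^ z) j) ^ 2 ≤
      spread z ε * τ * ∑ q with B.bin q = B.bin i,
        ((B.good a).indicator (fun i => a i ^ z) q + d q ^ z) := by
  classical
  have h3 := three_le_div hz hε hε'
  have hz' : (1 : ℝ) ≤ z := by exact_mod_cast hz
  have nn : ∀ j, 0 ≤ a j ^ z := fun j => pow_nonneg (ha.nonneg j) z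
  have nx : ∀ j, 0 ≤ d j ^ z := fun j => pow_nonneg (hd j) z
  set G := B.good a with hG
  set f := G.indicator (fun i => a i ^ z) with hf
  have nf : ∀ i, 0 ≤ f i := fun i => Set.indicator_nonneg (fun i _ => nn i) i
  have hsp : 0 ≤ spread z ε := by rw [spread]; positivity
  have hS : 0 ≤ ∑ q with B.bin q = B.bin i, (f q + d q ^ z) :=
    sum_nonneg fun q _ => add_nonneg (nf q) (nx q)
  have hrhs : 0 ≤ spread z ε * τ * ∑ q with B.bin q = B.bin i, (f q + d q ^ z) := by positivity
  have hν : 1 ≤ 28 * z / ε := by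
    have : 28 * z / ε = 28 * (z / ε) := by ring
    linarith
  have hν' : 1 ≤ (28 * z / ε) ^ (z - 2) := one_le_pow₀ hν
  have hz2 : (1 : ℝ) ≤ (z : ℝ) ^ 2 := one_le_pow₀ hz'
  -- Only for two different clients is the load of their bin known to be at most τ.
  by_cases hne : i = j
  · subst hne
    simpa using hrhs
  have hcases : B.kind i = 0 ∨ B.kind i = 1 ∨ B.kind i = 2 := by
    have := B.kind_le i
    omega
  have hkj := B.kind_eq hij
  have hlij := B.load_congr hij
  have hlpos := B.load_pos i
  rcases hcases with hk | hk | hk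
  · have hi : i ∉ G := fun hi => by rcases B.kind_of_mem_good hi with h | h <;> omega
    have hj : j ∉ G := fun hi => by rcases B.kind_of_mem_good hi with h | h <;> omega
    rw [hf, Set.indicator_of_notMem hi, Set.indicator_of_notMem hj]
    simpa using hrhs
  · have hload : B.load i ≤ τ := B.load_le i j (by omega) hne hij
    have hiff := B.good_iff_of_main (a := a) hk hij
    by_cases hi : i ∈ G
    · have hall : ∀ q, B.bin i = B.bin q → f q = a q ^ z := fun q hq =>
        Set.indicator_of_mem ((B.good_iff_of_main (a := a) hk hq).mp hi) _
      rw [hall i rfl, hall j hij, ← hlij, ← B.main_wt hk hij, ← mul_sub, mul_pow, div_pow]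
      set K := 36 * z ^ 2 * 8 ^ z * (28 * z / ε) ^ (z - 2) with hK
      have hKnn : 0 ≤ K := by positivity
      -- One of the two factors load is expanded as a sum over q, each summand being treated with
      -- its own bound; the other one is at most τ.
      have key : B.load i * (a i ^ z - a j ^ z) ^ 2 ≤
          3 * B.wt i ^ 2 * K * ∑ q with B.bin q = B.bin i, (f q + d q ^ z) := by
        rw [load, sum_mul, mul_sum]
        refine sum_le_sum fun q hq => ?_
        have hq' : B.bin i = B.bin q := (mem_filter.mp hq).2.symm
        have h1 := B.main_sq_sub_le hz hε hε' hd ha hk hi hij hq'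
        have hkq : B.kind q = 1 := by rw [← B.kind_eq hq', hk]
        have hw := B.main_wt hk hq'
        have h2 := (B.main_le q hkq).2
        rw [hall q hq', ← hw]
        rw [← hw] at h2
        have hwpos := B.wt_pos i
        calc B.wt i * (a i ^ z - a j ^ z) ^ 2 ≤ B.wt i * (K * (d q ^ z * (a q ^ z + d q ^ z))) :=
              mul_le_mul_of_nonneg_left h1 hwpos.le
          _ ≤ B.wt i * (K * (3 * B.wt i * (a q ^ z + d q ^ z))) := by
              have := add_nonneg (nn q) (nx q)
              gcongr
          _ = _ := by ring
      have hK3 : 3 * K ≤ spread z ε := by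
        have h8 : (8 : ℝ) ^ z ≤ 64 ^ z := pow_le_pow_left₀ (by norm_num) (by norm_num) _
        rw [hK, spread]
        calc 3 * (36 * z ^ 2 * 8 ^ z * (28 * z / ε) ^ (z - 2)) =
            108 * (z : ℝ) ^ 2 * 8 ^ z * (28 * z / ε) ^ (z - 2) := by ring
          _ ≤ _ := by gcongr
      have hw2 : 0 < B.wt i ^ 2 := pow_pos (B.wt_pos i) 2
      rw [div_mul_eq_mul_div, div_le_iff₀ hw2]
      set S := ∑ q with B.bin q = B.bin i, (f q + d q ^ z)
      calc B.load i ^ 2 * (a i ^ z - a j ^ z) ^ 2 =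
          B.load i * (B.load i * (a i ^ z - a j ^ z) ^ 2) := by ring
        _ ≤ B.load i * (3 * B.wt i ^ 2 * K * S) := mul_le_mul_of_nonneg_left key hlpos.le
        _ = (3 * K) * B.load i * S * B.wt i ^ 2 := by ring
        _ ≤ spread z ε * τ * S * B.wt i ^ 2 := by gcongr
    · rw [hf, Set.indicator_of_notMem hi, Set.indicator_of_notMem (fun h => hi (hiff.mpr h))]
      simpa using hrhs
  · have hload : B.load i ≤ τ := B.load_le i j (by omega) hne hij
    -- In an outer bin every contribution lies in [0, 8^z load], so the range of this interval is
    -- enough: its square is 64^z load², with one load at most τ and the other the sum of d^z.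
    have bound : ∀ l, B.bin i = B.bin l →
        0 ≤ B.load l / B.wt l * f l ∧ B.load l / B.wt l * f l ≤ 8 ^ z * B.load i := by
      intro l hl
      have hkl : B.kind l = 2 := by rw [← B.kind_eq hl, hk]
      have hw := B.wt_pos l
      refine ⟨mul_nonneg (div_nonneg (B.load_pos l).le hw.le) (nf l), ?_⟩
      have h1 : f l ≤ 8 ^ z * B.wt l := by
        rw [hf, Set.indicator_apply]
        split_ifs with hg
        · rcases hg with hg | hg
          · exact absurd hg.1 (by omega)
          · rw [B.outer_wt l hkl]; exact hg.2
        · positivity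
      rw [← B.load_congr hl]
      calc B.load i / B.wt l * f l ≤ B.load i / B.wt l * (8 ^ z * B.wt l) :=
            mul_le_mul_of_nonneg_left h1 (div_nonneg hlpos.le hw.le)
        _ = 8 ^ z * B.load i := by field_simp
    obtain ⟨i1, i2⟩ := bound i rfl
    obtain ⟨j1, j2⟩ := bound j hij
    have hsq : (B.load i / B.wt i * f i - B.load j / B.wt j * f j) ^ 2 ≤ (8 ^ z * B.load i) ^ 2 :=
      sq_le_sq' (by linarith) (by linarith)
    refine hsq.trans ?_
    have hS' : B.load i ≤ ∑ q with B.bin q = B.bin i, (f q + d q ^ z) := by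
      rw [load]
      refine sum_le_sum fun q hq => ?_
      have hkq : B.kind q = 2 := by rw [B.kind_eq (mem_filter.mp hq).2, hk]
      rw [B.outer_wt q hkq]
      linarith [nf q]
    have h64 : ((8 : ℝ) ^ z) ^ 2 = 64 ^ z := by rw [← pow_mul, mul_comm, pow_mul]; norm_num
    have hsp1 : (64 : ℝ) ^ z ≤ spread z ε := by
      rw [spread]
      calc (64 : ℝ) ^ z = 1 * 1 * 64 ^ z * 1 := by ring
        _ ≤ 108 * z ^ 2 * 64 ^ z * (28 * z / ε) ^ (z - 2) := by gcongr; norm_num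
    calc (8 ^ z * B.load i) ^ 2 = 64 ^ z * B.load i * B.load i := by rw [mul_pow, h64]; ring
      _ ≤ spread z ε * τ * ∑ q with B.bin q = B.bin i, (f q + d q ^ z) := by gcongr

end Packing
end Clustering

-- Drawing one item per bin: unbiasedness and concentration.

namespace BinSampling

open Finset ProbabilityTheory RealRAM

variable (n : ℕ) (b : ℕ → ℕ) (s : ℕ → ℝ)

/-- The total weight of the first `i` items in the bin `L`. -/
def pre (i L : ℕ) : ℝ := ∑ j ∈ range i with b j = L, s j

/-- The item `i` is selected by the number `u`. -/
def Sel (u : unitInterval) (i : ℕ) : Prop :=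
  pre b s i (b i) ≤ u * pre b s n (b i) ∧ u * pre b s n (b i) < pre b s i (b i) + s i

variable {n b s}

theorem pre_succ (i L : ℕ) : pre b s (i + 1) L = pre b s i L + if b i = L then s i else 0 := by
  rw [pre, range_add_one, filter_insert]
  split_ifs with h
  · rw [sum_insert (by simp), add_comm, pre]
  · rw [add_zero, pre]

theorem pre_mono (hs : ∀ i, 0 < s i) (L : ℕ) : Monotone fun i => pre b s i L := by
  refine monotone_nat_of_le_succ fun i => ?_
  rw [pre_succ]
  split_ifs
  · linarith [hs i]
  · linarith

theorem pre_nonneg (hs : ∀ i, 0 < s i) (i L : ℕ) : 0 ≤ pre b s i L :=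
  sum_nonneg fun j _ => (hs j).le

theorem pre_add_le (hs : ∀ i, 0 < s i) {i : ℕ} (hi : i < n) :
    pre b s i (b i) + s i ≤ pre b s n (b i) := by
  have := pre_mono (b := b) hs (b i) (Nat.succ_le_of_lt hi)
  simpa [pre_succ] using this

theorem pre_pos (hs : ∀ i, 0 < s i) {i : ℕ} (hi : i < n) : 0 < pre b s n (b i) := by
  linarith [pre_add_le (b := b) hs hi, pre_nonneg (b := b) hs i (b i), hs i]

/-- The items of a bin cut [0, total weight) into half-open intervals, and the first prefix sum
exceeding u · total identifies the item. The value u = 1 hits the uncovered right end. -/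
theorem exists_sel (hs : ∀ i, 0 < s i) {u : unitInterval} (hu : u ≠ 1) {i : ℕ} (hi : i < n) :
    ∃ j < n, b j = b i ∧ Sel n b s u j := by
  classical
  have hu1 : (u : ℝ) < 1 := lt_of_le_of_ne u.2.2 fun h => hu (Subtype.ext h)
  have hpos := pre_pos (b := b) hs hi
  set t := u * pre b s n (b i) with ht
  have htn : t < pre b s n (b i) := by nlinarith
  have hex : ∃ j, t < pre b s (j + 1) (b i) := ⟨n - 1, by rwa [Nat.sub_add_cancel (by omega)]⟩
  have h1 := Nat.find_spec hex
  have hle : pre b s (Nat.find hex) (b i) ≤ t := by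
    rcases Nat.eq_zero_or_pos (Nat.find hex) with h0 | h0
    · rw [h0]
      rw [show pre b s 0 (b i) = 0 by simp [pre]]
      exact mul_nonneg u.2.1 hpos.le
    · have := Nat.find_min hex (Nat.sub_lt h0 one_pos)
      rwa [Nat.sub_add_cancel (by omega), not_lt] at this
  have hbin : b (Nat.find hex) = b i := by
    by_contra hne
    rw [pre_succ, if_neg hne, add_zero] at h1
    linarith
  refine ⟨Nat.find hex, ?_, hbin, ?_⟩
  · by_contra hn
    have := pre_mono (b := b) hs (b i) (not_lt.mp hn)
    simp only at this
    linarith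
  · rw [pre_succ, if_pos hbin] at h1
    rw [Sel, hbin]
    exact ⟨hle, h1⟩

theorem sel_unique (hs : ∀ i, 0 < s i) {u : unitInterval} {i j : ℕ} (hij : b i = b j)
    (hi : Sel n b s u i) (hj : Sel n b s u j) : i = j := by
  have key : ∀ i j, b i = b j → Sel n b s u i → Sel n b s u j → ¬ i < j := by
    intro i j hij hi hj h
    have := pre_mono (b := b) hs (b i) (Nat.succ_le_of_lt h)
    simp only [Nat.succ_eq_add_one, pre_succ, if_true] at this
    have h1 := hi.2
    have h2 := hj.1
    rw [← hij] at h2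
    linarith
  rcases lt_trichotomy i j with h | h | h
  · exact absurd h (key i j hij hi hj)
  · exact h
  · exact absurd h (key j i hij.symm hj hi)

theorem setOf_sel_eq (hs : ∀ i, 0 < s i) {i : ℕ} (hi : i < n) :
    ∃ x y : unitInterval, {u | Sel n b s u i} = Set.Ico x y ∧
      (y : ℝ) - x = s i / pre b s n (b i) := by
  have hpos := pre_pos (b := b) hs hi
  have h1 := pre_nonneg (b := b) hs i (b i)
  have h2 := pre_add_le (b := b) hs hi
  refine ⟨⟨pre b s i (b i) / pre b s n (b i), div_nonneg h1 hpos.le,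
      (div_le_one hpos).mpr (by linarith [hs i])⟩,
    ⟨(pre b s i (b i) + s i) / pre b s n (b i), div_nonneg (by linarith [hs i]) hpos.le,
      (div_le_one hpos).mpr h2⟩, ?_, ?_⟩
  · ext u
    rw [Set.mem_ofPred_eq, Set.mem_Ico, Sel, ← Subtype.coe_le_coe, ← Subtype.coe_lt_coe,
      div_le_iff₀ hpos, lt_div_iff₀ hpos]
  · simp only
    ring

open Classical in
/-- The contribution of the bin `L` to the estimate of the sum of `f`. -/
noncomputable def contrib (n : ℕ) (b : ℕ → ℕ) (s f : ℕ → ℝ) (L : ℕ) (u : unitInterval) : ℝ :=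
  ∑ i ∈ range n with b i = L, if Sel n b s u i then pre b s n (b i) / s i * f i else 0

theorem contrib_eq (n : ℕ) (b : ℕ → ℕ) (s f : ℕ → ℝ) (L : ℕ) : contrib n b s f L = fun u =>
    ∑ i ∈ range n with b i = L,
      {u | Sel n b s u i}.indicator (fun _ => pre b s n (b i) / s i * f i) u := by
  classical
  funext u
  rw [contrib]
  refine sum_congr rfl fun i _ => ?_
  rw [Set.indicator_apply]
  simp only [Set.mem_ofPred_eq]

theorem measurableSet_sel (hs : ∀ i, 0 < s i) {i : ℕ} (hi : i < n) :
    MeasurableSet {u | Sel n b s u i} := by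
  obtain ⟨x, y, h, -⟩ := setOf_sel_eq (b := b) hs hi
  rw [h]
  exact measurableSet_Ico

theorem measurable_contrib (hs : ∀ i, 0 < s i) (f : ℕ → ℝ) (L : ℕ) :
    Measurable (contrib n b s f L) := by
  rw [contrib_eq]
  refine Finset.measurable_fun_sum _ fun i hi => measurable_const.indicator ?_
  exact measurableSet_sel hs (by simpa using (mem_filter.mp hi).1)

/-- Unbiasedness: an item is selected with probability s/total and then counts with the factor
total/s. -/
theorem integral_contrib (hs : ∀ i, 0 < s i) (f : ℕ → ℝ) (L : ℕ) :
    ∫ u, contrib n b s f L u = ∑ i ∈ range n with b i = L, f i := by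
  rw [contrib_eq, integral_finsetSum]
  · refine sum_congr rfl fun i hi => ?_
    have hi' : i < n := by simpa using (mem_filter.mp hi).1
    obtain ⟨x, y, h, hxy⟩ := setOf_sel_eq (b := b) hs hi'
    have hpos := pre_pos (b := b) hs hi'
    have hsi := hs i
    rw [integral_indicator_const _ (measurableSet_sel hs hi'), h, Measure.real,
      unitInterval.volume_Ico, hxy, ENNReal.toReal_ofReal (div_nonneg hsi.le hpos.le), smul_eq_mul]
    field_simp
  · intro i hi
    exact (integrable_const _).indicator
      (measurableSet_sel hs (by simpa using (mem_filter.mp hi).1))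

theorem contrib_eq_of_sel (hs : ∀ i, 0 < s i) (f : ℕ → ℝ) {u : unitInterval} {i : ℕ} (hi : i < n)
    (h : Sel n b s u i) : contrib n b s f (b i) u = pre b s n (b i) / s i * f i := by
  classical
  rw [contrib, sum_eq_single i, if_pos h]
  · intro j hj hji
    rw [if_neg fun h' => hji (sel_unique hs (mem_filter.mp hj).2 h' h)]
  · intro h'
    simp [hi] at h'

theorem coins_ae_ne_one : ∀ᵐ ω ∂coins, ∀ i, ω i ≠ 1 := by
  rw [ae_all_iff]
  intro i
  have h : ∀ᵐ u ∂(volume : Measure unitInterval), u ≠ 1 := by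
    rw [ae_iff]
    simp
  exact (measurePreserving_eval_infinitePi (fun _ : ℕ => (volume : Measure unitInterval))
    i).quasiMeasurePreserving.ae h

instance : IsProbabilityMeasure coins := by
  rw [coins]
  infer_instance

/-- The contributions are sub-Gaussian. -/
theorem hasSubgaussianMGF_contrib (hs : ∀ i, 0 < s i) (f : ℕ → ℝ) {w : ℕ → ℝ} (hw : ∀ L, 0 ≤ w L)
    (hvar : ∀ i < n, ∀ j < n, b i = b j →
      (pre b s n (b i) / s i * f i - pre b s n (b j) / s j * f j) ^ 2 ≤ w (b i)) (L l : ℕ) :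
    HasSubgaussianMGF (fun ω : ℕ → unitInterval => contrib n b s f L (ω l) -
      ∑ i ∈ range n with b i = L, f i) (w L / 4).toNNReal coins := by
  have hmean : ∫ ω, contrib n b s f L (ω l) ∂coins = ∑ i ∈ range n with b i = L, f i := by
    have := measurePreserving_eval_infinitePi (fun _ : ℕ => (volume : Measure unitInterval)) l
    rw [← integral_contrib hs, ← this.map_eq,
      integral_map this.measurable.aemeasurable (measurable_contrib hs f L).aestronglyMeasurable]
    rfl
  -- Almost surely exactly one item of a nonempty bin is selected, so the contribution lies between
  -- the extreme values over the bin. Hoeffding's lemma then gives the parameter ((hi - lo)/2)² ≤ w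
  -- L / 4.
  obtain ⟨lo, hi, hwidth, hrange⟩ : ∃ lo hi : ℝ, (hi - lo) ^ 2 ≤ w L ∧
      ∀ u : unitInterval, u ≠ 1 → contrib n b s f L u ∈ Set.Icc lo hi := by
    set T := {i ∈ range n | b i = L} with hT
    set g : ℕ → ℝ := fun i => pre b s n (b i) / s i * f i
    rcases T.eq_empty_or_nonempty with hE | hne
    · refine ⟨0, 0, by simpa using hw L, fun u _ => ?_⟩
      rw [contrib, ← hT, hE]
      simp
    · obtain ⟨i₀, hi₀, hmin⟩ := exists_min_image T g hne
      obtain ⟨i₁, hi₁, hmax⟩ := exists_max_image T g hne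
      rw [hT, mem_filter, mem_range] at hi₀ hi₁
      refine ⟨g i₀, g i₁, ?_, fun u hu => ?_⟩
      · have := hvar i₁ hi₁.1 i₀ hi₀.1 (hi₁.2.trans hi₀.2.symm)
        exact this.trans_eq (by rw [hi₁.2])
      · obtain ⟨j, hj, hjb, hsel⟩ := exists_sel (b := b) hs hu hi₀.1
        rw [hi₀.2] at hjb
        have hjT : j ∈ T := by rw [hT, mem_filter, mem_range]; exact ⟨hj, hjb⟩
        rw [← hjb, contrib_eq_of_sel hs f hj hsel]
        exact ⟨hmin j hjT, hmax j hjT⟩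
  have hsub := hasSubgaussianMGF_of_mem_Icc (μ := coins) (a := lo) (b := hi)
    (X := fun ω => contrib n b s f L (ω l))
    ((measurable_contrib hs f L).comp (measurable_pi_apply l)).aemeasurable
    (by filter_upwards [coins_ae_ne_one] with ω hω using hrange _ (hω l))
  rw [hmean] at hsub
  refine ⟨hsub.integrable_exp_mul, fun t => (hsub.mgf_le t).trans (Real.exp_le_exp.mpr ?_)⟩
  rw [Real.coe_toNNReal _ (by linarith [hw L])]
  push_cast
  rw [Real.norm_eq_abs, div_pow, sq_abs]
  have : (hi - lo) ^ 2 / 2 ^ 2 ≤ w L / 4 := by linarith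
  nlinarith [mul_le_mul_of_nonneg_right this (sq_nonneg t)]

open Classical in
/-- Concentration of the estimate of the sum of `f` around its mean. -/
theorem coins_abs_sub_le (hs : ∀ i, 0 < s i) (hb : ∀ i < n, 1 ≤ b i ∧ b i ≤ n) (f : ℕ → ℝ)
    {w : ℕ → ℝ} (hw : ∀ L, 0 ≤ w L)
    (hvar : ∀ i < n, ∀ j < n, b i = b j →
      (pre b s n (b i) / s i * f i - pre b s n (b j) / s j * f j) ^ 2 ≤ w (b i))
    {W t : ℝ} (hW : ∑ l ∈ range n, w (l + 1) ≤ W) (ht : 0 ≤ t) :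
    coins {ω | t ≤ |∑ i ∈ range n, (if Sel n b s (ω (b i - 1)) i then
        pre b s n (b i) / s i * f i else 0) - ∑ i ∈ range n, f i|} ≤
      ENNReal.ofReal (2 * Real.exp (-(2 * t ^ 2 / W))) := by
  have hW0 : 0 ≤ W := (sum_nonneg fun l _ => hw (l + 1)).trans hW
  set Z : ℕ → (ℕ → unitInterval) → ℝ := fun l ω => contrib n b s f (l + 1) (ω l) -
      ∑ i ∈ range n with b i = l + 1, f i with hZ
  have hmaps : ∀ i ∈ range n, b i - 1 ∈ range n := fun i hi => by
    have := hb i (by simpa using hi)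
    rw [mem_range]
    omega
  have hfib : ∀ l, {i ∈ range n | b i - 1 = l} = {i ∈ range n | b i = l + 1} := fun l =>
    filter_congr fun i hi => by
      have := hb i (by simpa using hi)
      omega
  have hsum : ∀ ω : ℕ → unitInterval, ∑ i ∈ range n, (if Sel n b s (ω (b i - 1)) i then
        pre b s n (b i) / s i * f i else 0) - ∑ i ∈ range n, f i = ∑ l ∈ range n, Z l ω := by
    intro ω
    rw [hZ, sum_sub_distrib, ← sum_fiberwise_of_maps_to hmaps, ← sum_fiberwise_of_maps_to hmaps f]
    simp_rw [hfib]
    congr 1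
    refine sum_congr rfl fun l _ => ?_
    rw [contrib]
    refine sum_congr rfl fun i hi => ?_
    rw [(mem_filter.mp hi).2, Nat.add_sub_cancel]
  -- The bin `l + 1` reads the random number `l` and no other.
  have hindep : iIndepFun Z coins :=
    iIndepFun_infinitePi (P := fun _ : ℕ => (volume : Measure unitInterval))
      (X := fun l u => contrib n b s f (l + 1) u - ∑ i ∈ range n with b i = l + 1, f i)
      fun l => (measurable_contrib hs f _).sub_const _
  have hsubG : HasSubgaussianMGF (fun ω => ∑ l ∈ range n, Z l ω) (W / 4).toNNReal coins := by
    have := HasSubgaussianMGF.sum_of_iIndepFun hindep (s := range n)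
      (c := fun l => (w (l + 1) / 4).toNNReal)
      fun l _ => hasSubgaussianMGF_contrib hs f hw hvar (l + 1) l
    refine ⟨this.integrable_exp_mul, fun r => (this.mgf_le r).trans (Real.exp_le_exp.mpr ?_)⟩
    rw [Real.coe_toNNReal _ (by linarith)]
    have h1 : ((∑ l ∈ range n, (w (l + 1) / 4).toNNReal : NNReal) : ℝ) ≤ W / 4 := by
      push_cast
      calc ∑ l ∈ range n, ((w (l + 1) / 4).toNNReal : ℝ) = ∑ l ∈ range n, w (l + 1) / 4 :=
            sum_congr rfl fun l _ => Real.coe_toNNReal _ (by linarith [hw (l + 1)])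
        _ ≤ W / 4 := by rw [← sum_div]; linarith
    nlinarith [mul_le_mul_of_nonneg_right h1 (sq_nonneg r)]
  -- For W = 0 both sides are 0 by the convention on division, and the resulting bound 2 is trivial.
  have hexp : -t ^ 2 / (2 * ((W / 4).toNNReal : ℝ)) = -(2 * t ^ 2 / W) := by
    rw [Real.coe_toNNReal _ (by linarith)]
    by_cases h0 : W = 0
    · simp [h0]
    · field_simp
      ring
  have up := hsubG.measure_ge_le ht
  have low := hsubG.neg.measure_ge_le ht
  rw [hexp] at up low
  have hsubset : {ω | t ≤ |∑ i ∈ range n, (if Sel n b s (ω (b i - 1)) i then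
        pre b s n (b i) / s i * f i else 0) - ∑ i ∈ range n, f i|} ⊆
      {ω | t ≤ ∑ l ∈ range n, Z l ω} ∪ {ω | t ≤ (-fun ω => ∑ l ∈ range n, Z l ω) ω} := by
    intro ω hω
    rw [Set.mem_ofPred_eq, hsum] at hω
    rcases le_abs.mp hω with h | h
    · exact Or.inl h
    · exact Or.inr (by simpa using h)
  refine (measure_mono hsubset).trans ((measure_union_le _ _).trans ?_)
  rw [two_mul, ENNReal.ofReal_add (Real.exp_pos _).le (Real.exp_pos _).le]
  refine add_le_add ?_ ?_
  · rw [← ENNReal.ofReal_toReal (measure_ne_top coins {ω | t ≤ ∑ l ∈ range n, Z l ω})]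
    exact ENNReal.ofReal_le_ofReal up
  · rw [← ENNReal.ofReal_toReal (measure_ne_top coins
      {ω | t ≤ (-fun ω => ∑ l ∈ range n, Z l ω) ω})]
    exact ENNReal.ofReal_le_ofReal low

end BinSampling

-- The packing of the algorithm: failure probability and number of samples.

namespace Clustering

open Finset RealRAM

namespace Input

/-- The conditions on the parameters of the input. -/
structure Valid (I : Input) : Prop where
  n_pos : 0 < I.n
  z_pos : 0 < I.z
  ε_pos : 0 < I.ε
  ε_lt : I.ε < 1 / 3
  π_pos : 0 < I.π
  π_lt : I.π < 1
  c_mem : ∀ i < I.n, 0 ≤ I.c i ∧ I.c i < I.k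
  d_nonneg : ∀ i, 0 ≤ I.d i
  -- Indices beyond n thereby become inner, which makes the weights positive at all natural numbers.
  d_eq_zero : ∀ i, I.n ≤ i → I.d i = 0

/-- The number of bits that the union bound has to take care of. -/
noncomputable def bits (I : Input) : ℝ :=
  I.k * Real.log I.m + Real.log (Real.log (1 / I.ε)) + Real.log (1 / I.π)

namespace Valid

variable {I : Input} (h : I.Valid)
include h

theorem one_lt_log : 1 < Real.log (1 / I.ε) := by
  rw [Real.lt_log_iff_exp_lt (by have := h.ε_pos; positivity)]
  refine Real.exp_one_lt_three.trans ?_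
  rw [lt_div_iff₀ h.ε_pos]
  linarith [h.ε_lt]

theorem loglog_le : Real.log (Real.log 3) ≤ Real.log (Real.log (1 / I.ε)) := by
  have h3 : 0 < Real.log 3 := Real.log_pos (by norm_num)
  refine Real.log_le_log h3 (Real.log_le_log (by norm_num) ?_)
  rw [le_div_iff₀ h.ε_pos]
  linarith [h.ε_lt]

omit h in
theorem loglog_three_pos : 0 < Real.log (Real.log 3) := by
  refine Real.log_pos ?_
  rw [Real.lt_log_iff_exp_lt (by norm_num)]
  exact Real.exp_one_lt_three

omit h in
theorem log_m_nonneg (I : Input) : 0 ≤ Real.log I.m := Real.log_natCast_nonneg _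

theorem log_π_pos : 0 < Real.log (1 / I.π) := by
  refine Real.log_pos ?_
  rw [lt_div_iff₀ h.π_pos]
  linarith [h.π_lt]

/-- An absolute positive lower bound, available because ε < 1/3; it absorbs additive constants into
the size bound. -/
theorem le_bits : Real.log (Real.log 3) ≤ I.bits := by
  have := mul_nonneg (Nat.cast_nonneg (α := ℝ) I.k) (log_m_nonneg I)
  rw [bits]
  linarith [h.loglog_le, h.log_π_pos]

theorem bits_pos : 0 < I.bits := loglog_three_pos.trans_le h.le_bits

theorem samples_eq : I.samples = (1 + I.bits) * (108 * (I.z * I.z) * (1792 * I.z) ^ I.z *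
    (1 / (I.ε * I.ε) + (1 / I.ε) ^ I.z)) := by
  have hz : (0 : ℝ) < I.z := by exact_mod_cast h.z_pos
  have hε := h.ε_pos
  rw [samples, bits, Real.exp_nat_mul, Real.exp_nat_mul, Real.exp_log (by positivity),
    Real.exp_log (by positivity)]

theorem samples_pos : 0 < I.samples := by
  have hz : (0 : ℝ) < I.z := by exact_mod_cast h.z_pos
  have hε := h.ε_pos
  have := h.bits_pos
  rw [h.samples_eq]
  positivity

/-- The choice of `samples` is made for this: half the exponent in Hoeffding's inequality is at
least ε² samples/spread. For z = 1 the exponent z - 2 is truncated and the summand 1/ε² is used; for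
z ≥ 2 the summand ε^(-z) is used. -/
theorem spread_le_samples : (1 + I.bits) * Packing.spread I.z I.ε ≤ I.ε ^ 2 * I.samples := by
  have hz : (1 : ℝ) ≤ I.z := by exact_mod_cast h.z_pos
  have hε := h.ε_pos
  have hb := h.bits_pos
  have key : (64 : ℝ) ^ I.z * (28 * I.z / I.ε) ^ (I.z - 2) ≤
      (1792 * I.z) ^ I.z * (I.ε ^ 2 * (1 / (I.ε * I.ε) + (1 / I.ε) ^ I.z)) := by
    have e1 : (1792 * (I.z : ℝ)) ^ I.z = 64 ^ I.z * (28 * I.z) ^ I.z := by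
      rw [← mul_pow]; ring
    rw [e1, mul_assoc]
    refine mul_le_mul_of_nonneg_left ?_ (by positivity)
    have h28 : (1 : ℝ) ≤ 28 * I.z := by linarith
    by_cases h1 : I.z = 1
    · rw [h1]
      have : (0 : ℝ) < (1 / I.ε) ^ 1 := by positivity
      have e2 : I.ε ^ 2 * (1 / (I.ε * I.ε) + (1 / I.ε) ^ 1) = 1 + I.ε := by field_simp
      rw [e2]
      norm_num
      linarith
    · have hz2 : 2 ≤ I.z := by have := h.z_pos; omega
      have e3 : I.ε ^ 2 * (1 / I.ε) ^ I.z = (1 / I.ε) ^ (I.z - 2) := by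
        obtain ⟨r, hr⟩ := Nat.exists_eq_add_of_le hz2
        rw [hr, pow_add, Nat.add_sub_cancel_left]
        field_simp
      have e4 : (28 * I.z / I.ε) ^ (I.z - 2) = (28 * (I.z : ℝ)) ^ (I.z - 2) *
          (1 / I.ε) ^ (I.z - 2) := by rw [← mul_pow]; ring
      rw [e4]
      have e5 : (28 * (I.z : ℝ)) ^ (I.z - 2) ≤ (28 * (I.z : ℝ)) ^ I.z :=
        pow_le_pow_right₀ h28 (by omega)
      refine mul_le_mul e5 ?_ (by positivity) (by positivity)
      rw [mul_add, e3]
      have : 0 ≤ I.ε ^ 2 * (1 / (I.ε * I.ε)) := by positivity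
      linarith
  rw [h.samples_eq, Packing.spread]
  calc (1 + I.bits) * (108 * (I.z : ℝ) ^ 2 * 64 ^ I.z * (28 * I.z / I.ε) ^ (I.z - 2)) =
      (1 + I.bits) * (108 * I.z ^ 2) * (64 ^ I.z * (28 * I.z / I.ε) ^ (I.z - 2)) := by ring
    _ ≤ (1 + I.bits) * (108 * I.z ^ 2) * ((1792 * I.z) ^ I.z *
        (I.ε ^ 2 * (1 / (I.ε * I.ε) + (1 / I.ε) ^ I.z))) := by gcongr
    _ = _ := by ring

theorem gamma_pos : 0 < 6 * I.z / I.ε := by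
  have hz : (0 : ℝ) < I.z := by exact_mod_cast h.z_pos
  have := h.ε_pos
  positivity

theorem one_le_gamma : 1 ≤ 6 * I.z / I.ε := by
  have hz : (1 : ℝ) ≤ I.z := by exact_mod_cast h.z_pos
  rw [le_div_iff₀ h.ε_pos]
  linarith [h.ε_lt]

theorem bound_nonneg : 0 ≤ I.bound :=
  mul_nonneg (by positivity) (Real.log_nonneg h.one_le_gamma)

theorem exp_bound : Real.exp I.bound = (6 * I.z / I.ε) ^ (2 * I.z) := by
  rw [bound, ← Nat.cast_ofNat (R := ℝ) (n := 2), ← Nat.cast_mul, Real.exp_nat_mul,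
    Real.exp_log h.gamma_pos]

theorem x_eq (i : ℕ) : I.x i = I.d i ^ I.z := by
  rw [x]
  split_ifs with hd
  · rw [le_antisymm hd (h.d_nonneg i), zero_pow h.z_pos.ne']
  · rw [Real.exp_nat_mul, Real.exp_log (not_le.mp hd)]

theorem x_nonneg (i : ℕ) : 0 ≤ I.x i := by
  rw [h.x_eq]; exact pow_nonneg (h.d_nonneg i) _

theorem inner_of_le {i : ℕ} (hi : I.n ≤ i) : I.Inner i := by
  left
  rw [h.x_eq, h.d_eq_zero i hi, zero_pow h.z_pos.ne']

omit h in
theorem x_pos {i : ℕ} (hi : ¬ I.Inner i) : 0 < I.x i := by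
  rw [Inner, not_or, not_le] at hi
  exact hi.1

theorem x_le_mass {i : ℕ} (hi : i < I.n) : I.x i ≤ I.mass (I.c i) :=
  single_le_sum (f := I.x) (fun j _ => h.x_nonneg j) (by simp [hi])

omit h in
theorem size_pos {i : ℕ} (hi : i < I.n) : 0 < I.size (I.c i) :=
  card_pos.mpr ⟨i, by simp [hi]⟩

theorem avg_pos_of_x_pos {i : ℕ} (hi : i < I.n) (hx : 0 < I.x i) : 0 < I.avg i :=
  div_pos (hx.trans_le (h.x_le_mass hi)) (by exact_mod_cast size_pos hi)

theorem avg_nonneg (i : ℕ) : 0 ≤ I.avg i :=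
  div_nonneg (sum_nonneg fun j _ => h.x_nonneg j) (Nat.cast_nonneg _)

theorem exp_level {i : ℕ} (hi : i < I.n) (hx : 0 < I.x i) :
    Real.exp (I.level i) * I.avg i = I.x i := by
  have := h.avg_pos_of_x_pos hi hx
  rw [level, Real.exp_sub, Real.exp_log hx, Real.exp_log this, div_mul_cancel₀ _ this.ne']

theorem wt_pos (i : ℕ) : 0 < I.wt i := by
  rw [wt]
  by_cases hin : I.Inner i
  · rw [if_pos hin]; exact one_pos
  · rw [if_neg hin]
    have hi : i < I.n := not_le.mp fun hi => hin (h.inner_of_le hi)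
    have hx := x_pos hin
    split_ifs
    · exact mul_pos (Real.exp_pos _) (h.avg_pos_of_x_pos hi hx)
    · exact hx

theorem main_wt_le {i : ℕ} (hin : ¬ I.Inner i) (hl : I.level i ≤ I.bound) :
    I.wt i ≤ I.x i ∧ I.x i ≤ 3 * I.wt i := by
  have hi : i < I.n := not_le.mp fun hi => hin (h.inner_of_le hi)
  have hx := x_pos hin
  have ha := h.avg_pos_of_x_pos hi hx
  rw [wt, if_neg hin, if_pos hl, ← h.exp_level hi hx]
  constructor
  · exact mul_le_mul_of_nonneg_right (Real.exp_le_exp.mpr (Int.floor_le _)) ha.le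
  · rw [← mul_assoc]
    refine mul_le_mul_of_nonneg_right ?_ ha.le
    calc Real.exp (I.level i) ≤ Real.exp (1 + ⌊I.level i⌋) :=
          Real.exp_le_exp.mpr (by linarith [Int.lt_floor_add_one (I.level i)])
      _ = Real.exp 1 * Real.exp ⌊I.level i⌋ := Real.exp_add _ _
      _ ≤ _ := mul_le_mul_of_nonneg_right Real.exp_one_lt_three.le (Real.exp_pos _).le

theorem wt_le_x {i : ℕ} (hin : ¬ I.Inner i) : I.wt i ≤ I.x i := by
  by_cases hl : I.level i ≤ I.bound
  · exact (h.main_wt_le hin hl).1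
  · rw [wt, if_neg hin, if_neg hl]

theorem total_pos {i : ℕ} (hin : ¬ I.Inner i) : 0 < I.total := by
  have hi : i < I.n := not_le.mp fun hi => hin (h.inner_of_le hi)
  exact (x_pos hin).trans_le (single_le_sum (f := I.x) (fun j _ => h.x_nonneg j) (by simpa))

theorem unit_nonneg : 0 ≤ I.unit :=
  div_nonneg (sum_nonneg fun j _ => h.x_nonneg j) h.samples_pos.le

theorem key_eq {i j : ℕ} (hi : i < I.n) (hj : j < I.n) (hij : I.key i = I.key j) :
    I.c i = I.c j ∧ I.cls i = I.cls j := by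
  have h1 : I.cls i = I.cls j := by
    rw [← I.key_ediv h.c_mem hi, ← I.key_ediv h.c_mem hj, hij]
  refine ⟨?_, h1⟩
  rw [key, key, h1] at hij
  linarith

end Valid

open Classical in
/-- The kind of a client: inner, main or outer. -/
noncomputable def kind (I : Input) (i : ℕ) : ℕ :=
  if I.Inner i then 0 else if I.level i ≤ I.bound then 1 else 2

theorem cls_eq_top_iff (I : Input) (hb : 0 ≤ I.bound) (i : ℕ) : I.cls i = I.top ↔
    ¬ I.Inner i ∧ ¬ I.level i ≤ I.bound := by
  have h2 : 0 ≤ ⌊I.bound⌋ := Int.floor_nonneg.mpr hb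
  rw [cls]
  split_ifs with h1 h3
  · simp only [h1, not_true, false_and, iff_false]
    unfold top
    omega
  · simp only [h3, not_true, and_false, iff_false]
    have := Int.floor_le_floor h3
    unfold top
    omega
  · simp [h1, h3]

theorem kind_congr (I : Input) (hb : 0 ≤ I.bound) {i j : ℕ} (hij : I.cls i = I.cls j) :
    I.kind i = I.kind j := by
  have h1 := I.cls_eq_inner_iff hb i
  have h2 := I.cls_eq_inner_iff hb j
  have h3 := I.cls_eq_top_iff hb i
  have h4 := I.cls_eq_top_iff hb j
  rw [← hij] at h2 h4
  have h5 : I.Inner i ↔ I.Inner j := h1.symm.trans h2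
  rw [h5] at h3
  have h6 := h3.symm.trans h4
  rw [kind, kind]
  by_cases hj : I.Inner j
  · rw [if_pos hj, if_pos (h5.mpr hj)]
  · rw [if_neg hj, if_neg fun hi => hj (h5.mp hi)]
    have h7 : I.level i ≤ I.bound ↔ I.level j ≤ I.bound := by tauto
    simp only [h7]

theorem of_kind_eq_one {I : Input} {i : ℕ} (hi : I.kind i = 1) :
    ¬ I.Inner i ∧ I.level i ≤ I.bound := by
  rw [kind] at hi
  by_cases h1 : I.Inner i
  · rw [if_pos h1] at hi
    omega
  · by_cases h2 : I.level i ≤ I.bound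
    · exact ⟨h1, h2⟩
    · rw [if_neg h1, if_neg h2] at hi
      omega

theorem of_kind_eq_two {I : Input} {i : ℕ} (hi : I.kind i = 2) :
    ¬ I.Inner i ∧ ¬ I.level i ≤ I.bound := by
  rw [kind] at hi
  by_cases h1 : I.Inner i
  · rw [if_pos h1] at hi
    omega
  · by_cases h2 : I.level i ≤ I.bound
    · rw [if_neg h1, if_pos h2] at hi
      omega
    · exact ⟨h1, h2⟩

theorem sum_fin_filter {n : ℕ} (f : ℕ → ℝ) (p : ℕ → Prop) [DecidablePred p] :
    ∑ i ∈ (univ : Finset (Fin n)).filter (fun i : Fin n => p (i : ℕ)), f i =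
      ∑ i ∈ range n with p i, f i := by
  rw [sum_filter, sum_filter]
  exact Fin.sum_univ_eq_sum_range (fun i => if p i then f i else 0) n

theorem load_eq_pre (I : Input) (i L : ℕ) : I.load i L = BinSampling.pre I.bin I.wt i L :=
  NextFit.load_eq i L

variable {I : Input} (h : I.Valid)

include h in
theorem Valid.clAvg_eq (i : Fin I.n) :
    clAvg I.z (fun i : Fin I.n => I.d i) (fun i => I.c i) i = I.avg i := by
  rw [clAvg, avg, clSum, clSum, sum_fin_filter (fun j => I.d j ^ I.z) fun j => I.c j = I.c i,
    sum_fin_filter (fun _ => 1) fun j => I.c j = I.c i, mass, size, card_eq_sum_ones]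
  push_cast
  congr 1
  exact sum_congr rfl fun j _ => (h.x_eq j).symm

/-- The packing that is computed by the algorithm. -/
noncomputable def packing : Packing I.z I.ε I.unit (fun i : Fin I.n => I.d i) (fun i => I.c i) where
  bin i := I.bin i
  wt i := I.wt i
  kind i := I.kind i
  wt_pos i := h.wt_pos i
  cl_eq {i j} hij := (h.key_eq i.2 j.2 (NextFit.key_eq_of_bin_eq hij)).1
  kind_eq {i j} hij :=
    I.kind_congr h.bound_nonneg (h.key_eq i.2 j.2 (NextFit.key_eq_of_bin_eq hij)).2
  kind_le i := by
    rw [kind]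
    split_ifs <;> omega
  inner_wt i hi := by
    by_cases hin : I.Inner i
    · rw [wt, if_pos hin]
    · rw [kind, if_neg hin] at hi
      split_ifs at hi
  inner_le i hi := by
    have hin : I.Inner i := by
      by_contra hin
      rw [kind, if_neg hin] at hi
      split_ifs at hi
    have hε := h.ε_pos
    rw [h.clAvg_eq, ← h.x_eq]
    by_cases hx : I.x i ≤ 0
    · exact hx.trans (mul_nonneg (by positivity) (h.avg_nonneg i))
    · have hl := hin.resolve_left hx
      have e : (I.ε / (6 * I.z)) ^ (2 * I.z) = Real.exp (-I.bound) := by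
        rw [Real.exp_neg, h.exp_bound, ← inv_pow, inv_div]
      rw [e, ← h.exp_level i.2 (not_le.mp hx)]
      exact mul_le_mul_of_nonneg_right (Real.exp_le_exp.mpr hl) (h.avg_nonneg i)
  main_wt {i j} hi hij := by
    obtain ⟨h1, h2⟩ := h.key_eq i.2 j.2 (NextFit.key_eq_of_bin_eq hij)
    have hj : I.kind j = 1 := by rw [← I.kind_congr h.bound_nonneg h2, hi]
    have key : ∀ l, I.kind l = 1 → I.wt l = Real.exp (I.cls l) * I.avg l := by
      intro l hl
      obtain ⟨h3, h4⟩ := of_kind_eq_one hl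
      rw [wt, cls, if_neg h3, if_neg h3, if_pos h4, if_pos h4]
    rw [key i hi, key j hj, h2, avg, avg, h1]
  main_le i hi := by
    obtain ⟨h3, h4⟩ := of_kind_eq_one hi
    rw [← h.x_eq]
    exact h.main_wt_le h3 h4
  outer_wt i hi := by
    obtain ⟨h3, h4⟩ := of_kind_eq_two hi
    rw [← h.x_eq, wt, if_neg h3, if_neg h4]
  outer_lt i hi := by
    obtain ⟨h3, h4⟩ := of_kind_eq_two hi
    have hx := Valid.x_pos h3
    rw [h.clAvg_eq, ← h.x_eq, ← h.exp_bound, ← h.exp_level i.2 hx]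
    exact mul_lt_mul_of_pos_right (Real.exp_lt_exp.mpr (not_le.mp h4)) (h.avg_pos_of_x_pos i.2 hx)
  load_le i j hi hne hij := by
    have hin : ¬ I.Inner i := by
      intro hin
      rw [kind, if_pos hin] at hi
      exact hi rfl
    have h1 := NextFit.load_le_cap (key := I.key) (s := I.wt) (cap := I.cap) I.n i i.2 j j.2
      (fun h' => hne (Fin.ext h')) hij
    rw [I.cap_key h.c_mem h.bound_nonneg i.2, if_neg hin, NextFit.load_eq] at h1
    rw [sum_fin_filter I.wt fun l => I.bin l = I.bin i]
    exact h1

theorem packing_load (i : Fin I.n) : (packing h).load i = I.load I.n (I.bin i) := by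
  rw [Packing.load, load_eq_pre, BinSampling.pre]
  exact sum_fin_filter I.wt fun l => I.bin l = I.bin i

theorem selected_iff (ω : ℕ → unitInterval) (i : ℕ) :
    I.Selected ω i ↔ BinSampling.Sel I.n I.bin I.wt (ω (I.bin i - 1)) i := by
  rw [Selected, BinSampling.Sel, load_eq_pre, load_eq_pre]

open Classical in
/-- The weighted sum over the selected clients is the estimate from representatives. -/
theorem exists_rep {ω : ℕ → unitInterval} (hω : ∀ i, ω i ≠ 1) :
    ∃ r : Fin I.n → Fin I.n, (∀ i, (packing h).bin (r i) = (packing h).bin i) ∧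
      ∀ f : Fin I.n → ℝ, (packing h).est r f =
        ∑ i : Fin I.n, if I.Selected ω i then I.outWt i * f i else 0 := by
  have hex : ∀ i : Fin I.n, ∃ j : Fin I.n, I.bin j = I.bin i ∧
      I.Selected ω j := by
    intro i
    obtain ⟨j, hj, hji, hsel⟩ :=
      BinSampling.exists_sel (b := I.bin) h.wt_pos (hω (I.bin i - 1)) i.2
    refine ⟨⟨j, hj⟩, hji, ?_⟩
    rw [selected_iff]
    rwa [← hji] at hsel
  choose r hr hsel using hex
  refine ⟨r, hr, fun f => ?_⟩
  rw [Packing.est, ← sum_fiberwise (s := univ) (g := r)]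
  refine sum_congr rfl fun j _ => ?_
  split_ifs with hj
  -- The clients represented by `j` are those of its bin, and their weights add up to the load in
  -- `outWt`.
  · have hfib : ∀ i, r i = j ↔ I.bin i = I.bin j := by
      intro i
      constructor
      · intro hij
        rw [← hr i, hij]
      · intro hij
        have h1 := hsel i
        rw [selected_iff] at h1 hj
        rw [hr i, hij] at h1
        exact Fin.ext (BinSampling.sel_unique h.wt_pos ((hr i).trans hij) h1 hj)
    have e1 : ∑ i with r i = j, (packing h).wt i / (packing h).wt (r i) * f (r i) =
        ∑ i with r i = j, (packing h).wt i / (packing h).wt j * f j :=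
      sum_congr rfl fun i hi => by rw [(mem_filter.mp hi).2]
    rw [e1, ← sum_mul, ← sum_div, outWt, ← packing_load h j, Packing.load]
    simp only [hfib]
    rfl
  · refine sum_eq_zero fun i hi => absurd ?_ hj
    rw [← (mem_filter.mp hi).2]
    exact hsel i

open Classical in
/-- The estimate of the sum of `f` from the selected clients. -/
noncomputable def estimate (I : Input) (ω : ℕ → unitInterval) (f : Fin I.n → ℝ) : ℝ :=
  ∑ i : Fin I.n, if I.Selected ω i then I.outWt i * f i else 0

include h in
/-- The probability that the costs of the good clients are not estimated correctly. -/
theorem coins_estimate_le {a : Fin I.n → ℝ}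
    (ha : Admissible (fun i : Fin I.n => I.d i) (fun i => I.c i) a) :
    coins {ω | ¬ |I.estimate ω (((packing h).good a).indicator fun i => a i ^ I.z) -
        ∑ i, ((packing h).good a).indicator (fun i => a i ^ I.z) i| ≤
      I.ε * (∑ i, ((packing h).good a).indicator (fun i => a i ^ I.z) i +
        ∑ i : Fin I.n, I.d i ^ I.z)} ≤ ENNReal.ofReal (2 * Real.exp (-(2 * (1 + I.bits)))) := by
  classical
  have nn : ∀ j, 0 ≤ a j ^ I.z := fun j => pow_nonneg (ha.nonneg j) _
  set G := (packing h).good a with hG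
  set f : Fin I.n → ℝ := G.indicator fun i => a i ^ I.z with hf
  have nf : ∀ i, 0 ≤ f i := fun i => Set.indicator_nonneg (fun i _ => nn i) i
  have htot : ∑ i : Fin I.n, I.d i ^ I.z = I.total := by
    rw [total, ← Fin.sum_univ_eq_sum_range]
    exact sum_congr rfl fun i _ => (h.x_eq i).symm
  rw [htot]
  -- A client that is not inner makes the total cost and the unit positive. Without one, the good
  -- set is empty and there is nothing to estimate.
  by_cases hex : ∃ i, ¬ I.Inner i
  · obtain ⟨i₀, hi₀⟩ := hex
    have htpos := h.total_pos hi₀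
    have hunit : 0 < I.unit := div_pos htpos h.samples_pos
    set Q := ∑ i, f i + I.total with hQ
    have hfs : 0 ≤ ∑ i, f i := sum_nonneg fun i _ => nf i
    have hQpos : 0 < Q := by positivity
    have hε := h.ε_pos
    have hz : (1 : ℝ) ≤ I.z := by exact_mod_cast h.z_pos
    set F : ℕ → ℝ := fun i => if hi : i < I.n then f ⟨i, hi⟩ else 0 with hF
    have hFf : ∀ i : Fin I.n, F i = f i := fun i => by rw [hF]; simp
    have hFnn : ∀ i, 0 ≤ F i := fun i => by
      rw [hF]
      simp only
      split_ifs
      exacts [nf _, le_rfl]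
    have hΛ : 0 < Packing.spread I.z I.ε := by rw [Packing.spread]; positivity
    set w : ℕ → ℝ := fun L => Packing.spread I.z I.ε * I.unit *
      ∑ q ∈ range I.n with I.bin q = L, (F q + I.x q) with hw
    have hwnn : ∀ L, 0 ≤ w L := fun L =>
      mul_nonneg (mul_nonneg hΛ.le hunit.le)
        (sum_nonneg fun q _ => add_nonneg (hFnn q) (h.x_nonneg q))
    have hbin : ∀ i < I.n, 1 ≤ I.bin i ∧ I.bin i ≤ I.n := fun i hi => by
      have := I.bin_spec' i
      omega
    have hvar : ∀ i < I.n, ∀ j < I.n, I.bin i = I.bin j →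
        (BinSampling.pre I.bin I.wt I.n (I.bin i) / I.wt i * F i -
          BinSampling.pre I.bin I.wt I.n (I.bin j) / I.wt j * F j) ^ 2 ≤ w (I.bin i) := by
      intro i hi j hj hij
      have := (packing h).sq_sub_le h.z_pos hε h.ε_lt (fun i => h.d_nonneg i) ha
        (i := ⟨i, hi⟩) (j := ⟨j, hj⟩) hij hunit.le
      rw [packing_load, packing_load, load_eq_pre, load_eq_pre, ← hG, ← hf, ← hFf, ← hFf] at this
      refine this.trans (le_of_eq ?_)
      rw [hw]
      simp only
      congr 1
      rw [← sum_fin_filter (fun q => F q + I.x q) fun q => I.bin q = I.bin i]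
      have e : ∀ q : Fin I.n, F q + I.x q = f q + I.d q ^ I.z := fun q => by rw [hFf, h.x_eq]
      simp only [e]
      rfl
    have hW : ∑ l ∈ range I.n, w (l + 1) ≤ Packing.spread I.z I.ε * I.unit * Q := by
      rw [hw, ← mul_sum]
      refine mul_le_mul_of_nonneg_left (le_of_eq ?_) (mul_nonneg hΛ.le hunit.le)
      have hmaps : ∀ i ∈ range I.n, I.bin i - 1 ∈ range I.n := fun i hi => by
        have := hbin i (by simpa using hi)
        rw [mem_range]
        omega
      have hfib : ∀ l, {i ∈ range I.n | I.bin i = l + 1} = {i ∈ range I.n | I.bin i - 1 = l} :=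
        fun l => filter_congr fun i hi => by
          have := hbin i (by simpa using hi)
          omega
      simp_rw [hfib]
      rw [sum_fiberwise_of_maps_to hmaps, sum_add_distrib, hQ, total, ← Fin.sum_univ_eq_sum_range]
      simp_rw [hFf]
    have hmain := BinSampling.coins_abs_sub_le (n := I.n) (b := I.bin) (s := I.wt) h.wt_pos hbin F
      hwnn hvar hW (t := I.ε * Q) (by positivity)
    refine (measure_mono ?_).trans (hmain.trans (ENNReal.ofReal_le_ofReal ?_))
    · intro ω hω
      rw [Set.mem_ofPred_eq, not_le] at hω
      rw [Set.mem_ofPred_eq]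
      refine hω.le.trans (le_of_eq ?_)
      rw [← Fin.sum_univ_eq_sum_range F, ← Fin.sum_univ_eq_sum_range
        (fun i => if BinSampling.Sel I.n I.bin I.wt (ω (I.bin i - 1)) i then
          BinSampling.pre I.bin I.wt I.n (I.bin i) / I.wt i * F i else 0), estimate]
      simp only [selected_iff, outWt, load_eq_pre, hFf]
    -- With t = εQ and W = spread·unit·Q the exponent is 2ε²Q/(spread·unit), and Q ≥ total =
    -- unit·samples.
    · have hexp : 2 * (1 + I.bits) ≤
          2 * (I.ε * Q) ^ 2 / (Packing.spread I.z I.ε * I.unit * Q) := by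
        have h1 := h.spread_le_samples
        have h2 : I.unit * I.samples = I.total := div_mul_cancel₀ _ h.samples_pos.ne'
        rw [le_div_iff₀ (by positivity)]
        have h3 : (1 + I.bits) * Packing.spread I.z I.ε * I.unit ≤ I.ε ^ 2 * Q := by
          calc (1 + I.bits) * Packing.spread I.z I.ε * I.unit ≤ I.ε ^ 2 * I.samples * I.unit :=
                mul_le_mul_of_nonneg_right h1 hunit.le
            _ = I.ε ^ 2 * (I.unit * I.samples) := by ring
            _ ≤ I.ε ^ 2 * Q := by
                rw [h2]
                exact mul_le_mul_of_nonneg_left (by linarith) (by positivity)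
        calc 2 * (1 + I.bits) * (Packing.spread I.z I.ε * I.unit * Q) =
            2 * ((1 + I.bits) * Packing.spread I.z I.ε * I.unit) * Q := by ring
          _ ≤ 2 * (I.ε ^ 2 * Q) * Q := by gcongr
          _ = _ := by ring
      have := Real.exp_le_exp.mpr (neg_le_neg hexp)
      linarith
  · push Not at hex
    have hempty : ∀ i, i ∉ G := by
      intro i hi
      have : I.kind i = 0 := by rw [kind, if_pos (hex i)]
      rcases (packing h).kind_of_mem_good hi with h1 | h1
      · rw [show (packing h).kind i = I.kind i from rfl] at h1
        omega
      · rw [show (packing h).kind i = I.kind i from rfl] at h1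
        omega
    have hf0 : ∀ i, f i = 0 := fun i => Set.indicator_of_notMem (hempty i) _
    have : {ω | ¬ |I.estimate ω f - ∑ i, f i| ≤ I.ε * (∑ i, f i + I.total)} = ∅ := by
      ext ω
      have h0 : 0 ≤ I.ε * I.total :=
        mul_nonneg h.ε_pos.le (sum_nonneg fun j _ => h.x_nonneg j)
      simp [estimate, hf0, h0]
    rw [this]
    simp

include h in
/-- If the costs of the good clients are estimated correctly for `a'`, then the total cost is
estimated correctly for `a`. -/
theorem estimate_abs_sub_le {ω : ℕ → unitInterval} (hω : ∀ i, ω i ≠ 1) {a a' : Fin I.n → ℝ}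
    (ha : Admissible (fun i : Fin I.n => I.d i) (fun i => I.c i) a)
    (ha' : Admissible (fun i : Fin I.n => I.d i) (fun i => I.c i) a')
    (happ : Approximates I.z I.ε (fun i : Fin I.n => I.d i) a a')
    (hest : |I.estimate ω (((packing h).good a').indicator fun i => a' i ^ I.z) -
        ∑ i, ((packing h).good a').indicator (fun i => a' i ^ I.z) i| ≤
      I.ε * (∑ i, ((packing h).good a').indicator (fun i => a' i ^ I.z) i +
        ∑ i : Fin I.n, I.d i ^ I.z)) :
    |I.estimate ω (fun i => a i ^ I.z) - ∑ i, a i ^ I.z| ≤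
      3010 * I.ε * (∑ i, a i ^ I.z + ∑ i : Fin I.n, I.d i ^ I.z) := by
  obtain ⟨r, hr, hr'⟩ := exists_rep h hω
  rw [estimate, ← hr'] at hest ⊢
  exact (packing h).est_abs_sub_le h.z_pos h.ε_pos h.ε_lt (fun i => h.d_nonneg i) hr ha ha'
    happ hest

include h in
/-- The number of selected clients. -/
theorem length_selection_le (ω : ℕ → unitInterval) : ((I.selection ω I.n).length : ℝ) ≤
    I.k * (2 * I.top + 2) + 2 + 2 * I.samples := by
  classical
  have htop : 0 ≤ ⌊I.bound⌋ := Int.floor_nonneg.mpr h.bound_nonneg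
  have hlen : (I.selection ω I.n).length = #{i ∈ range I.n | I.Selected ω i} := by
    rw [selection, ← List.toFinset_card_of_nodup ((List.nodup_range).filter _)]
    congr 1
    ext i
    simp
  -- A bin contains at most one selected client, and bins correspond to their openers.
  have hle : #{i ∈ range I.n | I.Selected ω i} ≤ #(NextFit.openers I.key I.wt I.cap I.n) := by
    refine card_le_card_of_injOn (fun i => I.bin i - 1) (fun i hi => ?_) fun i hi j hj hij => ?_
    · have hi' : i < I.n := by
        have := (mem_filter.mp hi).1
        simpa using this
      obtain ⟨j, hj, h1, -, h2⟩ := NextFit.bin_spec (key := I.key) (s := I.wt) (cap := I.cap) i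
      have h3 : I.bin i - 1 = j := by rw [bin, h1, Nat.add_sub_cancel]
      simp only [h3]
      exact mem_coe.mpr (mem_filter.mpr ⟨mem_range.mpr (by omega), h2⟩)
    · have h1 := (mem_filter.mp hi).2
      have h2 := (mem_filter.mp hj).2
      have hb : I.bin i = I.bin j := by
        have b1 := I.bin_spec' i
        have b2 := I.bin_spec' j
        simp only at hij
        omega
      rw [selected_iff] at h1 h2
      rw [hb] at h1
      exact BinSampling.sel_unique h.wt_pos hb h1 h2
  -- k clusters, and 2 top + 2 classes with the inner and the outer one included.
  set keys : Finset ℤ := ((range I.k) ×ˢ (Icc (-1 - I.top) I.top)).image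
    fun p => (p.1 : ℤ) + I.k * p.2 with hkeys
  have hkeymem : ∀ i < I.n, I.key i ∈ keys := by
    intro i hi
    obtain ⟨h1, h2⟩ := h.c_mem i hi
    rw [hkeys, mem_image]
    refine ⟨((I.c i).toNat, I.cls i), ?_, ?_⟩
    · rw [mem_product, mem_range, mem_Icc]
      refine ⟨by simp only; omega, ?_⟩
      simp only
      rw [cls]
      split_ifs with h3 h4
      · unfold top
        omega
      · have h5 := I.bound_floor_lt i h3
        have h6 := Int.floor_le_floor h4
        unfold top at h5 ⊢
        omega
      · unfold top
        omega
    · simp only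
      rw [key, Int.toNat_of_nonneg h1]
  have hkeycard : (#keys : ℝ) ≤ I.k * (2 * I.top + 2) := by
    have h1 : #keys ≤ I.k * (I.top + 1 - (-1 - I.top)).toNat := by
      refine card_image_le.trans ?_
      rw [card_product, card_range, Int.card_Icc]
    have h2 : (((I.top + 1 - (-1 - I.top)).toNat : ℤ) : ℝ) = 2 * I.top + 2 := by
      rw [Int.toNat_of_nonneg (by unfold top; omega)]
      push_cast
      ring
    rw [← h2, Int.cast_natCast]
    exact_mod_cast h1
  have hopen := NextFit.card_openers_le (key := I.key) (s := I.wt) (cap := I.cap)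
    (fun i => (h.wt_pos i).le) I.n (fun κ => by
      rw [cap]
      split_ifs
      exacts [Nat.cast_nonneg _, h.unit_nonneg])
    (fun i hi => by
      rw [I.cap_key h.c_mem h.bound_nonneg hi]
      split_ifs with hin
      · exact_mod_cast h.n_pos
      · exact div_pos (h.total_pos hin) h.samples_pos) keys hkeymem
  -- At most n inner clients of weight 1 against the capacity n give 2; the others have weight at
  -- most x against the unit total/samples. Charging both terms to every client avoids splitting the
  -- sum.
  have hsum : ∑ i ∈ range I.n, 2 * I.wt i / I.cap (I.key i) ≤ 2 + 2 * I.samples := by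
    have hn : (0 : ℝ) < I.n := by exact_mod_cast h.n_pos
    have h1 : ∀ i ∈ range I.n, 2 * I.wt i / I.cap (I.key i) ≤ 2 / I.n + 2 * I.x i / I.unit := by
      intro i hi
      have hi' : i < I.n := by simpa using hi
      rw [I.cap_key h.c_mem h.bound_nonneg hi']
      split_ifs with hin
      · rw [wt, if_pos hin, mul_one]
        have : 0 ≤ 2 * I.x i / I.unit :=
          div_nonneg (mul_nonneg (by norm_num) (h.x_nonneg i)) h.unit_nonneg
        linarith
      · have h2 : 2 * I.wt i / I.unit ≤ 2 * I.x i / I.unit := by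
          have := h.wt_le_x hin
          have := h.unit_nonneg
          gcongr
        have : 0 ≤ 2 / (I.n : ℝ) := by positivity
        linarith
    refine (sum_le_sum h1).trans ?_
    rw [sum_add_distrib, sum_const, card_range, nsmul_eq_mul, mul_div_cancel₀ _ hn.ne', ← sum_div,
      ← mul_sum, ← total]
    have h3 : 2 * I.total / I.unit ≤ 2 * I.samples := by
      rw [unit]
      by_cases h0 : I.total = 0
      · rw [h0]
        simpa using h.samples_pos.le
      · have := h.samples_pos
        refine le_of_eq ?_
        field_simp
    linarith
  rw [hlen]
  have : (#{i ∈ range I.n | I.Selected ω i} : ℝ) ≤ #(NextFit.openers I.key I.wt I.cap I.n) := by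
    exact_mod_cast hle
  linarith

end Input
end Clustering

-- The size bound in closed form.

namespace Clustering

open Finset RealRAM

namespace Input

variable {I : Input} (h : I.Valid)
include h

-- For z ≥ 2, 1792 ≤ 2^11 ≤ z^11 bounds the left side by z^(13z), and 13 ≤ 20 log 2. For z = 1 the
-- exponent on the right vanishes, hence the factor 1792.
omit h in
theorem mul_pow_le_rpow {z : ℕ} (hz : 0 < z) :
    (z * z : ℝ) * (1792 * z) ^ z ≤ 1792 * (2 : ℝ) ^ (20 * z * Real.log z) := by
  obtain rfl | h2 : z = 1 ∨ 2 ≤ z := by omega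
  · norm_num
  have hzr : (2 : ℝ) ≤ z := by exact_mod_cast h2
  have hz1 : (1 : ℝ) ≤ z := by linarith
  have e1 : (z * z : ℝ) * (1792 * z) ^ z ≤ (z : ℝ) ^ (13 * z) := by
    have b1 : (z * z : ℝ) ≤ (z : ℝ) ^ z := by
      rw [← pow_two]; exact pow_le_pow_right₀ hz1 h2
    have b2 : (1792 : ℝ) ≤ (z : ℝ) ^ 11 :=
      le_trans (by norm_num) (pow_le_pow_left₀ (by norm_num) hzr 11)
    have b3 : (1792 * z : ℝ) ≤ (z : ℝ) ^ 12 := by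
      rw [pow_succ]; exact mul_le_mul_of_nonneg_right b2 (by linarith)
    calc (z * z : ℝ) * (1792 * z) ^ z ≤ (z : ℝ) ^ z * ((z : ℝ) ^ 12) ^ z := by gcongr
      _ = (z : ℝ) ^ (13 * z) := by rw [← pow_mul, ← pow_add]; ring_nf
  have e2 : (z : ℝ) ^ (13 * z) = Real.exp (13 * z * Real.log z) := by
    have hp : (0 : ℝ) < z := by linarith
    rw [show (13 : ℝ) * z * Real.log z = ((13 * z : ℕ) : ℝ) * Real.log z by push_cast; ring,
      Real.exp_nat_mul, Real.exp_log hp]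
  have e3 : (2 : ℝ) ^ (20 * z * Real.log z) = Real.exp (Real.log 2 * (20 * z * Real.log z)) :=
    Real.rpow_def_of_pos (by norm_num) _
  have hlog : 0 ≤ Real.log z := Real.log_nonneg hz1
  have e4 : Real.exp (13 * z * Real.log z) ≤ Real.exp (Real.log 2 * (20 * z * Real.log z)) := by
    apply Real.exp_le_exp.mpr
    have := Real.log_two_gt_d9
    have hp : 0 ≤ z * Real.log z := by positivity
    nlinarith
  have e5 := Real.exp_pos (Real.log 2 * (20 * z * Real.log z))
  rw [e3]
  linarith

/-- The constant in the bound for the size of the sample. -/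
noncomputable def sizeConst : ℝ :=
  28 / Real.log 2 + 2 / Real.log (Real.log 3) + 432 * (1 / Real.log (Real.log 3) + 1)

omit h in
theorem sizeConst_pos : 0 < sizeConst := by
  have := Valid.loglog_three_pos
  have : 0 < Real.log 2 := Real.log_pos (by norm_num)
  rw [sizeConst]
  positivity

/-- Each summand is absorbed into bits · U/μ: the number of keys through log m ≥ log 2, constants
through bits ≥ log log 3. For m = 1 the term k log m vanishes and cannot pay for k clusters, but
then n = 1. The factor log⁴(1/ε) ≥ 1 is given away. -/
theorem le_sizeBound (hm : I.n = 1 ∨ 2 ≤ I.m) {N C : ℝ} (hN : N ≤ I.n)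
    (hN' : N ≤ I.k * (2 * I.top + 2) + 2 + 2 * I.samples) (hC : 20 ≤ C)
    (hC' : 1792 * sizeConst ≤ C) : N ≤ sizeBound C I.k I.z I.m I.ε I.π := by
  have hε := h.ε_pos
  have hε' := h.ε_lt
  have hz : (1 : ℝ) ≤ I.z := by exact_mod_cast h.z_pos
  have hb := h.bits_pos
  have hc := Valid.loglog_three_pos
  have hl2 : 0 < Real.log 2 := Real.log_pos (by norm_num)
  set c₀ := Real.log (Real.log 3) with hc₀
  set μ := min (I.ε ^ 2) (I.ε ^ I.z) with hμ
  have hμpos : 0 < μ := lt_min (by positivity) (by positivity)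
  have hμ2 : μ ≤ I.ε ^ 2 := min_le_left _ _
  have hμz : μ ≤ I.ε ^ I.z := min_le_right _ _
  have hμ1 : μ ≤ 1 := hμ2.trans (pow_le_one₀ hε.le (by linarith))
  set U : ℝ := I.z * I.z * (1792 * I.z) ^ I.z with hU
  have hzz : (1 : ℝ) ≤ I.z * I.z := by nlinarith
  have hpow : (1 : ℝ) ≤ (1792 * I.z) ^ I.z := one_le_pow₀ (by linarith)
  have hUz : I.z * I.z ≤ U := le_mul_of_one_le_right (by positivity) hpow
  have hU1 : 1 ≤ U := hzz.trans hUz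
  have hUμ : 1 ≤ U / μ := by rw [le_div_iff₀ hμpos]; linarith
  have hbc : 1 ≤ I.bits / c₀ := by rw [le_div_iff₀ hc, one_mul]; exact h.le_bits
  have main : N ≤ sizeConst * I.bits * (U / μ) := by
    rcases hm with hn | hm
    · have h1 : N ≤ 1 := by rw [hn] at hN; exact_mod_cast hN
      have h2 : I.bits / c₀ ≤ sizeConst * I.bits := by
        rw [sizeConst, ← hc₀, div_eq_mul_one_div, mul_comm]
        refine mul_le_mul_of_nonneg_right ?_ hb.le
        have t1 : 0 ≤ 28 / Real.log 2 := by positivity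
        have t2 : 0 ≤ 1 / c₀ := by positivity
        have t3 : 2 / c₀ = 2 * (1 / c₀) := by ring
        linarith
      have h3 : 1 ≤ sizeConst * I.bits := hbc.trans h2
      nlinarith
    · have hk : (I.k : ℝ) ≤ I.bits / Real.log 2 := by
        rw [le_div_iff₀ hl2, bits]
        have h1 : Real.log 2 ≤ Real.log I.m :=
          Real.log_le_log (by norm_num) (by exact_mod_cast hm)
        have h2 := mul_le_mul_of_nonneg_left h1 (Nat.cast_nonneg (α := ℝ) I.k)
        linarith [h.loglog_le, h.log_π_pos]
      have htop : (2 * I.top + 2 : ℝ) ≤ 28 * (U / μ) := by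
        have h1 : (I.top : ℝ) ≤ I.bound + 1 := by
          rw [top]
          push_cast
          linarith [Int.floor_le I.bound]
        have h2 : I.bound ≤ 12 * (I.z * I.z) / I.ε := by
          have := Real.log_le_self h.gamma_pos.le
          calc I.bound ≤ 2 * I.z * (6 * I.z / I.ε) :=
                mul_le_mul_of_nonneg_left this (by positivity)
            _ = _ := by ring
        have h3 : 1 ≤ (I.z * I.z) / I.ε := by rw [le_div_iff₀ hε]; linarith
        have h4 : (I.z * I.z) / I.ε ≤ U / μ := by
          have : μ ≤ I.ε := hμ2.trans (by nlinarith)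
          gcongr
        have h5 : 12 * (I.z * I.z) / I.ε = 12 * ((I.z * I.z) / I.ε) := by ring
        linarith
      have h1 : I.k * (2 * I.top + 2) ≤ I.bits / Real.log 2 * (28 * (U / μ)) := by
        calc I.k * (2 * I.top + 2 : ℝ) ≤ I.k * (28 * (U / μ)) :=
              mul_le_mul_of_nonneg_left htop (Nat.cast_nonneg _)
          _ ≤ _ := mul_le_mul_of_nonneg_right hk (by positivity)
      have h2 : (2 : ℝ) ≤ 2 * (I.bits / c₀) * (U / μ) := by nlinarith
      have h3 : I.samples ≤ 216 * (I.bits / c₀ + I.bits) * (U / μ) := by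
        have i1 : 1 / (I.ε * I.ε) ≤ 1 / μ := by
          rw [← pow_two]; exact one_div_le_one_div_of_le hμpos hμ2
        have i2 : (1 / I.ε) ^ I.z ≤ 1 / μ := by
          rw [one_div_pow]; exact one_div_le_one_div_of_le hμpos hμz
        rw [h.samples_eq]
        calc (1 + I.bits) * (108 * (I.z * I.z) * (1792 * I.z) ^ I.z *
              (1 / (I.ε * I.ε) + (1 / I.ε) ^ I.z)) =
              (1 + I.bits) * (108 * U * (1 / (I.ε * I.ε) + (1 / I.ε) ^ I.z)) := by
              rw [hU]; ring
          _ ≤ (I.bits / c₀ + I.bits) * (108 * U * (1 / μ + 1 / μ)) := by gcongr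
          _ = _ := by ring
      calc N ≤ I.bits / Real.log 2 * (28 * (U / μ)) + 2 * (I.bits / c₀) * (U / μ) +
            2 * (216 * (I.bits / c₀ + I.bits) * (U / μ)) := by linarith
        _ = _ := by rw [sizeConst, ← hc₀]; ring
  have hU2 := mul_pow_le_rpow h.z_pos
  rw [← hU] at hU2
  have hrp : (2 : ℝ) ^ (20 * I.z * Real.log I.z) ≤ 2 ^ (C * I.z * Real.log I.z) := by
    apply Real.rpow_le_rpow_of_exponent_le (by norm_num)
    have : 0 ≤ Real.log I.z := Real.log_nonneg hz
    gcongr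
  have hlog : 1 ≤ Real.log (1 / I.ε) ^ 4 := one_le_pow₀ h.one_lt_log.le
  have hsc := sizeConst_pos
  have hrpos : (0 : ℝ) < 2 ^ (C * I.z * Real.log I.z) := Real.rpow_pos_of_pos (by norm_num) _
  rw [sizeBound, ← hμ, ← bits]
  calc N ≤ sizeConst * I.bits * (U / μ) := main
    _ ≤ sizeConst * I.bits * (1792 * 2 ^ (C * I.z * Real.log I.z) / μ) := by
        gcongr
        linarith
    _ = 1792 * sizeConst * (2 ^ (C * I.z * Real.log I.z) * 1 / μ) * I.bits := by ring
    _ ≤ _ := by gcongr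

end Input

-- Distances to the nearest center, centroid sets, and sums over the output list.

section Metric

variable {X : Type*} [MetricSpace X] {k : ℕ}

/-- The distance from a point to the nearest center. -/
noncomputable def nearDist (q : X) (S : Fin k → X) : ℝ := ⨅ i, dist q (S i)

theorem exists_nearDist_eq (hk : 0 < k) (q : X) (S : Fin k → X) :
    ∃ i, nearDist q S = dist q (S i) ∧ ∀ j, dist q (S i) ≤ dist q (S j) := by
  have : Nonempty (Fin k) := ⟨⟨0, hk⟩⟩
  obtain ⟨i, hi⟩ := Finite.exists_min fun i => dist q (S i)
  exact ⟨i, le_antisymm (ciInf_le (Set.finite_range _).bddBelow i) (le_ciInf hi), hi⟩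

theorem nearDist_le (q : X) (S : Fin k → X) (i : Fin k) : nearDist q S ≤ dist q (S i) :=
  ciInf_le (Set.finite_range _).bddBelow i

theorem nearDist_nonneg (q : X) (S : Fin k → X) : 0 ≤ nearDist q S :=
  Real.iInf_nonneg fun _ => dist_nonneg

theorem ptCost_eq (hk : 0 < k) (z : ℕ) (q : X) (S : Fin k → X) :
    ptCost z q S = nearDist q S ^ z := by
  have : Nonempty (Fin k) := ⟨⟨0, hk⟩⟩
  obtain ⟨i, hi, hmin⟩ := exists_nearDist_eq hk q S
  rw [hi]
  exact le_antisymm (ciInf_le (Set.finite_range fun i => dist q (S i) ^ z).bddBelow i)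
    (le_ciInf fun j => pow_le_pow_left₀ dist_nonneg (hmin j) z)

theorem nearDist_le_add (hk : 0 < k) (p q : X) (S : Fin k → X) :
    nearDist p S ≤ nearDist q S + dist p q := by
  obtain ⟨i, hi, -⟩ := exists_nearDist_eq hk q S
  rw [hi]
  linarith [nearDist_le p S i, dist_triangle p q (S i)]

variable {n : ℕ} {P : Finset X}

/-- The input of the algorithm. -/
noncomputable def toInput (z m : ℕ) (ε π : ℝ) (e : Fin n ≃ P) (A : Fin k → X)
    (c : Fin n → Fin k) : Input where
  n := n
  k := k
  z := z
  m := m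
  ε := ε
  π := π
  c i := if h : i < n then ((c ⟨i, h⟩ : ℕ) : ℤ) else 0
  d i := if h : i < n then dist (e ⟨i, h⟩ : X) (A (c ⟨i, h⟩)) else 0

theorem toInput_holds (z m : ℕ) (ε π : ℝ) (e : Fin n ≃ P) (A : Fin k → X) (c : Fin n → Fin k) :
    (toInput z m ε π e A c).Holds (inputState z m ε π e A c) := by
  constructor <;> simp +contextual [toInput, inputState]

theorem cost_eq_sum (hk : 0 < k) (z : ℕ) (e : Fin n ≃ P) (S : Fin k → X) :
    cost z P S = ∑ i : Fin n, nearDist (e i : X) S ^ z := by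
  rw [cost, ← Finset.sum_coe_sort P, ← Equiv.sum_comp e]
  exact sum_congr rfl fun i _ => ptCost_eq hk _ _ _

theorem one_le_mul_log {z : ℕ} {ε : ℝ} (hz : 0 < z) (hε : 0 < ε) (hε' : ε < 1 / 3) :
    1 ≤ z * Real.log (z / ε) := by
  have hz' : (1 : ℝ) ≤ z := by exact_mod_cast hz
  have h3 : 3 ≤ z / ε := by rw [le_div_iff₀ hε]; linarith
  have h1 : 1 ≤ Real.log (z / ε) := by
    rw [Real.le_log_iff_exp_le (by linarith)]
    exact Real.exp_one_lt_three.le.trans h3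
  nlinarith

/-- The precision of a centroid set is at least `ε`. -/
theorem IsApproxCentroidSet.exists_le {z : ℕ} {ε : ℝ} {A : Fin k → X} {K : Finset X}
    (hK : IsApproxCentroidSet z ε P A K) (hk : 0 < k) (hz : 0 < z) (hε : 0 < ε) (hε' : ε < 1 / 3)
    (S : Fin k → X) : ∃ S' : Fin k → X, (∀ i, S' i ∈ K) ∧ ∀ p ∈ P,
      (nearDist p S ^ z ≤ (8 * z / ε) ^ z * nearDist p A ^ z ∨
        nearDist p S' ^ z ≤ (8 * z / ε) ^ z * nearDist p A ^ z) →
      |nearDist p S ^ z - nearDist p S' ^ z| ≤ ε * (nearDist p S ^ z + nearDist p A ^ z) := by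
  obtain ⟨S', hS', h⟩ := hK S
  refine ⟨S', hS', fun p hp hor => ?_⟩
  have := h p hp
  simp only [ptCost_eq hk] at this
  refine (this hor).trans (mul_le_mul_of_nonneg_right ?_
    (add_nonneg (pow_nonneg (nearDist_nonneg _ _) _) (pow_nonneg (nearDist_nonneg _ _) _)))
  exact div_le_self hε.le (one_le_mul_log hz hε hε')

/-- A centroid set with a single point only exists for a single client. -/
theorem two_le_card_of_isApproxCentroidSet {z : ℕ} {ε : ℝ} {A : Fin k → X} {K : Finset X}
    (hK : IsApproxCentroidSet z ε P A K) (hk : 0 < k) (hz : 0 < z) (hε : 0 < ε)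
    (hε' : ε < 1 / 3) (e : Fin n ≃ P) (hn : 0 < n) : n = 1 ∨ 2 ≤ K.card := by
  by_contra hcon
  rw [not_or, not_le] at hcon
  obtain ⟨hn1, hcard⟩ := hcon
  have hz' : (1 : ℝ) ≤ z := by exact_mod_cast hz
  have hsingle : ∀ x ∈ K, ∀ y ∈ K, x = y := fun x hx y hy =>
    card_le_one.mp (by omega) x hx y hy
  -- A one-point `K` offers the same tuple to every solution; it is tested against `A` and against
  -- the constant tuple p.
  obtain ⟨S₁, hS₁, h₁⟩ := hK.exists_le hk hz hε hε' A
  have hx : ∀ p ∈ P, p = S₁ ⟨0, hk⟩ := by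
    intro p hp
    obtain ⟨S₂, hS₂, h₂⟩ := hK.exists_le hk hz hε hε' fun _ => p
    obtain rfl : S₁ = S₂ := funext fun i => hsingle _ (hS₁ i) _ (hS₂ i)
    have hpp : nearDist p (fun _ : Fin k => p) = 0 :=
      le_antisymm ((nearDist_le p (fun _ : Fin k => p) ⟨0, hk⟩).trans (by simp))
        (nearDist_nonneg _ _)
    have hA0 : 0 ≤ nearDist p A ^ z := pow_nonneg (nearDist_nonneg _ _) _
    have hS0 : 0 ≤ nearDist p S₁ ^ z := pow_nonneg (nearDist_nonneg _ _) _
    have h8 : (1 : ℝ) ≤ (8 * z / ε) ^ z := by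
      apply one_le_pow₀
      rw [le_div_iff₀ hε]
      linarith
    have k1 := h₁ p hp (Or.inl (le_mul_of_one_le_left hA0 h8))
    have k2 := h₂ p hp (Or.inl (by
      rw [hpp, zero_pow hz.ne']
      exact mul_nonneg (by linarith) hA0))
    rw [hpp, zero_pow hz.ne', zero_sub, abs_neg, abs_of_nonneg hS0, zero_add] at k2
    have k3 := (abs_le.mp k1).2
    -- With c = cost(p, A), the two tests give (1 - 2ε) c ≤ cost(p, S₁) ≤ ε c, which forces c = 0
    -- because ε < 1/3.
    have hzero : nearDist p S₁ ^ z = 0 := by nlinarith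
    have hzero' := pow_eq_zero_iff hz.ne' |>.mp hzero
    obtain ⟨i, hi, -⟩ := exists_nearDist_eq hk p S₁
    rw [hi, dist_eq_zero] at hzero'
    rw [hzero']
    exact hsingle _ (hS₁ _) _ (hS₁ _)
  have h0 := hx _ (e ⟨0, hn⟩).2
  have h1 := hx _ (e ⟨1, by omega⟩).2
  have := e.injective (Subtype.ext (h0.trans h1.symm))
  simp at this

omit [MetricSpace X] in
open Classical in
/-- A sum over a list of labels as a sum over the set of the labelled points. -/
theorem sum_image_weights {L : ℕ} (x : Fin L → X) (u : Fin L → ℝ) (g : X → ℝ) :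
    ∑ q ∈ univ.image x, (∑ j with x j = q, u j) * g q = ∑ j, u j * g (x j) := by
  rw [← sum_fiberwise_of_maps_to (g := x) (t := univ.image x) (fun j _ => by simp)]
  refine sum_congr rfl fun q _ => ?_
  rw [sum_mul]
  exact sum_congr rfl fun j hj => by rw [(mem_filter.mp hj).2]

open Classical in
theorem Input.sum_selection (I : Input) (ω : ℕ → unitInterval) (g : ℕ → ℝ) (i : ℕ) :
    ∑ j : Fin (I.selection ω i).length, g (I.selection ω i)[j] =
      ∑ j ∈ range i, if I.Selected ω j then g j else 0 := by
  have h1 : ∑ j : Fin (I.selection ω i).length, g (I.selection ω i)[j] =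
      ((I.selection ω i).map g).sum := Fin.sum_univ_fun_getElem _ _
  rw [h1]
  induction i with
  | zero => simp [Input.selection]
  | succ i ih =>
    have ih' := ih (Fin.sum_univ_fun_getElem _ _)
    rw [sum_range_succ, ← ih']
    by_cases hs : I.Selected ω i <;> simp [Input.selection, List.range_succ, hs]

end Metric

end Clustering

-- Assembly: from good random numbers to a coreset, and the union bound.

open Clustering RealRAM in
theorem theorem1 (α : ℝ) (hα : 1 ≤ α) :
    ∃ (prog : RealRAM.Prog) (C : ℝ), 0 < C ∧
      ∀ (X : Type*) [MetricSpace X] (P : Finset X) (n k z : ℕ) (ε π : ℝ)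
        (A : Fin k → X) (K : Finset X) (e : Fin n ≃ P) (c : Fin n → Fin k),
        0 < n → 0 < k → 0 < z → 0 < ε → ε < 1 / 3 → 0 < π → π < 1 →
        Clustering.IsApproxSolution z α P A →
        Clustering.IsApproxCentroidSet z ε P A K →
        Clustering.IsNearest e A c →
        (∀ ω, ∃ s t, RealRAM.Runs ω prog
            (Clustering.inputState z K.card ε π e A c) s t ∧ (t : ℝ) ≤ C * n) ∧
        RealRAM.coins {ω | ¬ ∃ s t Ω w,
            RealRAM.Runs ω prog (Clustering.inputState z K.card ε π e A c) s t ∧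
            Clustering.IsOutput e A s Ω w ∧
            Clustering.IsCoreset k z (C * ε) P Ω w ∧
            (Ω.card : ℝ) ≤ Clustering.sizeBound C k z K.card ε π} ≤ ENNReal.ofReal π := by
  classical
  have hsc := Input.sizeConst_pos
  -- The summands serve the running time, the size (two of them) and the precision, in this order.
  refine ⟨samplingProg, stepBound + 20 + 1792 * Input.sizeConst + 3010 * (1 + α), by positivity, ?_⟩
  intro X _ P n k z ε π A K e c hn hk hz hε hε' hπ hπ' hA hK hc
  set C : ℝ := stepBound + 20 + 1792 * Input.sizeConst + 3010 * (1 + α) with hC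
  have hstep0 : (0 : ℝ) ≤ stepBound := Nat.cast_nonneg _
  set I : Input := toInput z K.card ε π e A c with hI
  have hm : 0 < K.card := by
    obtain ⟨S', hS', -⟩ := hK A
    exact Finset.card_pos.mpr ⟨_, hS' ⟨0, hk⟩⟩
  have hIc : ∀ i : Fin n, I.c i = (c i : ℕ) := fun i => by simp [hI, toInput]
  have hId : ∀ i : Fin n, I.d i = dist (e i : X) (A (c i)) := fun i => by simp [hI, toInput]
  have hv : I.Valid := by
    refine ⟨hn, hz, hε, hε', hπ, hπ', fun i hi => ?_, fun i => ?_, fun i hi => ?_⟩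
    · rw [hIc ⟨i, hi⟩]
      exact ⟨Int.natCast_nonneg _, by exact_mod_cast (c ⟨i, hi⟩).2⟩
    · by_cases hi : i < n
      · rw [hId ⟨i, hi⟩]; exact dist_nonneg
      · simp [hI, toInput, hi]
    · have : ¬ i < n := not_lt.mpr hi
      simp [hI, toInput, this]
  have hdA : ∀ i : Fin n, I.d i = nearDist (e i : X) A := by
    intro i
    obtain ⟨j, hj, hmin⟩ := exists_nearDist_eq hk (e i : X) A
    rw [hId, hj]
    exact le_antisymm (hc i j) (hmin _)
  have hadm : ∀ S : Fin k → X, Admissible (fun i : Fin I.n => I.d i) (fun i => I.c i)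
      fun i : Fin n => nearDist (e i : X) S := by
    intro S
    refine ⟨fun i => nearDist_nonneg _ _, fun i j hij => ?_⟩
    refine (nearDist_le_add hk (e i : X) (e j : X) S).trans (add_le_add le_rfl ?_)
    have hij' : c i = c j := by
      have h1 : I.c i = I.c j := hij
      rw [hIc i, hIc j] at h1
      exact Fin.ext (by exact_mod_cast h1)
    have h2 := dist_triangle_right (e i : X) (e j : X) (A (c i))
    have e1 := hId i
    have e2 := hId j
    rw [← hij'] at e2
    calc dist (e i : X) (e j : X) ≤ dist (e i : X) (A (c i)) + dist (e j : X) (A (c i)) := h2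
      _ = I.d i + I.d j := by rw [e1, e2]
  have hruns : ∀ ω, ∃ s t, Runs ω samplingProg (inputState z K.card ε π e A c) s t ∧
      I.OutInv ω I.n s ∧ t ≤ stepBound * I.n := fun ω =>
    samplingProg_runs I hn hv.c_mem hv.bound_nonneg ω _ (toInput_holds z K.card ε π e A c) rfl
      (fun b a hb => by simp [inputState, show b ≠ 0 by omega, show b ≠ 1 by omega])
      (fun b a hb => by simp [inputState, show b ≠ 0 by omega, show b ≠ 1 by omega])
  refine ⟨fun ω => ?_, ?_⟩
  · obtain ⟨s, t, hrun, -, ht⟩ := hruns ω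
    refine ⟨s, t, hrun, ?_⟩
    have h1 : (t : ℝ) ≤ stepBound * n := by exact_mod_cast ht
    refine h1.trans (mul_le_mul_of_nonneg_right ?_ (Nat.cast_nonneg _))
    rw [hC]
    linarith
  set near : (Fin k → X) → Fin I.n → ℝ := fun S i => nearDist (e i : X) S with hnear
  set Good : (Fin k → X) → (ℕ → unitInterval) → Prop := fun S ω =>
    |I.estimate ω (((Input.packing hv).good (near S)).indicator fun i => near S i ^ I.z) -
        ∑ i, ((Input.packing hv).good (near S)).indicator (fun i => near S i ^ I.z) i| ≤
      I.ε * (∑ i, ((Input.packing hv).good (near S)).indicator (fun i => near S i ^ I.z) i +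
        ∑ i : Fin I.n, I.d i ^ I.z) with hGood
  have hcostA : cost z P A = ∑ i : Fin I.n, I.d i ^ I.z := by
    rw [cost_eq_sum hk z e]
    exact Finset.sum_congr rfl fun i _ => by rw [hdA i]; rfl
  have hcost : ∀ S : Fin k → X, cost z P S = ∑ i : Fin I.n, near S i ^ I.z := fun S =>
    cost_eq_sum hk z e S
  -- Finitely many events, one per tuple of `K`, control all solutions S at once.
  have key : ∀ ω : ℕ → unitInterval, (∀ i, ω i ≠ 1) →
      (∀ S : Fin k → K, Good (fun i => S i) ω) → ∃ s t Ω w,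
        Runs ω samplingProg (inputState z K.card ε π e A c) s t ∧ IsOutput e A s Ω w ∧
        IsCoreset k z (C * ε) P Ω w ∧ (Ω.card : ℝ) ≤ sizeBound C k z K.card ε π := by
    intro ω hω hgood
    obtain ⟨s, t, hrun, hout, -⟩ := hruns ω
    set l := I.selection ω I.n with hl
    have hlt : ∀ j : Fin l.length, l[j] < n := fun j =>
      List.mem_range.mp (List.mem_filter.mp (List.getElem_mem j.2)).1
    have hspec : ∀ j : Fin l.length, s.int 3 ((j : ℕ) : ℤ) = l[j] ∧
        s.real 2 ((j : ℕ) : ℤ) = I.outWt l[j] := fun j =>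
      hout.out j l[j] (List.getElem?_eq_getElem j.2)
    set x : Fin l.length → X := fun j => e ⟨l[j], hlt j⟩ with hx
    refine ⟨s, t, Finset.univ.image x,
      fun y => ∑ j : Fin l.length with x j = y, s.real 2 ((j : ℕ) : ℤ), hrun,
      ⟨l.length, x, hout.int2, fun j => Or.inl ⟨⟨l[j], hlt j⟩, (hspec j).1, rfl⟩, rfl,
        fun y => rfl⟩, ⟨?_, ?_⟩, ?_⟩
    · intro q hq
      obtain ⟨j, -, hj⟩ := Finset.mem_image.mp hq
      refine Finset.sum_pos (fun j _ => ?_) ⟨j, by simp [hj]⟩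
      rw [(hspec j).2, Input.outWt, Input.load_eq_pre]
      exact div_pos (BinSampling.pre_pos hv.wt_pos (hlt j)) (hv.wt_pos _)
    · intro S
      obtain ⟨S', hS', happ⟩ := hK.exists_le hk hz hε hε' S
      have hw : wCost z (Finset.univ.image x)
          (fun y => ∑ j : Fin l.length with x j = y, s.real 2 ((j : ℕ) : ℤ)) S =
          I.estimate ω fun i => near S i ^ I.z := by
        set F : ℕ → ℝ := fun i => I.outWt i *
          (if h : i < n then nearDist (e ⟨i, h⟩ : X) S ^ z else 0) with hF
        have h1 : wCost z (Finset.univ.image x)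
            (fun y => ∑ j : Fin l.length with x j = y, s.real 2 ((j : ℕ) : ℤ)) S =
            ∑ j : Fin l.length, s.real 2 ((j : ℕ) : ℤ) * ptCost z (x j) S :=
          sum_image_weights x (fun j => s.real 2 ((j : ℕ) : ℤ)) fun q => ptCost z q S
        have h2 : ∑ j : Fin l.length, s.real 2 ((j : ℕ) : ℤ) * ptCost z (x j) S =
            ∑ j : Fin l.length, F l[j] := by
          refine Finset.sum_congr rfl fun j _ => ?_
          rw [hF, (hspec j).2, ptCost_eq hk]
          simp only [hlt j, dif_pos, hx]
        refine h1.trans (h2.trans ((Input.sum_selection I ω F I.n).trans ?_))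
        rw [Input.estimate, ← Fin.sum_univ_eq_sum_range
          (fun j => if I.Selected ω j then F j else 0)]
        refine Finset.sum_congr rfl fun i _ => ?_
        have hi : (i : ℕ) < n := i.2
        rw [hF]
        simp only [hi, dif_pos]
        rfl
      have happ' : Approximates I.z I.ε (fun i : Fin I.n => I.d i) (near S) (near S') := by
        intro i hi
        have e1 : (fun i : Fin I.n => I.d i) i = nearDist (e i : X) A := hdA i
        rw [e1] at hi ⊢
        exact happ (e i) (e i).2 hi
      have hest := Input.estimate_abs_sub_le hv hω (hadm S) (hadm S') happ'
        (hgood fun i => ⟨S' i, hS' i⟩)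
      rw [hw, abs_sub_comm, hcost S]
      refine hest.trans ?_
      rw [← hcostA, ← hcost S]
      have h1 := hA S
      have h2 : 0 ≤ cost z P S := by
        rw [hcost S]
        exact Finset.sum_nonneg fun i _ => pow_nonneg (nearDist_nonneg _ _) _
      have h3 : 3010 * (1 + α) ≤ C := by rw [hC]; linarith
      calc 3010 * I.ε * (cost z P S + cost z P A) ≤
            3010 * ε * (cost z P S + α * cost z P S) :=
          mul_le_mul_of_nonneg_left (by linarith) (by positivity)
        _ = 3010 * (1 + α) * (ε * cost z P S) := by ring
        _ ≤ C * (ε * cost z P S) := mul_le_mul_of_nonneg_right h3 (by positivity)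
        _ = C * ε * cost z P S := by ring
    · have hcard : ((Finset.univ.image x).card : ℝ) ≤ l.length := by
        have := Finset.card_image_le (s := Finset.univ) (f := x)
        rw [Finset.card_univ, Fintype.card_fin] at this
        exact_mod_cast this
      refine Input.le_sizeBound hv (two_le_card_of_isApproxCentroidSet hK hk hz hε hε' e hn) ?_
        (hcard.trans (Input.length_selection_le hv ω)) (by rw [hC]; linarith)
        (by rw [hC]; linarith)
      have h1 : l.length ≤ n := by
        have := List.length_filter_le (fun j => decide (I.Selected ω j)) (List.range I.n)
        rw [List.length_range] at this
        exact this
      exact hcard.trans (by exact_mod_cast h1)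
  have hsub : {ω | ¬ ∃ s t Ω w,
      Runs ω samplingProg (inputState z K.card ε π e A c) s t ∧ IsOutput e A s Ω w ∧
      IsCoreset k z (C * ε) P Ω w ∧ (Ω.card : ℝ) ≤ sizeBound C k z K.card ε π} ⊆
      {ω | ¬ ∀ i, ω i ≠ 1} ∪ ⋃ S : Fin k → K, {ω | ¬ Good (fun i => S i) ω} := by
    intro ω hω
    by_contra hcon
    rw [Set.mem_union, not_or, Set.mem_iUnion, not_exists] at hcon
    exact hω (key ω (not_not.mp hcon.1) fun S => not_not.mp (hcon.2 S))
  refine (measure_mono hsub).trans ((measure_union_le _ _).trans ?_)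
  have h0 : coins {ω | ¬ ∀ i, ω i ≠ 1} = 0 := BinSampling.coins_ae_ne_one
  rw [h0, zero_add]
  -- There are |K|^k events, each of probability at most 2 exp(-2(1 + bits)) ≤ exp(-bits) ≤ |K|^(-k)
  -- π; the last inequality uses log log (1/ε) ≥ 0.
  refine (measure_iUnion_fintype_le _ _).trans ((Finset.sum_le_sum fun S _ =>
    Input.coins_estimate_le hv (hadm fun i => S i)).trans ?_)
  rw [Finset.sum_const, Finset.card_univ, Fintype.card_fun, Fintype.card_coe, Fintype.card_fin,
    nsmul_eq_mul, ← ENNReal.ofReal_natCast, ← ENNReal.ofReal_mul (Nat.cast_nonneg _)]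
  refine ENNReal.ofReal_le_ofReal ?_
  have hb := hv.bits_pos
  have hmr : (0 : ℝ) < K.card := by exact_mod_cast hm
  have e1 : 2 * Real.exp (-(2 * (1 + I.bits))) ≤ Real.exp (-I.bits) := by
    have h1 : Real.exp (-(2 * (1 + I.bits))) ≤ Real.exp (-I.bits + -1) :=
      Real.exp_le_exp.mpr (by linarith)
    rw [Real.exp_add] at h1
    have h2 : Real.exp (-1) ≤ 1 / 2 := by
      rw [Real.exp_neg, ← one_div]
      refine one_div_le_one_div_of_le (by norm_num) ?_
      linarith [Real.add_one_le_exp (1 : ℝ)]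
    nlinarith [Real.exp_pos (-I.bits)]
  have e2 : Real.exp (-I.bits) ≤ Real.exp (-(k * Real.log K.card)) * π := by
    have h1 : -I.bits ≤ -(k * Real.log K.card) + Real.log π := by
      have h2 := hv.loglog_le
      have h3 := Input.Valid.loglog_three_pos
      have h4 : Real.log (1 / I.π) = -Real.log π := by rw [one_div, Real.log_inv]; rfl
      have h5 : I.bits = k * Real.log K.card + Real.log (Real.log (1 / I.ε)) +
        Real.log (1 / I.π) := rfl
      linarith
    calc Real.exp (-I.bits) ≤ Real.exp (-(k * Real.log K.card) + Real.log π) :=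
          Real.exp_le_exp.mpr h1
      _ = _ := by rw [Real.exp_add, Real.exp_log hπ]
  have e3 : ((K.card ^ k : ℕ) : ℝ) * Real.exp (-(k * Real.log K.card)) = 1 := by
    rw [Real.exp_neg, Real.exp_nat_mul, Real.exp_log hmr, Nat.cast_pow,
      mul_inv_cancel₀ (by positivity)]
  calc ((K.card ^ k : ℕ) : ℝ) * (2 * Real.exp (-(2 * (1 + I.bits)))) ≤
      ((K.card ^ k : ℕ) : ℝ) * (Real.exp (-(k * Real.log K.card)) * π) :=
        mul_le_mul_of_nonneg_left (e1.trans e2) (Nat.cast_nonneg _)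
    _ = π := by rw [← mul_assoc, e3, one_mul]
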